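/- **Setting.** A Smale space is a homeomorphism $\varphi$ of a compact metric space $X$ with a bracket $[\cdot,\cdot]$, defined for points at distance at most some $\varepsilon_X>0$, satisfying the usual axioms; $X^s(x)$, $X^u(x)$ are the stable and unstable sets, with their intrinsic topologies (basic neighbourhoods: the local stable, resp. unstable, sets). A map (continuous and equivariant) $f$ of Smale spaces is $s$-bijective (resp. $u$-bijective) if $f\colon X^s(x)\to Y^s(f(x))$ (resp. $f\colon X^u(x)\to Y^u(f(x))$) is a bijection for every $x$. An $s/u$-bijective pair $\pi=(Y,\psi,\pi_s,Z,\zeta,\pi_u)$ for $(X,\varphi)$ consists of Smale spaces $(Y,\psi)$, $(Z,\zeta)$, a surjective $s$-bijective map $\pi_s\colon Y\to X$ and a surjective $u$-bijective map $\pi_u\colon Z\to X$, such that all unstable sets of $Y$ and all stable sets of $Z$ are totally disconnected. For $L,M\ge 0$ let $$\Sigma_{L,M}=\{(y_0,\dots,y_L,z_0,\dots,z_M)\mid y_l\in Y,\ z_m\in Z,\ \pi_s(y_l)=\pi_u(z_m)\ \text{for all } l,m\},$$ with the coordinatewise dynamics and bracket. For such a space $\Sigma$ with dynamics $\sigma$,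 let $CO^s(\Sigma)$ be the family of compact open subsets of the stable sets $\Sigma^s(e)$, $e\in\Sigma$, and let $\sim$ be the smallest equivalence relation on it such that $E\sim F$ whenever $E$ and $F$ are contained in local stable sets, $[E,F]$ and $[F,E]$ are defined, and $[E,F]=E$, $[F,E]=F$; and such that $E\sim F$ if and only if $\sigma(E)\sim\sigma(F)$. The dimension group $D^s(\Sigma)$ is the free abelian group on the $\sim$-classes $[E]$ modulo the subgroup generated by the elements $[E\cup F]-[E]-[F]$, for disjoint $E,F\in CO^s(\Sigma)$ with $E\cup F\in CO^s(\Sigma)$. The maps below between the spaces $\Sigma_{L,M}$ that delete, repeat or permute the entries $y_l$ are $s$-bijective and induce homomorphisms $f^s\colon[E]\mapsto[f(E)]$. Put $C_{L,M}=D^s(\Sigma_{L,M})$ and $\partial^s=\sum_{l=0}^{L}(-1)^l\delta_l^s\colon C_{L,M}\to C_{L-1,M}$, where $\delta_l$ deletes the entry $y_l$ (and $\partial^s=0$ on $C_{0,M}$). For $L\ge1$, $0\le l\le L-1$ and $1\le j\le L-l$, let $\sigma_js_l\colon\Sigma_{L-1,M}\to\Sigma_{L,M}$ be the map that repeats $y_l$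 at coordinate $l+j$, $$(y_0,\dots,y_{L-1},z)\mapsto(y_0,\dots,y_l,\dots,y_{l+j-1},\,y_l,\,y_{l+j},\dots,y_{L-1},z).$$ Let the symmetric group $S_{L+1}$ act on $C_{L,M}$ by permuting $y_0,\dots,y_L$, and let $DC_{L,M}\subseteq C_{L,M}$ be the subgroup generated by the images $(\sigma_js_l)^s(C_{L-1,M})$ (none if $L=0$) and by all elements $\alpha(a)-\operatorname{sgn}(\alpha)a$ with $\alpha\in S_{L+1}$, $a\in C_{L,M}$. These subgroups form a subcomplex $DC_{\bullet,M}$ of the chain complex $(C_{\bullet,M},\partial^s)$. **Theorem.** Let $\pi$ be an $s/u$-bijective pair for a Smale space $(X,\varphi)$ and let $M\ge0$. In the short exact sequence of chain complexes $$0\to DC_{\bullet,M}\to C_{\bullet,M}\to C_{\bullet,M}/DC_{\bullet,M}\to0$$ the complex $DC_{\bullet,M}$ is acyclic; hence the projection $C_{\bullet,M}\to C_{\bullet,M}/DC_{\bullet,M}$ is a quasi-isomorphism. -/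

import Mathlib

namespace SmaleHomology

open Filter Topology

/-- `x` and `y` are asymptotic under `f`: `d(fⁿ x, fⁿ y) → 0`. -/
def Asymptotic {X : Type*} [MetricSpace X] (f : X → X) (x y : X) : Prop :=
  Tendsto (fun n : ℕ => dist (f^[n] x) (f^[n] y)) atTop (𝓝 0)

/-- The points asymptotic to `x` whose whole forward `f`-orbit stays `δ`-close to that of `x`. -/
def localSet {X : Type*} [MetricSpace X] (f : X → X) (x : X) (δ : ℝ) : Set X :=
  {y | Asymptotic f x y ∧ ∀ n : ℕ, dist (f^[n] x) (f^[n] y) < δ}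

/-- The topology in which the sets `localSet f x δ`, `δ > 0`, are basic neighbourhoods of `x`.
Each asymptotic class is open, and carries its intrinsic (inductive limit) topology. -/
@[reducible]
def leafTopology {X : Type*} [MetricSpace X] (f : X → X) : TopologicalSpace X where
  IsOpen U := ∀ x ∈ U, ∃ δ > 0, localSet f x δ ⊆ U
  isOpen_univ := fun _ _ => ⟨1, one_pos, Set.subset_univ _⟩
  isOpen_inter := by
    rintro U V hU hV x ⟨hxU, hxV⟩
    obtain ⟨a, ha, hUa⟩ := hU x hxU
    obtain ⟨b, hb, hVb⟩ := hV x hxV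
    refine ⟨min a b, lt_min ha hb, fun y hy => ⟨hUa ⟨hy.1, fun n => ?_⟩, hVb ⟨hy.1, fun n => ?_⟩⟩⟩
    · exact (hy.2 n).trans_le (min_le_left _ _)
    · exact (hy.2 n).trans_le (min_le_right _ _)
  isOpen_sUnion := by
    rintro 𝒰 h𝒰 x ⟨U, hU, hxU⟩
    obtain ⟨a, ha, hUa⟩ := h𝒰 U hU x hxU
    exact ⟨a, ha, hUa.trans (Set.subset_sUnion_of_mem hU)⟩

/-- A Smale space structure `(φ, [·,·], ε, λ)` on a (compact) metric space. The bracket is only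
meaningful for pairs of points at distance at most `ε`; `[x, y]` is the intersection of the
local stable set of `x` with the local unstable set of `y`. -/
structure SmaleSpace (X : Type*) [MetricSpace X] where
  φ : X ≃ₜ X
  bracket : X → X → X
  eps : ℝ
  lam : ℝ
  eps_pos : 0 < eps
  lam_pos : 0 < lam
  lam_lt_one : lam < 1
  continuousOn_bracket :
    ContinuousOn (fun p : X × X => bracket p.1 p.2) {p | dist p.1 p.2 ≤ eps}
  bracket_self : ∀ x, bracket x x = x
  bracket_right : ∀ x y z, dist y z ≤ eps → dist x (bracket y z) ≤ eps → dist x z ≤ eps →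
    bracket x (bracket y z) = bracket x z
  bracket_left : ∀ x y z, dist x y ≤ eps → dist (bracket x y) z ≤ eps → dist x z ≤ eps →
    bracket (bracket x y) z = bracket x z
  map_bracket : ∀ x y, dist x y ≤ eps → dist (φ x) (φ y) ≤ eps →
    φ (bracket x y) = bracket (φ x) (φ y)
  contract : ∀ y z, dist y z ≤ eps → bracket y z = z → dist (φ y) (φ z) ≤ lam * dist y z
  expand : ∀ y z, dist y z ≤ eps → bracket y z = y →
    dist (φ.symm y) (φ.symm z) ≤ lam * dist y z

namespace SmaleSpace

variable {X : Type*} [MetricSpace X]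

/-- The global stable set `X^s(x)`. -/
def stableSet (S : SmaleSpace X) (x : X) : Set X := {y | Asymptotic S.φ x y}

/-- The global unstable set `X^u(x)`. -/
def unstableSet (S : SmaleSpace X) (x : X) : Set X := {y | Asymptotic S.φ.symm x y}

/-- The same space run backwards in time. -/
def reverse (S : SmaleSpace X) : SmaleSpace X where
  φ := S.φ.symm
  bracket x y := S.bracket y x
  eps := S.eps
  lam := S.lam
  eps_pos := S.eps_pos
  lam_pos := S.lam_pos
  lam_lt_one := S.lam_lt_one
  continuousOn_bracket := by
    refine S.continuousOn_bracket.comp continuous_swap.continuousOn ?_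
    intro p hp
    simpa [dist_comm] using hp
  bracket_self := S.bracket_self
  bracket_right x y z h1 h2 h3 := by
    rw [dist_comm] at h1 h2 h3
    exact S.bracket_left z y x h1 h2 h3
  bracket_left x y z h1 h2 h3 := by
    rw [dist_comm] at h1 h2 h3
    exact S.bracket_right z y x h1 h2 h3
  map_bracket x y h1 h2 := by
    rw [dist_comm] at h1 h2
    have := S.map_bracket (S.φ.symm y) (S.φ.symm x) h2 (by simpa using h1)
    rw [S.φ.symm_apply_eq, this]
    simp
  contract y z h1 h2 := by
    rw [dist_comm] at h1
    rw [dist_comm, dist_comm y z]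
    exact S.expand z y h1 h2
  expand y z h1 h2 := by
    rw [dist_comm] at h1
    rw [dist_comm, dist_comm y z]
    exact S.contract z y h1 h2

lemma near_diag [CompactSpace X] (S : SmaleSpace X) {η : ℝ} (hη : 0 < η) :
    ∃ δ > 0, δ ≤ S.eps ∧ ∀ x y, dist x y ≤ δ →
      dist (S.bracket x y) x < η ∧ dist (S.bracket x y) y < η := by
  have hc : IsCompact {p : X × X | dist p.1 p.2 ≤ S.eps} :=
    (isClosed_le continuous_dist continuous_const).isCompact
  have hu := hc.uniformContinuousOn_of_continuous S.continuousOn_bracket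
  rw [Metric.uniformContinuousOn_iff] at hu
  obtain ⟨δ, hδ, h⟩ := hu η hη
  have he := S.eps_pos
  refine ⟨min S.eps (δ / 2), by positivity, min_le_left _ _, fun x y hxy => ?_⟩
  have h1 : dist x y ≤ S.eps := hxy.trans (min_le_left _ _)
  have h2 : dist x y < δ := (hxy.trans (min_le_right _ _)).trans_lt (by linarith)
  constructor
  · have := h (x, y) h1 (x, x) (by simp [he.le]) (by simpa [Prod.dist_eq, dist_comm, hδ] using h2)
    simpa [S.bracket_self] using this
  · have := h (x, y) h1 (y, y) (by simp [he.le]) (by simpa [Prod.dist_eq, hδ] using h2)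
    simpa [S.bracket_self] using this

lemma iterate_bracket (S : SmaleSpace X) {a b : X}
    (h : ∀ n : ℕ, dist (S.φ^[n] a) (S.φ^[n] b) ≤ S.eps) (n : ℕ) :
    S.φ^[n] (S.bracket a b) = S.bracket (S.φ^[n] a) (S.φ^[n] b) := by
  induction n with
  | zero => rfl
  | succ n ih =>
    have h2 := h (n + 1)
    simp only [Function.iterate_succ_apply'] at h2 ⊢
    rw [ih, S.map_bracket _ _ (h n) h2]

lemma contract_iterate (S : SmaleSpace X) {y z : X} (h : dist y z ≤ S.eps)
    (hb : S.bracket y z = z) (n : ℕ) :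
    dist (S.φ^[n] y) (S.φ^[n] z) ≤ S.lam ^ n * dist y z ∧
      S.bracket (S.φ^[n] y) (S.φ^[n] z) = S.φ^[n] z := by
  have key : ∀ k : ℕ, S.lam ^ k * dist y z ≤ S.eps := fun k =>
    (mul_le_of_le_one_left dist_nonneg (pow_le_one₀ S.lam_pos.le S.lam_lt_one.le)).trans h
  induction n with
  | zero => simpa using hb
  | succ n ih =>
    simp only [Function.iterate_succ_apply']
    have h1 := S.contract _ _ (ih.1.trans (key n)) ih.2
    have h2 : dist (S.φ (S.φ^[n] y)) (S.φ (S.φ^[n] z)) ≤ S.lam ^ (n + 1) * dist y z := by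
      refine h1.trans ?_
      rw [pow_succ', mul_assoc]
      exact mul_le_mul_of_nonneg_left ih.1 S.lam_pos.le
    refine ⟨h2, ?_⟩
    rw [← S.map_bracket _ _ (ih.1.trans (key n)) (h2.trans (key _)), ih.2]

lemma asymptotic_of_bracket (S : SmaleSpace X) {y z : X} (h : dist y z ≤ S.eps)
    (hb : S.bracket y z = z) : Asymptotic S.φ y z := by
  refine squeeze_zero (fun _ => dist_nonneg) (fun n => (S.contract_iterate h hb n).1) ?_
  simpa using (tendsto_pow_atTop_nhds_zero_of_lt_one S.lam_pos.le S.lam_lt_one).mul_const (dist y z)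

/-- Points whose forward orbits stay close lie on the same local stable set. -/
lemma exists_forward [CompactSpace X] (S : SmaleSpace X) : ∃ δ > 0, δ ≤ S.eps ∧ ∀ a b,
    (∀ n : ℕ, dist (S.φ^[n] a) (S.φ^[n] b) ≤ δ) → S.bracket a b = b := by
  obtain ⟨δ, hδ, hδe, hd⟩ := S.near_diag S.eps_pos
  refine ⟨δ, hδ, hδe, fun a b hab => ?_⟩
  set c := S.bracket a b with hc
  have hit := S.iterate_bracket (fun n => (hab n).trans hδe)
  have key : ∀ n : ℕ, dist c b ≤ S.lam ^ n * S.eps := by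
    intro n
    have h1 : dist (S.φ^[n] c) (S.φ^[n] b) ≤ S.eps := by
      rw [hc, hit]
      exact (hd _ _ (hab n)).2.le
    have h2 : S.bracket (S.φ^[n] c) (S.φ^[n] b) = S.φ^[n] c := by
      rw [hc, hit] at h1 ⊢
      exact S.bracket_left _ _ _ ((hab n).trans hδe) h1 ((hab n).trans hδe)
    have h3 := (S.reverse.contract_iterate (y := S.φ^[n] b) (z := S.φ^[n] c)
      (by rw [dist_comm]; exact h1) h2 n).1
    have inv : ∀ x, (S.reverse.φ)^[n] (S.φ^[n] x) = x :=
      fun x => (Function.LeftInverse.iterate S.φ.symm_apply_apply n) x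
    rw [inv, inv] at h3
    rw [dist_comm]
    refine h3.trans ?_
    rw [dist_comm]
    exact mul_le_mul_of_nonneg_left h1 (pow_nonneg S.lam_pos.le _)
  have lim : Tendsto (fun n : ℕ => S.lam ^ n * S.eps) atTop (𝓝 0) := by
    simpa using (tendsto_pow_atTop_nhds_zero_of_lt_one S.lam_pos.le S.lam_lt_one).mul_const S.eps
  exact dist_le_zero.mp (ge_of_tendsto lim (Eventually.of_forall key))

/-- Smale spaces are expansive. -/
lemma exists_expansive [CompactSpace X] (S : SmaleSpace X) : ∃ δ > 0, ∀ a b,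
    (∀ n : ℕ, dist (S.φ^[n] a) (S.φ^[n] b) ≤ δ) →
    (∀ n : ℕ, dist (S.φ.symm^[n] a) (S.φ.symm^[n] b) ≤ δ) → a = b := by
  obtain ⟨δ, hδ, -, h⟩ := S.exists_forward
  obtain ⟨δ', hδ', -, h'⟩ := S.reverse.exists_forward
  refine ⟨min δ δ', lt_min hδ hδ', fun a b h1 h2 => ?_⟩
  have e1 := h a b fun n => (h1 n).trans (min_le_left _ _)
  have e2 := h' b a fun n => by
    rw [dist_comm]; exact (h2 n).trans (min_le_right _ _)
  exact e2.symm.trans e1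

lemma dist_bracket_lt (R : SmaleSpace X) (u v : X) (ρ : ℝ) (huv : dist u v ≤ R.eps)
    (hlt : dist (R.bracket u v) u < min R.eps ρ) (n : ℕ) :
    dist (R.φ^[n] u) (R.φ^[n] (R.bracket u v)) < ρ := by
  have h1 : dist u (R.bracket u v) ≤ R.eps := by
    rw [dist_comm]; exact hlt.le.trans (min_le_left _ _)
  have h2 : R.bracket u (R.bracket u v) = R.bracket u v :=
    R.bracket_right _ _ _ huv h1 huv
  refine lt_of_le_of_lt (R.contract_iterate h1 h2 n).1 ?_
  refine lt_of_le_of_lt (mul_le_of_le_one_left dist_nonneg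
    (pow_le_one₀ R.lam_pos.le R.lam_lt_one.le)) ?_
  rw [dist_comm]
  exact hlt.trans_le (min_le_right _ _)

/-- Continuous equivariant maps preserve the bracket of sufficiently close points. -/
lemma exists_map_bracket [CompactSpace X] {W : Type*} [MetricSpace W] [CompactSpace W]
    (S : SmaleSpace X) (T : SmaleSpace W) (f : X → W) (hf : Continuous f)
    (he : ∀ x, f (S.φ x) = T.φ (f x)) :
    ∃ r > 0, r ≤ S.eps ∧ ∀ x y, dist x y ≤ r → dist (f x) (f y) ≤ T.eps ∧
      f (S.bracket x y) = T.bracket (f x) (f y) := by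
  obtain ⟨δ, hδ, hexp⟩ := T.exists_expansive
  obtain ⟨a, ha, hae, hA⟩ := T.near_diag (lt_min T.eps_pos (half_pos hδ))
  have hu := CompactSpace.uniformContinuous_of_continuous hf
  rw [Metric.uniformContinuous_iff] at hu
  obtain ⟨b, hb, hB⟩ := hu a ha
  obtain ⟨c, hc, hC⟩ := hu (δ / 2) (half_pos hδ)
  obtain ⟨r, hr, hre, hR⟩ := S.near_diag (lt_min S.eps_pos hc)
  refine ⟨min r (b / 2), by positivity, (min_le_left _ _).trans hre, fun x y hxy => ?_⟩
  have hxr : dist x y ≤ r := hxy.trans (min_le_left _ _)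
  have hxe : dist x y ≤ S.eps := hxr.trans hre
  have hfa : dist (f x) (f y) < a :=
    hB ((hxy.trans (min_le_right _ _)).trans_lt (half_lt_self hb))
  have hfe : dist (f x) (f y) ≤ T.eps := hfa.le.trans hae
  refine ⟨hfe, ?_⟩
  have hes : ∀ x, f (S.φ.symm x) = T.φ.symm (f x) := fun x => by
    rw [T.φ.eq_symm_apply, ← he, S.φ.apply_symm_apply]
  have hit : ∀ (n : ℕ) x, T.φ^[n] (f x) = f (S.φ^[n] x) := fun n x =>
    ((Function.Semiconj.iterate_right (f := f) he n) x).symm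
  have hits : ∀ (n : ℕ) x, T.φ.symm^[n] (f x) = f (S.φ.symm^[n] x) := fun n x =>
    ((Function.Semiconj.iterate_right (f := f) hes n) x).symm
  refine hexp _ _ (fun n => ?_) (fun n => ?_)
  · have h1 := hC (dist_bracket_lt S x y c hxe (hR x y hxr).1 n)
    have h2 := dist_bracket_lt T (f x) (f y) (δ / 2) hfe (hA _ _ hfa.le).1 n
    rw [hit] at h2 ⊢
    refine (dist_triangle_left _ _ (f (S.φ^[n] x))).trans ?_
    linarith
  · have h1 := hC (dist_bracket_lt S.reverse y x c (by rw [dist_comm]; exact hxe) (hR x y hxr).2 n)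
    have h2 := dist_bracket_lt T.reverse (f y) (f x) (δ / 2) (by rw [dist_comm]; exact hfe)
      (hA _ _ hfa.le).2 n
    change dist (f (S.φ.symm^[n] y)) (f (S.φ.symm^[n] (S.bracket x y))) < _ at h1
    change dist (T.φ.symm^[n] (f y)) (T.φ.symm^[n] (T.bracket (f x) (f y))) < _ at h2
    rw [hits] at h2 ⊢
    refine (dist_triangle_left _ _ (f (S.φ.symm^[n] y))).trans ?_
    linarith

end SmaleSpace

/-- A map of Smale spaces: continuous and equivariant. -/
structure IsMap {X W : Type*} [MetricSpace X] [MetricSpace W] (S : SmaleSpace X)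
    (T : SmaleSpace W) (f : X → W) : Prop where
  continuous : Continuous f
  map_φ : ∀ x, f (S.φ x) = T.φ (f x)

/-- `f` is `s`-bijective: it restricts to bijections `X^s(x) → W^s(f x)`. -/
structure IsSBijective {X W : Type*} [MetricSpace X] [MetricSpace W] (S : SmaleSpace X)
    (T : SmaleSpace W) (f : X → W) : Prop extends IsMap S T f where
  bijOn : ∀ x, Set.BijOn f (S.stableSet x) (T.stableSet (f x))

/-- `f` is `u`-bijective: it restricts to bijections `X^u(x) → W^u(f x)`. -/
structure IsUBijective {X W : Type*} [MetricSpace X] [MetricSpace W] (S : SmaleSpace X)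
    (T : SmaleSpace W) (f : X → W) : Prop extends IsMap S T f where
  bijOn : ∀ x, Set.BijOn f (S.unstableSet x) (T.unstableSet (f x))

section Leaf

variable {X W : Type*} [MetricSpace X] [MetricSpace W] {S : SmaleSpace X} {T : SmaleSpace W}
  {f : X → W}

lemma Asymptotic.symm {g : X → X} {x y : X} (h : Asymptotic g x y) : Asymptotic g y x := by
  simpa only [Asymptotic, dist_comm] using h

lemma Asymptotic.trans {g : X → X} {x y z : X} (h : Asymptotic g x y) (h' : Asymptotic g y z) :
    Asymptotic g x z :=
  squeeze_zero (fun _ => dist_nonneg) (fun _ => dist_triangle _ _ _) (by simpa using h.add h')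

lemma Asymptotic.tail {g : X → X} {x y : X} (k : ℕ) (h : Asymptotic g (g^[k] x) (g^[k] y)) :
    Asymptotic g x y := by
  have : Tendsto (fun n : ℕ => dist (g^[n + k] x) (g^[n + k] y)) atTop (𝓝 0) := by
    simp only [Function.iterate_add_apply]
    exact h
  exact (tendsto_add_atTop_iff_nat k).mp this

lemma IsMap.iterate (hf : IsMap S T f) (n : ℕ) (x : X) : f (S.φ^[n] x) = T.φ^[n] (f x) :=
  (Function.Semiconj.iterate_right (f := f) hf.map_φ n) x

/-- `s`-bijective maps are open for the leaf topologies: lifts of close points are close. -/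
lemma IsSBijective.exists_lift_close [CompactSpace X] (hf : IsSBijective S T f) {ε : ℝ}
    (hε : 0 < ε) : ∃ δ > 0, ∀ y y', Asymptotic S.φ y y' → f y' ∈ localSet T.φ (f y) δ →
      y' ∈ localSet S.φ y ε := by
  obtain ⟨ε₀, hε₀, hε₀e, hfw⟩ := S.exists_forward
  set e := min ε ε₀ with he
  have he0 : 0 < e := lt_min hε hε₀
  suffices h : ∃ δ > 0, ∀ y y', Asymptotic S.φ y y' → f y' ∈ localSet T.φ (f y) δ →
      y' ∈ localSet S.φ y e by
    obtain ⟨δ, hδ, h⟩ := h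
    exact ⟨δ, hδ, fun y y' h1 h2 =>
      ⟨h1, fun n => ((h y y' h1 h2).2 n).trans_le (min_le_left _ _)⟩⟩
  by_contra hcon
  push Not at hcon
  -- pairs that are `e`-apart now, but `e`-close at all later times, with close images
  have step : ∀ n : ℕ, ∃ p : X × X, e ≤ dist p.1 p.2 ∧
      (∀ j : ℕ, dist (S.φ^[j + 1] p.1) (S.φ^[j + 1] p.2) ≤ e) ∧
      dist (f p.1) (f p.2) ≤ 1 / ((n : ℝ) + 1) := by
    intro n
    obtain ⟨y, y', h1, h2, h3⟩ := hcon (1 / ((n : ℝ) + 1)) (by positivity)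
    have h4 : ∃ k : ℕ, e ≤ dist (S.φ^[k] y) (S.φ^[k] y') := by
      by_contra hno
      push Not at hno
      exact h3 ⟨h1, hno⟩
    obtain ⟨N, hN⟩ := eventually_atTop.mp ((tendsto_order.mp h1).2 e he0)
    classical
    let k := Nat.findGreatest (fun k => e ≤ dist (S.φ^[k] y) (S.φ^[k] y')) N
    have hk : e ≤ dist (S.φ^[k] y) (S.φ^[k] y') := by
      obtain ⟨k₀, hk₀⟩ := h4
      refine Nat.findGreatest_spec (P := fun k => e ≤ dist (S.φ^[k] y) (S.φ^[k] y')) (m := k₀)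
        ?_ hk₀
      by_contra hlt
      exact absurd hk₀ (not_le.mpr (hN k₀ (not_le.mp hlt).le))
    refine ⟨(S.φ^[k] y, S.φ^[k] y'), hk, fun j => ?_, ?_⟩
    · rw [← Function.iterate_add_apply, ← Function.iterate_add_apply]
      by_contra hlt
      have hlt' := (not_le.mp hlt).le
      rcases le_or_gt (j + 1 + k) N with hjN | hjN
      · exact Nat.findGreatest_is_greatest
          (P := fun k => e ≤ dist (S.φ^[k] y) (S.φ^[k] y')) (show k < j + 1 + k by omega) hjN hlt'
      · exact absurd hlt' (not_le.mpr (hN _ hjN.le))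
    · simp only [hf.iterate]
      exact (h2.2 k).le
  choose p hp1 hp2 hp3 using step
  obtain ⟨q, -, s, hs, hlim⟩ := isCompact_univ.tendsto_subseq (x := p) (fun n => Set.mem_univ _)
  have q1 : e ≤ dist q.1 q.2 :=
    ge_of_tendsto ((continuous_dist.tendsto q).comp hlim) (Eventually.of_forall fun n => hp1 _)
  have hit : ∀ j : ℕ, Continuous (S.φ^[j]) := fun j => S.φ.continuous.iterate j
  have q2 : ∀ j : ℕ, dist (S.φ^[j + 1] q.1) (S.φ^[j + 1] q.2) ≤ e := fun j => by
    have hc : Continuous fun p : X × X => dist (S.φ^[j + 1] p.1) (S.φ^[j + 1] p.2) :=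
      ((hit _).comp continuous_fst).dist ((hit _).comp continuous_snd)
    exact le_of_tendsto ((hc.tendsto q).comp hlim) (Eventually.of_forall fun n => hp2 _ j)
  have q3 : f q.1 = f q.2 := by
    have hc : Continuous fun p : X × X => dist (f p.1) (f p.2) :=
      (hf.continuous.comp continuous_fst).dist (hf.continuous.comp continuous_snd)
    have h0 : Tendsto (fun n => 1 / (((s n : ℕ) : ℝ) + 1)) atTop (𝓝 0) :=
      tendsto_one_div_add_atTop_nhds_zero_nat.comp hs.tendsto_atTop
    exact dist_le_zero.mp
      (le_of_tendsto_of_tendsto' ((hc.tendsto q).comp hlim) h0 fun n => hp3 _)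
  have has : Asymptotic S.φ q.1 q.2 := by
    refine Asymptotic.tail 1 ?_
    have hb := hfw (S.φ^[1] q.1) (S.φ^[1] q.2) fun n => by
      rw [← Function.iterate_add_apply, ← Function.iterate_add_apply]
      exact (q2 n).trans (min_le_right _ _)
    exact S.asymptotic_of_bracket ((q2 0).trans ((min_le_right _ _).trans hε₀e)) hb
  have hself : q.1 ∈ S.stableSet q.1 := by
    simp [SmaleSpace.stableSet, Asymptotic]
  have := (hf.bijOn q.1).injOn hself has q3
  rw [this, dist_self] at q1
  linarith

lemma IsMap.asymptotic [CompactSpace X] (hf : IsMap S T f) {x y : X}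
    (h : Asymptotic S.φ x y) : Asymptotic T.φ (f x) (f y) := by
  have hu := CompactSpace.uniformContinuous_of_continuous hf.continuous
  rw [Metric.uniformContinuous_iff] at hu
  refine Metric.tendsto_atTop.mpr fun ε hε => ?_
  obtain ⟨δ, hδ, hd⟩ := hu ε hε
  obtain ⟨N, hN⟩ := Metric.tendsto_atTop.mp h δ hδ
  refine ⟨N, fun n hn => ?_⟩
  have h1 := hN n hn
  rw [Real.dist_eq, sub_zero, abs_of_nonneg dist_nonneg] at h1 ⊢
  rw [← hf.iterate, ← hf.iterate]
  exact hd h1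

lemma IsMap.continuous_leaf [CompactSpace X] (hf : IsMap S T f) :
    @Continuous X W (leafTopology S.φ) (leafTopology T.φ) f := by
  have hu := CompactSpace.uniformContinuous_of_continuous hf.continuous
  rw [Metric.uniformContinuous_iff] at hu
  refine @Continuous.mk _ _ (leafTopology S.φ) (leafTopology T.φ) _ fun U hU x hx => ?_
  obtain ⟨ε, hε, hεU⟩ := hU (f x) hx
  obtain ⟨δ, hδ, hd⟩ := hu ε hε
  refine ⟨δ, hδ, fun y hy => hεU ⟨hf.asymptotic hy.1, fun n => ?_⟩⟩
  rw [← hf.iterate, ← hf.iterate]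
  exact hd (hy.2 n)

lemma IsSBijective.isOpen_image [CompactSpace X] (hf : IsSBijective S T f) {U : Set X}
    (hU : IsOpen[leafTopology S.φ] U) : IsOpen[leafTopology T.φ] (f '' U) := by
  rintro _ ⟨x, hx, rfl⟩
  obtain ⟨ε, hε, hεU⟩ := hU x hx
  obtain ⟨δ, hδ, hd⟩ := hf.exists_lift_close hε
  refine ⟨δ, hδ, fun w hw => ?_⟩
  obtain ⟨y, hy, rfl⟩ := (hf.bijOn x).surjOn hw.1
  exact ⟨y, hεU (hd x y hy hw), rfl⟩

end Leaf

/-- `CO^s`: the compact open subsets of the stable orbits, for the intrinsic topology. -/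
def CompactOpen {X : Type*} [MetricSpace X] (S : SmaleSpace X) : Type _ :=
  {E : Set X // (∃ e, E ⊆ S.stableSet e) ∧ @IsCompact X (leafTopology S.φ) E ∧
    IsOpen[leafTopology S.φ] E}

/-- The smallest equivalence relation on `CO^s` that is invariant under `φ` (in both directions)
and satisfies `E ∼ F` whenever `[E, F] = E` and `[F, E] = F`, where `E` and `F` lie in local
stable sets and are so close that `[E, F]` and `[F, E]` are defined. -/
inductive DimRel {X : Type*} [MetricSpace X] (S : SmaleSpace X) :
    CompactOpen S → CompactOpen S → Prop
  | bracket (E F : CompactOpen S)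
      (hE : ∃ e, E.1 ⊆ localSet S.φ e (S.eps / 2)) (hF : ∃ f, F.1 ⊆ localSet S.φ f (S.eps / 2))
      (hEF : ∀ x ∈ E.1, ∀ y ∈ F.1, dist x y ≤ S.eps)
      (h₁ : Set.image2 S.bracket E.1 F.1 = E.1) (h₂ : Set.image2 S.bracket F.1 E.1 = F.1) :
      DimRel S E F
  | shift (E F E' F' : CompactOpen S) (hE : E'.1 = S.φ '' E.1) (hF : F'.1 = S.φ '' F.1)
      (h : DimRel S E F) : DimRel S E' F'
  | unshift (E F E' F' : CompactOpen S) (hE : E'.1 = S.φ '' E.1) (hF : F'.1 = S.φ '' F.1)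
      (h : DimRel S E' F') : DimRel S E F
  | refl (E : CompactOpen S) : DimRel S E E
  | symm (E F : CompactOpen S) (h : DimRel S E F) : DimRel S F E
  | trans (E F G : CompactOpen S) (h : DimRel S E F) (h' : DimRel S F G) : DimRel S E G

/-- The equivalence relation `∼` on `CO^s`. -/
def dimSetoid {X : Type*} [MetricSpace X] (S : SmaleSpace X) : Setoid (CompactOpen S) where
  r := DimRel S
  iseqv := ⟨DimRel.refl, DimRel.symm _ _, DimRel.trans _ _ _⟩

/-- The generator of the free abelian group given by the class of `E`. -/
def dimGen {X : Type*} [MetricSpace X] {S : SmaleSpace X} (E : CompactOpen S) :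
    FreeAbelianGroup (Quotient (dimSetoid S)) :=
  FreeAbelianGroup.of (Quotient.mk (dimSetoid S) E)

/-- The relations `[E ∪ F] = [E] + [F]` for disjoint `E`, `F` (with `E ∪ F` in `CO^s`). -/
def dimRelations {X : Type*} [MetricSpace X] (S : SmaleSpace X) :
    AddSubgroup (FreeAbelianGroup (Quotient (dimSetoid S))) :=
  AddSubgroup.closure {x | ∃ E F G : CompactOpen S, Disjoint E.1 F.1 ∧ G.1 = E.1 ∪ F.1 ∧
    x = dimGen G - dimGen E - dimGen F}

/-- The (stable) dimension group `D^s`. -/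
abbrev DimGroup {X : Type*} [MetricSpace X] (S : SmaleSpace X) : Type _ :=
  FreeAbelianGroup (Quotient (dimSetoid S)) ⧸ dimRelations S

/-- The class `[E] ∈ D^s` of a compact open set. -/
def dimClass {X : Type*} [MetricSpace X] {S : SmaleSpace X} (E : CompactOpen S) : DimGroup S :=
  QuotientAddGroup.mk (dimGen E)

/-- `s`-bijective maps that strictly respect scales and brackets. (Any `s`-bijective map respects
brackets of close enough points; all the maps considered below do so at the given scale.) -/
structure IsStrict {X W : Type*} [MetricSpace X] [MetricSpace W] (S : SmaleSpace X)
    (T : SmaleSpace W) (f : X → W) : Prop extends IsSBijective S T f where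
  eps_eq : S.eps = T.eps
  dist_le : ∀ x y, dist (f x) (f y) ≤ dist x y
  map_bracket : ∀ x y, dist x y ≤ S.eps → f (S.bracket x y) = T.bracket (f x) (f y)

lemma dimGroup_hom_ext {X : Type*} [MetricSpace X] {S : SmaleSpace X} {A : Type*} [AddCommGroup A] {u v : DimGroup S →+ A}
    (h : ∀ E, u (dimClass E) = v (dimClass E)) : u = v := by
  refine QuotientAddGroup.addMonoidHom_ext _ (FreeAbelianGroup.lift_ext _ _ ?_)
  intro q
  induction q using Quotient.inductionOn with
  | h E => exact h E

section Functor

variable {X W V : Type*} [MetricSpace X] [MetricSpace W] [MetricSpace V] [CompactSpace X] {S : SmaleSpace X} {T : SmaleSpace W} {R : SmaleSpace V} {f : X → W} {g : W → V}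

/-- The image of a compact open set under an `s`-bijective map. -/
def CompactOpen.map (hf : IsSBijective S T f) (E : CompactOpen S) : CompactOpen T :=
  ⟨f '' E.1, by
    obtain ⟨E, ⟨e, he⟩, hc, ho⟩ := E
    refine ⟨⟨f e, ?_⟩, ?_, hf.isOpen_image ho⟩
    · exact ((hf.bijOn e).mapsTo.mono_left he).image_subset
    · exact @IsCompact.image X W (leafTopology S.φ) (leafTopology T.φ) E f hc
        hf.toIsMap.continuous_leaf⟩

lemma DimRel.map (hf : IsStrict S T f) {E F : CompactOpen S} (h : DimRel S E F) :
    DimRel T (E.map hf.toIsSBijective) (F.map hf.toIsSBijective) := by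
  have hφ : ∀ A : Set X, f '' (S.φ '' A) = T.φ '' (f '' A) := fun A => by
    rw [Set.image_image, Set.image_image]
    exact Set.image_congr fun x _ => hf.map_φ x
  have hloc : ∀ (A : Set X), (∃ e, A ⊆ localSet S.φ e (S.eps / 2)) →
      ∃ e, f '' A ⊆ localSet T.φ e (T.eps / 2) := by
    rintro A ⟨e, he⟩
    refine ⟨f e, ?_⟩
    rintro _ ⟨x, hx, rfl⟩
    refine ⟨hf.toIsMap.asymptotic (he hx).1, fun n => ?_⟩
    rw [← hf.toIsMap.iterate, ← hf.toIsMap.iterate, ← hf.eps_eq]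
    exact (hf.dist_le _ _).trans_lt ((he hx).2 n)
  induction h with
  | bracket E F hE hF hEF h₁ h₂ =>
    refine DimRel.bracket _ _ (hloc _ hE) (hloc _ hF) ?_ ?_ ?_
    · rintro _ ⟨x, hx, rfl⟩ _ ⟨y, hy, rfl⟩
      rw [← hf.eps_eq]
      exact (hf.dist_le _ _).trans (hEF x hx y hy)
    · change Set.image2 T.bracket (f '' E.1) (f '' F.1) = f '' E.1
      conv_rhs => rw [← h₁]
      rw [Set.image2_image_left, Set.image2_image_right, Set.image_image2]
      exact Set.image2_congr fun x hx y hy => (hf.map_bracket x y (hEF x hx y hy)).symm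
    · change Set.image2 T.bracket (f '' F.1) (f '' E.1) = f '' F.1
      conv_rhs => rw [← h₂]
      rw [Set.image2_image_left, Set.image2_image_right, Set.image_image2]
      exact Set.image2_congr fun x hx y hy =>
        (hf.map_bracket x y (by rw [dist_comm]; exact hEF y hy x hx)).symm
  | shift E F E' F' hE hF _ ih =>
    refine DimRel.shift _ _ _ _ ?_ ?_ ih
    · change f '' E'.1 = _
      rw [hE, hφ]; rfl
    · change f '' F'.1 = _
      rw [hF, hφ]; rfl
  | unshift E F E' F' hE hF _ ih =>
    refine DimRel.unshift _ _ _ _ ?_ ?_ ih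
    · change f '' E'.1 = _
      rw [hE, hφ]; rfl
    · change f '' F'.1 = _
      rw [hF, hφ]; rfl
  | refl E => exact DimRel.refl _
  | symm E F _ ih => exact DimRel.symm _ _ ih
  | trans E F G _ _ ih ih' => exact DimRel.trans _ _ _ ih ih'

/-- The homomorphism `f^s : D^s(X) → D^s(W)`, `[E] ↦ [f(E)]`. -/
def dimMap (hf : IsStrict S T f) : DimGroup S →+ DimGroup T :=
  QuotientAddGroup.map (dimRelations S) (dimRelations T)
    (FreeAbelianGroup.map (Quotient.map (sa := dimSetoid S) (sb := dimSetoid T)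
      (CompactOpen.map hf.toIsSBijective) fun _ _ h => DimRel.map hf h)) (by
    refine (AddSubgroup.closure_le _).mpr ?_
    rintro _ ⟨E, F, G, hd, hG, rfl⟩
    refine AddSubgroup.subset_closure ⟨E.map hf.toIsSBijective, F.map hf.toIsSBijective,
      G.map hf.toIsSBijective, ?_, ?_, ?_⟩
    · obtain ⟨e, he⟩ := G.2.1
      rw [hG] at he
      exact Set.disjoint_image_image fun x hx y hy hxy =>
        Set.disjoint_left.mp hd hx ((hf.bijOn e).injOn (he (Or.inl hx)) (he (Or.inr hy)) hxy ▸ hy)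
    · change f '' G.1 = _
      rw [hG, Set.image_union]; rfl
    · simp only [map_sub]
      rfl)

lemma dimMap_dimClass (hf : IsStrict S T f) (E : CompactOpen S) :
    dimMap hf (dimClass E) = dimClass (E.map hf.toIsSBijective) := rfl

lemma dimMap_comp [CompactSpace W] (hf : IsStrict S T f) (hg : IsStrict T R g) (hgf : IsStrict S R (g ∘ f))
    (x : DimGroup S) : dimMap hgf x = dimMap hg (dimMap hf x) := by
  suffices h : dimMap hgf = (dimMap hg).comp (dimMap hf) by rw [h]; rfl
  refine dimGroup_hom_ext fun E => ?_
  simp only [AddMonoidHom.comp_apply, dimMap_dimClass]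
  congr 1
  exact Subtype.ext (Set.image_comp g f E.1)

lemma dimMap_id (h : IsStrict S S id) (x : DimGroup S) : dimMap h x = x := by
  suffices h' : dimMap h = AddMonoidHom.id _ by rw [h']; rfl
  refine dimGroup_hom_ext fun E => ?_
  simp only [AddMonoidHom.id_apply, dimMap_dimClass]
  congr 1
  exact Subtype.ext (Set.image_id E.1)

end Functor

/-- An `s/u`-bijective pair `(Y, ψ, π_s, Z, ζ, π_u)` for a Smale space `(X, φ)`. -/
structure SUPair {X Y Z : Type*} [MetricSpace X] [MetricSpace Y] [MetricSpace Z]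
    (SX : SmaleSpace X) (SY : SmaleSpace Y) (SZ : SmaleSpace Z) where
  πs : Y → X
  πu : Z → X
  πs_sBijective : IsSBijective SY SX πs
  πu_uBijective : IsUBijective SZ SX πu
  πs_surjective : Function.Surjective πs
  πu_surjective : Function.Surjective πu
  unstable_totallyDisconnected :
    ∀ y, @IsTotallyDisconnected Y (leafTopology SY.φ.symm) (SY.unstableSet y)
  stable_totallyDisconnected :
    ∀ z, @IsTotallyDisconnected Z (leafTopology SZ.φ) (SZ.stableSet z)

namespace SUPair

lemma comp_succAbove_eq_cycleIcc {L : ℕ} (l r : Fin (L + 1)) (hlr : l ≤ r)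
    (ρ : Fin (L + 2) → Fin (L + 1)) (q : Fin (L + 2)) (hqr : q = r.succ) (hρq : ρ q = l)
    (hρs : ∀ j, ρ (q.succAbove j) = j) : ρ ∘ l.castSucc.succAbove = Fin.cycleIcc l r := by
  subst hqr
  funext k
  simp only [Function.comp_apply]
  rcases lt_or_ge k l with hk | hk
  · rw [Fin.cycleIcc_of_lt hk, Fin.succAbove_castSucc_of_lt _ _ hk,
      ← Fin.succAbove_succ_of_le r k (hk.le.trans hlr), hρs]
  · rw [Fin.succAbove_castSucc_of_le _ _ hk]
    rcases lt_trichotomy k r with hkr | hkr | hkr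
    · rw [Fin.cycleIcc_of_ge_of_lt hk hkr]
      have h1 : ((k + 1 : Fin (L + 1)) : ℕ) = k + 1 := Fin.val_add_one_of_lt' (by omega)
      have h2 : k.succ = r.succ.succAbove (k + 1) := by
        rw [Fin.succAbove_succ_of_le _ _ (by rw [Fin.le_def, h1]; exact hkr)]
        exact Fin.ext (by simp [h1])
      rw [h2, hρs]
    · rw [hkr, Fin.cycleIcc_of_last hlr, hρq]
    · rw [Fin.cycleIcc_of_gt hkr, ← Fin.succAbove_succ_of_lt r k hkr, hρs]

lemma swap_comp_succAbove {L : ℕ} (i : Fin (L + 1)) :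
    Equiv.swap i.castSucc i.succ ∘ i.castSucc.succAbove = i.succ.succAbove := by
  funext k
  simp only [Function.comp_apply]
  rcases lt_trichotomy k i with hk | hk | hk
  · rw [Fin.succAbove_castSucc_of_lt _ _ hk, Fin.succAbove_succ_of_le _ _ hk.le,
      Equiv.swap_apply_of_ne_of_ne]
    · simpa using hk.ne
    · exact (Fin.castSucc_lt_succ_iff.mpr hk.le).ne
  · subst hk
    simp
  · rw [Fin.succAbove_castSucc_of_le _ _ hk.le, Fin.succAbove_succ_of_lt _ _ hk,
      Equiv.swap_apply_of_ne_of_ne]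
    · exact (Fin.castSucc_lt_succ_iff.mpr hk.le).ne'
    · simpa using hk.ne'

lemma insertNth_eq_predAbove_comp_cycleIcc {L : ℕ} (l : Fin (L + 1)) (q : Fin (L + 2))
    (h : l.castSucc < q) : Fin.insertNth (α := fun _ => Fin (L + 1)) q l id =
      l.predAbove ∘ Fin.cycleIcc l.succ q := by
  have h' : l.succ ≤ q := h
  have hs : Fin.insertNth (α := fun _ => Fin (L + 1)) q l id q = l := by simp
  funext i
  rcases lt_trichotomy i q with hk | hk | hk
  · rcases lt_or_ge i l.succ with hi | hi
    · rw [Function.comp_apply, Fin.cycleIcc_of_lt hi]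
      simp [Fin.insertNth_apply_below hk]
      rw [Fin.predAbove_of_le_castSucc _ _ (Fin.le_castSucc_iff.mpr hi)]
    · rw [Function.comp_apply, Fin.cycleIcc_of_ge_of_lt hi hk]
      simp [Fin.insertNth_apply_below hk]
      have h1 : ((i + 1 : Fin (L + 2)) : ℕ) = i + 1 := Fin.val_add_one_of_lt' (by omega)
      rw [Fin.predAbove_of_castSucc_lt]
      · ext; simp [h1]
      · rw [Fin.lt_def, h1]; simp [Fin.le_def] at hi ⊢; omega
  · subst hk
    rw [Function.comp_apply, Fin.cycleIcc_of_last h', hs]; simp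
  · rw [Function.comp_apply, Fin.cycleIcc_of_gt hk]
    simp [Fin.insertNth_apply_above hk]
    rw [Fin.predAbove_of_castSucc_lt]
    exact h.trans hk

variable {X Y Z : Type*} [MetricSpace X] [MetricSpace Y] [MetricSpace Z]
  {SX : SmaleSpace X} {SY : SmaleSpace Y} {SZ : SmaleSpace Z}

/-- The space `Σ_{L,M}(π)` of tuples `(y_0, …, y_L, z_0, …, z_M)` with `π_s(y_l) = π_u(z_m)`,
with the supremum metric. -/
abbrev Shift (π : SUPair SX SY SZ) (L M : ℕ) : Type _ :=
  {p : (Fin (L + 1) → Y) × (Fin (M + 1) → Z) // ∀ l m, π.πs (p.1 l) = π.πu (p.2 m)}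

instance [CompactSpace Y] [CompactSpace Z] (π : SUPair SX SY SZ) (L M : ℕ) :
    CompactSpace (π.Shift L M) := by
  have h : IsClosed {p : (Fin (L + 1) → Y) × (Fin (M + 1) → Z) |
      ∀ l m, π.πs (p.1 l) = π.πu (p.2 m)} := by
    simp only [Set.ofPred_forall]
    refine isClosed_iInter fun l => isClosed_iInter fun m => isClosed_eq ?_ ?_
    · exact π.πs_sBijective.continuous.comp ((continuous_apply l).comp continuous_fst)
    · exact π.πu_uBijective.continuous.comp ((continuous_apply m).comp continuous_snd)
  exact isCompact_iff_compactSpace.mp h.isCompact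

section

variable {π : SUPair SX SY SZ}

lemma dist_fst_le {L M : ℕ} (p q : π.Shift L M) (l : Fin (L + 1)) :
    dist (p.1.1 l) (q.1.1 l) ≤ dist p q :=
  (dist_le_pi_dist _ _ l).trans (le_max_left _ _)

lemma dist_snd_le {L M : ℕ} (p q : π.Shift L M) (m : Fin (M + 1)) :
    dist (p.1.2 m) (q.1.2 m) ≤ dist p q :=
  (dist_le_pi_dist _ _ m).trans (le_max_right _ _)

lemma dist_le_iff {L M : ℕ} {p q : π.Shift L M} {r : ℝ} (hr : 0 ≤ r) :
    dist p q ≤ r ↔ (∀ l, dist (p.1.1 l) (q.1.1 l) ≤ r) ∧ ∀ m, dist (p.1.2 m) (q.1.2 m) ≤ r := by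
  rw [Subtype.dist_eq, Prod.dist_eq, max_le_iff, dist_pi_le_iff hr, dist_pi_le_iff hr]

lemma shift_ext {L M : ℕ} {p q : π.Shift L M} (h₁ : ∀ l, p.1.1 l = q.1.1 l)
    (h₂ : ∀ m, p.1.2 m = q.1.2 m) : p = q :=
  Subtype.ext (Prod.ext (funext h₁) (funext h₂))

variable (π : SUPair SX SY SZ)

/-- Reindexing of the `Y`-coordinates:
`(y_0, …, y_L, z) ↦ (y_{θ 0}, …, y_{θ K}, z)`. -/
def reindex {K L : ℕ} (M : ℕ) (θ : Fin (K + 1) → Fin (L + 1)) (p : π.Shift L M) : π.Shift K M :=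
  ⟨(fun k => p.1.1 (θ k), p.1.2), fun k m => p.2 (θ k) m⟩

lemma dist_reindex_le {K L M : ℕ} (θ : Fin (K + 1) → Fin (L + 1)) (p q : π.Shift L M) :
    dist (π.reindex M θ p) (π.reindex M θ q) ≤ dist p q :=
  (dist_le_iff dist_nonneg).mpr ⟨fun k => dist_fst_le p q (θ k), fun m => dist_snd_le p q m⟩

end

section Compact

variable [CompactSpace X] [CompactSpace Y] [CompactSpace Z] (π : SUPair SX SY SZ)

/-- There is a scale below which `π_s` and `π_u` commute with the brackets. -/
lemma exists_scale : ∃ r > 0, r ≤ SY.eps ∧ r ≤ SZ.eps ∧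
    (∀ y y', dist y y' ≤ r → π.πs (SY.bracket y y') = SX.bracket (π.πs y) (π.πs y')) ∧
    (∀ z z', dist z z' ≤ r → π.πu (SZ.bracket z z') = SX.bracket (π.πu z) (π.πu z')) := by
  obtain ⟨a, ha, hae, hA⟩ := SY.exists_map_bracket SX π.πs π.πs_sBijective.continuous
    π.πs_sBijective.map_φ
  obtain ⟨b, hb, hbe, hB⟩ := SZ.exists_map_bracket SX π.πu π.πu_uBijective.continuous
    π.πu_uBijective.map_φ
  exact ⟨min a b, lt_min ha hb, (min_le_left _ _).trans hae, (min_le_right _ _).trans hbe,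
    fun y y' h => (hA y y' (h.trans (min_le_left _ _))).2,
    fun z z' h => (hB z z' (h.trans (min_le_right _ _))).2⟩

/-- A scale below which `π_s` and `π_u` commute with the brackets; it does not depend on
`L` and `M`. -/
noncomputable def scale : ℝ := Classical.choose π.exists_scale

lemma scale_spec : 0 < π.scale ∧ π.scale ≤ SY.eps ∧ π.scale ≤ SZ.eps ∧
    (∀ y y', dist y y' ≤ π.scale → π.πs (SY.bracket y y') = SX.bracket (π.πs y) (π.πs y')) ∧
    (∀ z z', dist z z' ≤ π.scale → π.πu (SZ.bracket z z') = SX.bracket (π.πu z) (π.πu z')) :=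
  Classical.choose_spec π.exists_scale

/-- The homeomorphism of `Σ_{L,M}(π)` induced by `ψ` and `ζ`. -/
def shiftMap (L M : ℕ) : π.Shift L M ≃ₜ π.Shift L M where
  toFun p := ⟨(fun l => SY.φ (p.1.1 l), fun m => SZ.φ (p.1.2 m)), fun l m => by
    change π.πs (SY.φ _) = π.πu (SZ.φ _)
    rw [π.πs_sBijective.map_φ, π.πu_uBijective.map_φ, p.2 l m]⟩
  invFun p := ⟨(fun l => SY.φ.symm (p.1.1 l), fun m => SZ.φ.symm (p.1.2 m)), fun l m => by
    apply SX.φ.injective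
    change SX.φ (π.πs (SY.φ.symm _)) = SX.φ (π.πu (SZ.φ.symm _))
    rw [← π.πs_sBijective.map_φ, ← π.πu_uBijective.map_φ, SY.φ.apply_symm_apply,
      SZ.φ.apply_symm_apply, p.2 l m]⟩
  left_inv p := by ext <;> simp
  right_inv p := by ext <;> simp
  continuous_toFun := by fun_prop
  continuous_invFun := by fun_prop

open Classical in
/-- The coordinatewise bracket on `Σ_{L,M}(π)` (with a dummy value where the coordinatewise
bracket leaves the space, which does not happen for pairs at distance at most `π.scale`). -/
noncomputable def shiftBracket (L M : ℕ) (p q : π.Shift L M) : π.Shift L M :=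
  if h : ∀ l m, π.πs (SY.bracket (p.1.1 l) (q.1.1 l)) = π.πu (SZ.bracket (p.1.2 m) (q.1.2 m))
  then ⟨(fun l => SY.bracket (p.1.1 l) (q.1.1 l), fun m => SZ.bracket (p.1.2 m) (q.1.2 m)), h⟩
  else p

lemma shiftBracket_val {L M : ℕ} {p q : π.Shift L M} (h : dist p q ≤ π.scale) :
    (π.shiftBracket L M p q).1 = (fun l => SY.bracket (p.1.1 l) (q.1.1 l),
      fun m => SZ.bracket (p.1.2 m) (q.1.2 m)) := by
  unfold shiftBracket
  rw [dif_pos]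
  intro l m
  rw [π.scale_spec.2.2.2.1 _ _ ((dist_fst_le p q l).trans h),
    π.scale_spec.2.2.2.2 _ _ ((dist_snd_le p q m).trans h), p.2 l m, q.2 l m]

lemma shiftBracket_fst {L M : ℕ} {p q : π.Shift L M} (h : dist p q ≤ π.scale) (l : Fin (L + 1)) :
    (π.shiftBracket L M p q).1.1 l = SY.bracket (p.1.1 l) (q.1.1 l) := by
  rw [π.shiftBracket_val h]

lemma shiftBracket_snd {L M : ℕ} {p q : π.Shift L M} (h : dist p q ≤ π.scale) (m : Fin (M + 1)) :
    (π.shiftBracket L M p q).1.2 m = SZ.bracket (p.1.2 m) (q.1.2 m) := by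
  rw [π.shiftBracket_val h]

/-- The Smale space structure on `Σ_{L,M}(π)`. -/
noncomputable def shiftSpace (L M : ℕ) : SmaleSpace (π.Shift L M) where
  φ := π.shiftMap L M
  bracket := π.shiftBracket L M
  eps := π.scale
  lam := max SY.lam SZ.lam
  eps_pos := π.scale_spec.1
  lam_pos := lt_max_of_lt_left SY.lam_pos
  lam_lt_one := max_lt SY.lam_lt_one SZ.lam_lt_one
  continuousOn_bracket := by
    have hY := π.scale_spec.2.1
    have hZ := π.scale_spec.2.2.1
    refine Topology.IsInducing.subtypeVal.continuousOn_iff.mpr ?_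
    refine ContinuousOn.congr (f := fun a : π.Shift L M × π.Shift L M =>
      ((fun l => SY.bracket (a.1.1.1 l) (a.2.1.1 l), fun m => SZ.bracket (a.1.1.2 m) (a.2.1.2 m)) :
        (Fin (L + 1) → Y) × (Fin (M + 1) → Z))) ?_ fun a ha => π.shiftBracket_val ha
    refine ContinuousOn.prodMk (continuousOn_pi.mpr fun l => ?_) (continuousOn_pi.mpr fun m => ?_)
    · refine SY.continuousOn_bracket.comp (f := fun a : π.Shift L M × π.Shift L M =>
        (a.1.1.1 l, a.2.1.1 l)) (by fun_prop) fun a ha => ?_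
      exact (dist_fst_le a.1 a.2 l).trans (le_trans ha hY)
    · refine SZ.continuousOn_bracket.comp (f := fun a : π.Shift L M × π.Shift L M =>
        (a.1.1.2 m, a.2.1.2 m)) (by fun_prop) fun a ha => ?_
      exact (dist_snd_le a.1 a.2 m).trans (le_trans ha hZ)
  bracket_self p := by
    have h : dist p p ≤ π.scale := by simpa using π.scale_spec.1.le
    refine shift_ext (fun l => ?_) fun m => ?_
    · rw [π.shiftBracket_fst h, SY.bracket_self]
    · rw [π.shiftBracket_snd h, SZ.bracket_self]
  bracket_right p q r h1 h2 h3 := by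
    have hY := π.scale_spec.2.1
    have hZ := π.scale_spec.2.2.1
    refine shift_ext (fun l => ?_) fun m => ?_
    · have h2' := (dist_fst_le _ _ l).trans h2
      rw [π.shiftBracket_fst h2, π.shiftBracket_fst h3]
      rw [π.shiftBracket_fst h1] at h2' ⊢
      exact SY.bracket_right _ _ _ ((dist_fst_le _ _ l).trans (h1.trans hY)) (h2'.trans hY)
        ((dist_fst_le _ _ l).trans (h3.trans hY))
    · have h2' := (dist_snd_le _ _ m).trans h2
      rw [π.shiftBracket_snd h2, π.shiftBracket_snd h3]
      rw [π.shiftBracket_snd h1] at h2' ⊢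
      exact SZ.bracket_right _ _ _ ((dist_snd_le _ _ m).trans (h1.trans hZ)) (h2'.trans hZ)
        ((dist_snd_le _ _ m).trans (h3.trans hZ))
  bracket_left p q r h1 h2 h3 := by
    have hY := π.scale_spec.2.1
    have hZ := π.scale_spec.2.2.1
    refine shift_ext (fun l => ?_) fun m => ?_
    · have h2' := (dist_fst_le _ _ l).trans h2
      rw [π.shiftBracket_fst h2, π.shiftBracket_fst h3]
      rw [π.shiftBracket_fst h1] at h2' ⊢
      exact SY.bracket_left _ _ _ ((dist_fst_le _ _ l).trans (h1.trans hY)) (h2'.trans hY)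
        ((dist_fst_le _ _ l).trans (h3.trans hY))
    · have h2' := (dist_snd_le _ _ m).trans h2
      rw [π.shiftBracket_snd h2, π.shiftBracket_snd h3]
      rw [π.shiftBracket_snd h1] at h2' ⊢
      exact SZ.bracket_left _ _ _ ((dist_snd_le _ _ m).trans (h1.trans hZ)) (h2'.trans hZ)
        ((dist_snd_le _ _ m).trans (h3.trans hZ))
  map_bracket p q h1 h2 := by
    have hY := π.scale_spec.2.1
    have hZ := π.scale_spec.2.2.1
    refine shift_ext (fun l => ?_) fun m => ?_
    · have e1 := (dist_fst_le _ _ l).trans (h1.trans hY)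
      have e2 := (dist_fst_le _ _ l).trans (h2.trans hY)
      rw [π.shiftBracket_fst h2]
      change SY.φ ((π.shiftBracket L M p q).1.1 l) = SY.bracket (SY.φ (p.1.1 l)) (SY.φ (q.1.1 l))
      rw [π.shiftBracket_fst h1]
      exact SY.map_bracket _ _ e1 e2
    · have e1 := (dist_snd_le _ _ m).trans (h1.trans hZ)
      have e2 := (dist_snd_le _ _ m).trans (h2.trans hZ)
      rw [π.shiftBracket_snd h2]
      change SZ.φ ((π.shiftBracket L M p q).1.2 m) = SZ.bracket (SZ.φ (p.1.2 m)) (SZ.φ (q.1.2 m))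
      rw [π.shiftBracket_snd h1]
      exact SZ.map_bracket _ _ e1 e2
  contract p q h hb := by
    have hY := π.scale_spec.2.1
    have hZ := π.scale_spec.2.2.1
    have h0 : 0 < max SY.lam SZ.lam := lt_max_of_lt_left SY.lam_pos
    refine (dist_le_iff (mul_nonneg h0.le dist_nonneg)).mpr ⟨fun l => ?_, fun m => ?_⟩
    · refine (SY.contract _ _ ((dist_fst_le p q l).trans (h.trans hY)) ?_).trans
        (mul_le_mul (le_max_left _ _) (dist_fst_le p q l) dist_nonneg h0.le)
      rw [← π.shiftBracket_fst h, hb]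
    · refine (SZ.contract _ _ ((dist_snd_le p q m).trans (h.trans hZ)) ?_).trans
        (mul_le_mul (le_max_right _ _) (dist_snd_le p q m) dist_nonneg h0.le)
      rw [← π.shiftBracket_snd h, hb]
  expand p q h hb := by
    have hY := π.scale_spec.2.1
    have hZ := π.scale_spec.2.2.1
    have h0 : 0 < max SY.lam SZ.lam := lt_max_of_lt_left SY.lam_pos
    refine (dist_le_iff (mul_nonneg h0.le dist_nonneg)).mpr ⟨fun l => ?_, fun m => ?_⟩
    · refine (SY.expand _ _ ((dist_fst_le p q l).trans (h.trans hY)) ?_).trans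
        (mul_le_mul (le_max_left _ _) (dist_fst_le p q l) dist_nonneg h0.le)
      rw [← π.shiftBracket_fst h, hb]
    · refine (SZ.expand _ _ ((dist_snd_le p q m).trans (h.trans hZ)) ?_).trans
        (mul_le_mul (le_max_right _ _) (dist_snd_le p q m) dist_nonneg h0.le)
      rw [← π.shiftBracket_snd h, hb]

lemma shift_iterate_fst {L M : ℕ} (n : ℕ) (p : π.Shift L M) (l : Fin (L + 1)) :
    ((π.shiftSpace L M).φ^[n] p).1.1 l = SY.φ^[n] (p.1.1 l) := by
  induction n with
  | zero => rfl
  | succ n ih =>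
    rw [Function.iterate_succ_apply', Function.iterate_succ_apply', ← ih]
    rfl

lemma shift_iterate_snd {L M : ℕ} (n : ℕ) (p : π.Shift L M) (m : Fin (M + 1)) :
    ((π.shiftSpace L M).φ^[n] p).1.2 m = SZ.φ^[n] (p.1.2 m) := by
  induction n with
  | zero => rfl
  | succ n ih =>
    rw [Function.iterate_succ_apply', Function.iterate_succ_apply', ← ih]
    rfl

lemma asymptotic_iff {L M : ℕ} {p q : π.Shift L M} :
    Asymptotic (π.shiftSpace L M).φ p q ↔ (∀ l, Asymptotic SY.φ (p.1.1 l) (q.1.1 l)) ∧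
      ∀ m, Asymptotic SZ.φ (p.1.2 m) (q.1.2 m) := by
  constructor
  · refine fun h => ⟨fun l => ?_, fun m => ?_⟩
    · refine squeeze_zero (fun _ => dist_nonneg) (fun n => ?_) h
      rw [← π.shift_iterate_fst, ← π.shift_iterate_fst]
      exact dist_fst_le _ _ l
    · refine squeeze_zero (fun _ => dist_nonneg) (fun n => ?_) h
      rw [← π.shift_iterate_snd, ← π.shift_iterate_snd]
      exact dist_snd_le _ _ m
  · rintro ⟨h1, h2⟩
    have h3 : Tendsto (fun n : ℕ => (∑ l, dist (SY.φ^[n] (p.1.1 l)) (SY.φ^[n] (q.1.1 l))) +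
        ∑ m, dist (SZ.φ^[n] (p.1.2 m)) (SZ.φ^[n] (q.1.2 m))) atTop (𝓝 0) := by
      simpa using (tendsto_finsetSum Finset.univ fun l _ => h1 l).add
        (tendsto_finsetSum Finset.univ fun m _ => h2 m)
    refine squeeze_zero (fun _ => dist_nonneg) (fun n => ?_) h3
    have n1 : ∀ l ∈ Finset.univ, 0 ≤ dist (SY.φ^[n] (p.1.1 l)) (SY.φ^[n] (q.1.1 l)) :=
      fun _ _ => dist_nonneg
    have n2 : ∀ m ∈ Finset.univ, 0 ≤ dist (SZ.φ^[n] (p.1.2 m)) (SZ.φ^[n] (q.1.2 m)) :=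
      fun _ _ => dist_nonneg
    refine (dist_le_iff (add_nonneg (Finset.sum_nonneg n1) (Finset.sum_nonneg n2))).mpr
      ⟨fun l => ?_, fun m => ?_⟩
    · rw [π.shift_iterate_fst, π.shift_iterate_fst]
      exact (Finset.single_le_sum n1 (Finset.mem_univ l)).trans
        (le_add_of_nonneg_right (Finset.sum_nonneg n2))
    · rw [π.shift_iterate_snd, π.shift_iterate_snd]
      exact (Finset.single_le_sum n2 (Finset.mem_univ m)).trans
        (le_add_of_nonneg_left (Finset.sum_nonneg n1))

/-- All reindexing maps (faces, degeneracies, permutations) are `s`-bijective. -/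
lemma reindex_isStrict {K L : ℕ} (M : ℕ) (θ : Fin (K + 1) → Fin (L + 1)) :
    IsStrict (π.shiftSpace L M) (π.shiftSpace K M) (π.reindex M θ) where
  continuous := by unfold reindex; fun_prop
  map_φ _ := rfl
  eps_eq := rfl
  dist_le := π.dist_reindex_le θ
  map_bracket p q h := by
    have h' := (π.dist_reindex_le θ p q).trans h
    refine shift_ext (fun k => ?_) fun m => ?_
    · exact (π.shiftBracket_fst h (θ k)).trans (π.shiftBracket_fst h' k).symm
    · exact (π.shiftBracket_snd h m).trans (π.shiftBracket_snd h' m).symm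
  bijOn e := by
    refine ⟨fun p hp => ?_, fun p hp q hq hpq => ?_, fun q hq => ?_⟩
    · exact π.asymptotic_iff.mpr ⟨fun k => (π.asymptotic_iff.mp hp).1 (θ k),
        (π.asymptotic_iff.mp hp).2⟩
    · have hz : ∀ m, p.1.2 m = q.1.2 m := fun m => congrFun (congrArg (fun x => x.1.2) hpq) m
      refine shift_ext (fun l => ?_) hz
      refine (π.πs_sBijective.bijOn (e.1.1 l)).injOn ((π.asymptotic_iff.mp hp).1 l)
        ((π.asymptotic_iff.mp hq).1 l) ?_
      rw [p.2 l 0, q.2 l 0, hz 0]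
    · have hq' := π.asymptotic_iff.mp hq
      have hx : ∀ l, π.πu (q.1.2 0) ∈ SX.stableSet (π.πs (e.1.1 l)) := fun l => by
        rw [e.2 l 0]
        exact π.πu_uBijective.toIsMap.asymptotic (hq'.2 0)
      choose y hy hyx using fun l => (π.πs_sBijective.bijOn (e.1.1 l)).surjOn (hx l)
      refine ⟨⟨(y, q.1.2), fun l m => ?_⟩, π.asymptotic_iff.mpr ⟨hy, hq'.2⟩, ?_⟩
      · rw [hyx, ← q.2 0 0, ← q.2 0 m]
      · refine shift_ext (fun k => ?_) fun m => rfl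
        refine (π.πs_sBijective.bijOn (e.1.1 (θ k))).injOn (hy (θ k)) (hq'.1 k) ?_
        rw [hyx, q.2 k 0]

/-- The group `C_{L,M} = D^s(Σ_{L,M}(π))`. -/
def chains (L M : ℕ) : Type _ := DimGroup (π.shiftSpace L M)

noncomputable instance (L M : ℕ) : AddCommGroup (π.chains L M) :=
  inferInstanceAs (AddCommGroup (DimGroup (π.shiftSpace L M)))

/-- The homomorphism on dimension groups induced by a reindexing map. -/
noncomputable def pull {K L : ℕ} (M : ℕ) (θ : Fin (K + 1) → Fin (L + 1)) :
    π.chains L M →+ π.chains K M :=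
  dimMap (π.reindex_isStrict M θ)

/-- The face map `δ_l^s`, induced by deleting the entry `y_l`. -/
noncomputable def face {L : ℕ} (M : ℕ) (l : Fin (L + 2)) : π.chains (L + 1) M →+ π.chains L M :=
  π.pull M l.succAbove

/-- The generalized degeneracy `(σ_j s_l)^s` for `q = l + j > l`. It is induced by the map that
repeats the entry `y_l` at coordinate `q`:
`(y_0, …, y_L) ↦ (y_0, …, y_{q-1}, y_l, y_q, …, y_L)`. -/
noncomputable def degeneracy {L : ℕ} (M : ℕ) (l : Fin (L + 1)) (q : Fin (L + 2)) :
    π.chains L M →+ π.chains (L + 1) M :=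
  π.pull M (Fin.insertNth (α := fun _ => Fin (L + 1)) q l id)

/-- The action of a permutation of the `Y`-coordinates: the entry `y_i` of a tuple is moved to
position `α i`. -/
noncomputable def perm {L : ℕ} (M : ℕ) (α : Equiv.Perm (Fin (L + 1))) :
    π.chains L M →+ π.chains L M :=
  π.pull M (α⁻¹ : Equiv.Perm (Fin (L + 1)))

/-- The differential `∂^s = ∑ (-1)^l δ_l^s`. -/
noncomputable def boundary (L M : ℕ) : π.chains (L + 1) M →+ π.chains L M :=
  ∑ l : Fin (L + 2), ((-1 : ℤ) ^ (l : ℕ)) • π.face M l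

/-- The subgroup `∑_{l,j} (σ_j s_l)^s(C_{L-1,M})` of `C_{L,M}`. -/
noncomputable def degenerate (M : ℕ) : (L : ℕ) → AddSubgroup (π.chains L M)
  | 0 => ⊥
  | L + 1 => ⨆ (l : Fin (L + 1)) (q : Fin (L + 2)) (_ : l.castSucc < q), (π.degeneracy M l q).range

/-- The subgroup of `C_{L,M}` generated by the elements `α(a) - sgn(α) a`. -/
noncomputable def signed (M L : ℕ) : AddSubgroup (π.chains L M) :=
  AddSubgroup.closure {x | ∃ (α : Equiv.Perm (Fin (L + 1))) (a : π.chains L M),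
    x = π.perm M α a - (Equiv.Perm.sign α : ℤ) • a}

/-- The group of degenerate chains `DC_{L,M}`. -/
noncomputable def DC (M L : ℕ) : AddSubgroup (π.chains L M) :=
  π.degenerate M L ⊔ π.signed M L

lemma pull_pull {J K L M : ℕ} (θ : Fin (K + 1) → Fin (L + 1)) (τ : Fin (J + 1) → Fin (K + 1))
    (a : π.chains L M) : π.pull M τ (π.pull M θ a) = π.pull M (θ ∘ τ) a :=
  (dimMap_comp (π.reindex_isStrict M θ) (π.reindex_isStrict M τ)
    (π.reindex_isStrict M (θ ∘ τ)) a).symm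

lemma pull_id {L M : ℕ} (a : π.chains L M) : π.pull M id a = a :=
  dimMap_id (π.reindex_isStrict M id) a

lemma boundary_apply {L M : ℕ} (a : π.chains (L + 1) M) :
    π.boundary L M a = ∑ l : Fin (L + 2), ((-1 : ℤ) ^ (l : ℕ)) • π.face M l a := by
  simp [boundary, AddMonoidHom.finsetSum_apply]

open CategoryTheory in
/-- The simplicial group `L ↦ D^s(Σ_{L,M}(π))`. -/
noncomputable def simplicialGroup (M : ℕ) : SimplicialObject AddCommGrpCat where
  obj n := AddCommGrpCat.of (π.chains n.unop.len M)
  map θ := AddCommGrpCat.ofHom (π.pull M θ.unop.toOrderHom)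
  map_id _ := AddCommGrpCat.hom_ext (AddMonoidHom.ext fun a => π.pull_id a)
  map_comp θ τ := AddCommGrpCat.hom_ext (AddMonoidHom.ext fun a =>
    (π.pull_pull (M := M) θ.unop.toOrderHom τ.unop.toOrderHom a).symm)

open CategoryTheory in
lemma boundary_boundary {L M : ℕ} (a : π.chains (L + 2) M) :
    π.boundary L M (π.boundary (L + 1) M a) = 0 := by
  have key : ∀ n : ℕ, AlgebraicTopology.AlternatingFaceMapComplex.objD (π.simplicialGroup M) n =
      AddCommGrpCat.ofHom (π.boundary n M) := by
    intro n
    apply AddCommGrpCat.homAddEquiv.injective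
    simp only [AlgebraicTopology.AlternatingFaceMapComplex.objD, map_sum, map_zsmul]
    rfl
  have h := AlgebraicTopology.AlternatingFaceMapComplex.d_squared (π.simplicialGroup M) L
  rw [key, key] at h
  exact congrArg (fun f => f.hom a) h

/-- The generalized degeneracy is the composite of the usual degeneracy `s_l` (repeating `y_l` at
coordinate `l + 1`) and the cycle `σ_j = (q q-1 ⋯ l+1)`, `q = l + j`. -/
lemma degeneracy_eq_perm {L M : ℕ} (l : Fin (L + 1)) (q : Fin (L + 2)) (h : l.castSucc < q)
    (a : π.chains L M) : π.degeneracy M l q a =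
      π.perm M (Fin.cycleIcc l.succ q)⁻¹ (π.pull M l.predAbove a) := by
  rw [degeneracy, insertNth_eq_predAbove_comp_cycleIcc l q h, perm, inv_inv, pull_pull]

/-- Everything that comes from tuples with two equal entries is degenerate. -/
lemma pull_mem_degenerate {K L M : ℕ} (θ : Fin (L + 1) → Fin (K + 1)) (p q : Fin (L + 1))
    (hpq : p < q) (h : θ p = θ q) (a : π.chains K M) : π.pull M θ a ∈ π.degenerate M L := by
  cases L with
  | zero => omega
  | succ L =>
    have hp : p ≠ Fin.last _ := (hpq.trans_le (Fin.le_last _)).ne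
    have e : θ = (θ ∘ q.succAbove) ∘
        (Fin.insertNth (α := fun _ => Fin (L + 1)) q (p.castPred hp) id) := by
      funext i
      refine Fin.succAboveCases q ?_ (fun j => ?_) i
      · simp only [Function.comp_apply, Fin.insertNth_apply_same]
        rw [Fin.succAbove_of_castSucc_lt _ _ (by simpa using hpq), Fin.castSucc_castPred, h]
      · simp
    rw [e, ← π.pull_pull]
    refine AddSubgroup.mem_iSup_of_mem (p.castPred hp) (AddSubgroup.mem_iSup_of_mem q
      (AddSubgroup.mem_iSup_of_mem (by simpa using hpq) ⟨_, rfl⟩))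

lemma perm_sub_mem {L M : ℕ} (α : Equiv.Perm (Fin (L + 1))) (a : π.chains L M) :
    π.perm M α a - (Equiv.Perm.sign α : ℤ) • a ∈ π.signed M L :=
  AddSubgroup.subset_closure ⟨α, a, rfl⟩

lemma boundary_degeneracy_mem {L M : ℕ} (l : Fin (L + 1)) (q : Fin (L + 2))
    (hlq : l.castSucc < q) (a : π.chains L M) :
    π.boundary L M (π.degeneracy M l q a) ∈ π.DC M L := by
  set ρ : Fin (L + 2) → Fin (L + 1) := Fin.insertNth (α := fun _ => Fin (L + 1)) q l id with hρ
  have hρq : ρ q = l := by simp [hρ]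
  have hρs : ∀ j, ρ (q.succAbove j) = j := fun j => by simp [hρ]
  have hρl : ρ l.castSucc = l := by
    have := hρs l
    rwa [Fin.succAbove_of_castSucc_lt _ _ hlq] at this
  have hne : l.castSucc ≠ q := hlq.ne
  have hf : ∀ i, π.face M i (π.degeneracy M l q a) = π.pull M (ρ ∘ i.succAbove) a :=
    fun i => π.pull_pull _ _ a
  rw [boundary_apply]
  simp only [hf]
  rw [← Finset.add_sum_erase _ _ (Finset.mem_univ q),
    ← Finset.add_sum_erase _ _ (Finset.mem_erase.mpr ⟨hne, Finset.mem_univ l.castSucc⟩),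
    ← add_assoc]
  refine add_mem ?_ (sum_mem fun i hi => ?_)
  · have e1 : ρ ∘ q.succAbove = id := funext hρs
    have hq0 : q ≠ 0 := (lt_of_le_of_lt (Fin.zero_le _) hlq).ne'
    set r := q.pred hq0 with hr
    have hqr : q = r.succ := (Fin.succ_pred q hq0).symm
    have hlr : l ≤ r := by
      rw [hqr] at hlq
      exact Fin.castSucc_lt_succ_iff.mp hlq
    have e2 : ρ ∘ l.castSucc.succAbove = Fin.cycleIcc l r :=
      comp_succAbove_eq_cycleIcc l r hlr ρ q hqr hρq hρs
    have hs : Equiv.Perm.sign (Fin.cycleIcc l r)⁻¹ = (-1) ^ ((r : ℕ) - l) := by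
      rw [Equiv.Perm.sign_inv, Fin.sign_cycleIcc_of_le hlr]
    have hm := π.perm_sub_mem (M := M) (Fin.cycleIcc l r)⁻¹ a
    rw [hs] at hm
    have hm' := AddSubgroup.zsmul_mem _ hm ((-1 : ℤ) ^ (l : ℕ))
    refine AddSubgroup.mem_sup_right ?_
    convert hm' using 1
    rw [e1, π.pull_id, e2, perm, inv_inv, smul_sub, smul_smul]
    have : ((-1 : ℤ) ^ (q : ℕ)) = -((-1) ^ (l : ℕ) * (((-1 : ℤˣ) ^ ((r : ℕ) - l) : ℤˣ) : ℤ)) := by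
      have hle : (l : ℕ) ≤ r := hlr
      rw [Units.val_pow_eq_pow_val, Units.val_neg, Units.val_one, ← pow_add,
        Nat.add_sub_cancel' hle, hqr, Fin.val_succ, pow_succ]
      ring
    rw [this, neg_smul, Fin.val_castSucc]
    abel
  · refine AddSubgroup.zsmul_mem _ (AddSubgroup.mem_sup_left ?_) _
    have hil : i ≠ l.castSucc := (Finset.mem_erase.mp hi).1
    have hiq : i ≠ q := (Finset.mem_erase.mp (Finset.mem_erase.mp hi).2).1
    obtain ⟨u, hu⟩ := Fin.exists_succAbove_eq hil.symm
    obtain ⟨v, hv⟩ := Fin.exists_succAbove_eq hiq.symm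
    refine π.pull_mem_degenerate _ u v ?_ ?_ a
    · rw [← Fin.succAbove_lt_succAbove_iff (p := i), hu, hv]
      exact hlq
    · simp only [Function.comp_apply, hu, hv, hρl, hρq]

lemma boundary_swap_mem {L M : ℕ} (i : Fin (L + 1)) (a : π.chains (L + 1) M) :
    π.boundary L M (π.perm M (Equiv.swap i.castSucc i.succ) a) + π.boundary L M a ∈
      π.signed M L := by
  set t := Equiv.swap i.castSucc i.succ with ht
  have hne : i.castSucc ≠ i.succ := Fin.castSucc_lt_succ.ne
  have htinv : t⁻¹ = t := Equiv.swap_inv _ _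
  have hf : ∀ k, π.face M k (π.perm M t a) = π.pull M (t ∘ k.succAbove) a := fun k => by
    rw [perm, htinv]
    exact π.pull_pull _ _ a
  rw [boundary_apply, boundary_apply, ← Finset.sum_add_distrib]
  simp only [hf, ← smul_add]
  rw [← Finset.add_sum_erase _ _ (Finset.mem_univ i.castSucc),
    ← Finset.add_sum_erase _ _ (Finset.mem_erase.mpr ⟨hne.symm, Finset.mem_univ i.succ⟩),
    ← add_assoc]
  refine add_mem ?_ (sum_mem fun k hk => ?_)
  · have e1 : t ∘ i.castSucc.succAbove = i.succ.succAbove := swap_comp_succAbove i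
    have e2 : t ∘ i.succ.succAbove = i.castSucc.succAbove := by
      rw [← e1, ← Function.comp_assoc, ht]
      funext x
      simp
    rw [e1, e2, Fin.val_succ, Fin.val_castSucc, pow_succ]
    convert zero_mem (π.signed M L) using 1
    simp only [face, mul_neg, mul_one, neg_smul, smul_add]
    abel
  · refine AddSubgroup.zsmul_mem _ ?_ _
    have hks : k ≠ i.succ := (Finset.mem_erase.mp hk).1
    have hkc : k ≠ i.castSucc := (Finset.mem_erase.mp (Finset.mem_erase.mp hk).2).1
    obtain ⟨u, hu⟩ := Fin.exists_succAbove_eq hkc.symm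
    obtain ⟨v, hv⟩ := Fin.exists_succAbove_eq hks.symm
    have huv : u ≠ v := by
      rintro rfl
      exact hne (hu.symm.trans hv)
    have e : t ∘ k.succAbove = k.succAbove ∘ Equiv.swap u v := by
      rw [ht, ← hu, ← hv]
      exact (Fin.succAbove_right_injective (p := k)).swap_comp u v
    have hm := π.perm_sub_mem (M := M) (Equiv.swap u v) (π.face M k a)
    rw [Equiv.Perm.sign_swap huv] at hm
    convert hm using 1
    rw [e, ← π.pull_pull, perm, Equiv.swap_inv]
    simp [face]

lemma boundary_perm_mem {L M : ℕ} (α : Equiv.Perm (Fin (L + 2))) : ∀ a : π.chains (L + 1) M,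
    π.boundary L M (π.perm M α a - (Equiv.Perm.sign α : ℤ) • a) ∈ π.signed M L := by
  have hα : α ∈ Submonoid.closure
      (Set.range fun i : Fin (L + 1) => Equiv.swap i.castSucc i.succ) := by
    rw [Equiv.Perm.mclosure_swap_castSucc_succ]
    trivial
  induction hα using Submonoid.closure_induction with
  | mem x hx =>
    obtain ⟨i, rfl⟩ := hx
    intro a
    have := π.boundary_swap_mem (M := M) i a
    simp only [Equiv.Perm.sign_swap Fin.castSucc_lt_succ.ne]
    simpa using this
  | one =>
    intro a
    have : π.perm M (1 : Equiv.Perm (Fin (L + 2))) a = a := by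
      rw [perm, inv_one]
      exact π.pull_id a
    simp [this]
  | mul x y _ _ hx hy =>
    intro a
    have e : π.perm M (x * y) a = π.perm M x (π.perm M y a) := by
      simp only [perm, pull_pull, mul_inv_rev]
      rfl
    have e' : π.perm M (x * y) a - (Equiv.Perm.sign (x * y) : ℤ) • a =
        (π.perm M x (π.perm M y a) - (Equiv.Perm.sign x : ℤ) • π.perm M y a) +
          (Equiv.Perm.sign x : ℤ) • (π.perm M y a - (Equiv.Perm.sign y : ℤ) • a) := by
      rw [e, smul_sub, smul_smul, Equiv.Perm.sign_mul, Units.val_mul]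
      abel
    rw [e', map_add, map_zsmul]
    exact add_mem (hx _) (AddSubgroup.zsmul_mem _ (hy a) _)

/-- The differential preserves degenerate chains. -/
lemma boundary_mem {L M : ℕ} : π.DC M (L + 1) ≤ (π.DC M L).comap (π.boundary L M) := by
  refine sup_le ?_ ((AddSubgroup.closure_le _).mpr ?_)
  · refine iSup_le fun l => iSup_le fun q => iSup_le fun hlq => ?_
    rintro _ ⟨a, rfl⟩
    exact π.boundary_degeneracy_mem l q hlq a
  · rintro _ ⟨α, a, rfl⟩
    exact AddSubgroup.mem_sup_right (π.boundary_perm_mem α a)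

lemma boundary_mem_DC {L M : ℕ} {a : π.chains (L + 1) M} (ha : a ∈ π.DC M (L + 1)) :
    π.boundary L M a ∈ π.DC M L :=
  AddSubgroup.mem_comap.mp (π.boundary_mem ha)

open CategoryTheory

/-- The chain complex `(C_{•,M}, ∂^s)`. -/
noncomputable def chainComplex (M : ℕ) : ChainComplex AddCommGrpCat ℕ :=
  ChainComplex.of (fun L => AddCommGrpCat.of (π.chains L M))
    (fun L => AddCommGrpCat.ofHom (π.boundary L M)) fun _ =>
      AddCommGrpCat.hom_ext (AddMonoidHom.ext fun a => π.boundary_boundary a)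

/-- The restriction of the differential to degenerate chains. -/
noncomputable def boundaryDC (L M : ℕ) : π.DC M (L + 1) →+ π.DC M L where
  toFun a := ⟨π.boundary L M a.1, π.boundary_mem_DC a.2⟩
  map_zero' := Subtype.ext (map_zero (π.boundary L M))
  map_add' a b := Subtype.ext (map_add (π.boundary L M) a.1 b.1)

/-- The chain complex `(DC_{•,M}, ∂^s)`. -/
noncomputable def degenerateComplex (M : ℕ) : ChainComplex AddCommGrpCat ℕ :=
  ChainComplex.of (fun L => AddCommGrpCat.of (π.DC M L))
    (fun L => AddCommGrpCat.ofHom (π.boundaryDC L M)) fun L =>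
      AddCommGrpCat.hom_ext (AddMonoidHom.ext fun a => Subtype.ext (π.boundary_boundary a.1))

/-- The differential induced on the quotients `C_{L,M} / DC_{L,M}`. -/
noncomputable def boundaryQuotient (L M : ℕ) :
    π.chains (L + 1) M ⧸ π.DC M (L + 1) →+ π.chains L M ⧸ π.DC M L :=
  QuotientAddGroup.map _ _ (π.boundary L M) π.boundary_mem

/-- The chain complex `(C_{•,M} / DC_{•,M}, ∂^s)`. -/
noncomputable def quotientComplex (M : ℕ) : ChainComplex AddCommGrpCat ℕ :=
  ChainComplex.of (fun L => AddCommGrpCat.of (π.chains L M ⧸ π.DC M L))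
    (fun L => AddCommGrpCat.ofHom (π.boundaryQuotient L M)) fun _ =>
      AddCommGrpCat.hom_ext (QuotientAddGroup.addMonoidHom_ext _ (AddMonoidHom.ext fun a =>
        congrArg (QuotientAddGroup.mk (s := π.DC M _)) (π.boundary_boundary a)))

/-- The inclusion `DC_{•,M} → C_{•,M}`. -/
noncomputable def inclusion (M : ℕ) : π.degenerateComplex M ⟶ π.chainComplex M :=
  ChainComplex.ofHom (fun L => AddCommGrpCat.ofHom (π.DC M L).subtype) fun L => by
    simp only [degenerateComplex, chainComplex, ChainComplex.of_d]
    rfl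

/-- The projection `C_{•,M} → C_{•,M} / DC_{•,M}`. -/
noncomputable def projection (M : ℕ) : π.chainComplex M ⟶ π.quotientComplex M :=
  ChainComplex.ofHom
    (fun L => AddCommGrpCat.ofHom (QuotientAddGroup.mk' (π.DC M L))) fun L => by
    simp only [quotientComplex, chainComplex, ChainComplex.of_d]
    rfl

/-- The sequence `0 → DC_{•,M} → C_{•,M} → C_{•,M} / DC_{•,M} → 0`. -/
noncomputable def shortComplex (M : ℕ) : ShortComplex (ChainComplex AddCommGrpCat ℕ) :=
  ShortComplex.mk (π.inclusion M) (π.projection M) (by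
    refine HomologicalComplex.hom_ext _ _ fun L => AddCommGrpCat.hom_ext (AddMonoidHom.ext fun a => ?_)
    exact (QuotientAddGroup.eq_zero_iff _).mpr a.2)

end Compact

end SUPair

end SmaleHomology

/-!
The points of `Σ_{L,M}` are labelled, at time `-n`, by the symbols of their entries `y_l` with
respect to a partition of `Σ_{0,M}` into small clopen sets. The partition is chosen such that,
among points with the same `Z`-coordinates, the present symbol determines the past itinerary. The
group `D^s(Σ_{L,M})` is the direct limit over `n` of groups in which only those sets are
identified that are related by a holonomy preserving the itineraries up to time `-n`.

In the `n`-th of these groups a chain splits into components, one for each tuple of labels, and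
two reindexings of the entries that agree on the labels agree on the component. Hence the natural
operators on the ordered chains of a finite set of labels act on it. One of them is the signed
sorting operator: it is chain homotopic to the identity, it kills the degenerate chains, and
`x - sort x` is always degenerate. If `h` is the homotopy and `x` a degenerate cycle, then `h x` has
boundary `x`, and so has the degenerate chain `h x - sort (h x)`. Finally let `n` tend to
infinity.
-/

namespace SmaleHomology

/-! ### Alternating functions and ordered chains -/

section Alternating

variable {V G : Type*} [AddCommGroup G] {K : ℕ}

/-- A function on tuples is alternating if it vanishes on tuples with repeated entries and changes
by the sign under permutations. -/
structure IsAlternating (t : (Fin K → V) → G) : Prop where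
  comp_perm : ∀ (a : Fin K → V) (α : Equiv.Perm (Fin K)),
    t (a ∘ α) = (Equiv.Perm.sign α : ℤ) • t a
  eq_zero : ∀ a : Fin K → V, ¬ Function.Injective a → t a = 0

/-- The alternating sum of the values of `t` on the faces of a tuple: the simplicial differential
with values in `G`. -/
def faceSum (t : (Fin K → V) → G) (a : Fin (K + 1) → V) : G :=
  ∑ l : Fin (K + 1), (-1 : ℤ) ^ (l : ℕ) • t (a ∘ l.succAbove)

lemma map_faceSum {H : Type*} [AddCommGroup H] (u : G →+ H) (t : (Fin K → V) → G)
    (a : Fin (K + 1) → V) : u (faceSum t a) = faceSum (fun b => u (t b)) a := by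
  simp only [faceSum, map_sum, map_zsmul]

namespace IsAlternating

lemma faceSum_swap {t : (Fin (K + 1) → V) → G} (ht : IsAlternating t) (a : Fin (K + 2) → V)
    (i : Fin (K + 1)) : faceSum t (a ∘ Equiv.swap i.castSucc i.succ) = -faceSum t a := by
  have hne : i.castSucc ≠ i.succ := Fin.castSucc_lt_succ.ne
  have castSucc_face : Equiv.swap i.castSucc i.succ ∘ i.castSucc.succAbove = i.succ.succAbove :=
    SUPair.swap_comp_succAbove i
  have succ_face : Equiv.swap i.castSucc i.succ ∘ i.succ.succAbove = i.castSucc.succAbove := by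
    rw [← castSucc_face, ← Function.comp_assoc, ← Equiv.coe_trans, Equiv.swap_swap]
    rfl
  rw [eq_neg_iff_add_eq_zero, faceSum, faceSum, ← Finset.sum_add_distrib,
    Fintype.sum_eq_add i.castSucc i.succ hne]
  · rw [Function.comp_assoc, Function.comp_assoc, castSucc_face, succ_face, Fin.val_succ,
      Fin.val_castSucc, pow_succ, mul_neg_one, neg_smul, neg_smul]
    abel
  · rintro k ⟨hkc, hks⟩
    obtain ⟨u, hu⟩ := Fin.exists_succAbove_eq hkc.symm
    obtain ⟨v, hv⟩ := Fin.exists_succAbove_eq hks.symm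
    have huv : u ≠ v := by
      rintro rfl
      exact hne (hu.symm.trans hv)
    have other_face : Equiv.swap i.castSucc i.succ ∘ k.succAbove =
        k.succAbove ∘ Equiv.swap u v := by
      rw [← hu, ← hv]
      exact (Fin.succAbove_right_injective (p := k)).swap_comp u v
    rw [Function.comp_assoc, other_face, ← Function.comp_assoc, ht.comp_perm,
      Equiv.Perm.sign_swap huv]
    simp

lemma faceSum_comp_perm {t : (Fin K → V) → G} (ht : IsAlternating t)
    (a : Fin (K + 1) → V) (α : Equiv.Perm (Fin (K + 1))) :
    faceSum t (a ∘ α) = (Equiv.Perm.sign α : ℤ) • faceSum t a := by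
  obtain _ | K := K
  · obtain rfl : α = 1 := Equiv.ext fun i => Subsingleton.elim (α := Fin 1) _ _
    simp
  have hα : α ∈ Submonoid.closure
      (Set.range fun i : Fin (K + 1) => Equiv.swap i.castSucc i.succ) := by
    simp only [Equiv.Perm.mclosure_swap_castSucc_succ, Submonoid.mem_top]
  induction hα using Submonoid.closure_induction generalizing a with
  | mem _ hx =>
    obtain ⟨i, rfl⟩ := hx
    simp [ht.faceSum_swap, Equiv.Perm.sign_swap Fin.castSucc_lt_succ.ne]
  | one => simp
  | mul α β _ _ hα hβ =>
    rw [Equiv.Perm.coe_mul, ← Function.comp_assoc, hβ, hα, smul_smul, Equiv.Perm.sign_mul,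
      Units.val_mul, mul_comm]

lemma faceSum_eq_zero_of_zero_eq_one {t : (Fin (K + 1) → V) → G} (ht : IsAlternating t)
    {a : Fin (K + 2) → V} (ha : a 0 = a 1) : faceSum t a = 0 := by
  rw [faceSum, Fintype.sum_eq_add 0 1 Fin.zero_ne_one]
  · have faces_eq : a ∘ Fin.succAbove 0 = a ∘ Fin.succAbove 1 := by
      funext k
      cases k using Fin.cases with
      | zero => simpa using ha.symm
      | succ k =>
        obtain _ | K := K
        · exact k.elim0
        · simp
    rw [faces_eq]
    simp
  · rintro k ⟨hk₀, hk₁⟩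
    obtain ⟨u, hu⟩ := Fin.exists_succAbove_eq hk₀.symm
    obtain ⟨v, hv⟩ := Fin.exists_succAbove_eq hk₁.symm
    have hface : ¬ Function.Injective (a ∘ k.succAbove) := fun h => by
      have huv : u = v := h (by simp only [Function.comp_apply, hu, hv, ha])
      exact Fin.zero_ne_one (hu.symm.trans ((congrArg _ huv).trans hv))
    rw [ht.eq_zero _ hface, smul_zero]

protected lemma faceSum {t : (Fin K → V) → G} (ht : IsAlternating t) :
    IsAlternating (faceSum t) where
  comp_perm := ht.faceSum_comp_perm
  eq_zero a ha := by
    obtain _ | K := K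
    · exact absurd (fun i j _ => Subsingleton.elim (α := Fin 1) i j) ha
    obtain ⟨i, j, hij, hne⟩ := Function.not_injective_iff.mp ha
    let β := Equiv.swap 0 i
    let α := β * Equiv.swap 1 (β j)
    have hβj : β j ≠ 0 := fun h =>
      hne (β.injective (h.trans (Equiv.swap_apply_right 0 i).symm)).symm
    have hα₀ : α 0 = i := by
      simp [α, β, Equiv.swap_apply_of_ne_of_ne Fin.zero_ne_one hβj.symm]
    have hα₁ : α 1 = j := by simp [α, β]
    have hα : faceSum t (a ∘ α) = 0 :=
      ht.faceSum_eq_zero_of_zero_eq_one (by simp only [Function.comp_apply, hα₀, hα₁, hij])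
    rw [ht.faceSum_comp_perm] at hα
    exact (smul_eq_zero_iff_eq (Equiv.Perm.sign α)).mp hα

lemma ext_strictMono [LinearOrder V] {t t' : (Fin K → V) → G} (ht : IsAlternating t)
    (ht' : IsAlternating t') (h : ∀ a, StrictMono a → t a = t' a) : t = t' := by
  funext a
  by_cases ha : Function.Injective a
  · have hsort := h (a ∘ Tuple.sort a)
      ((Tuple.monotone_sort a).strictMono_of_injective (ha.comp (Tuple.sort a).injective))
    rw [ht.comp_perm, ht'.comp_perm] at hsort
    exact smul_left_cancel (Equiv.Perm.sign (Tuple.sort a)) hsort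
  · rw [ht.eq_zero a ha, ht'.eq_zero a ha]

lemma map {H : Type*} [AddCommGroup H] {t : (Fin K → V) → G} (ht : IsAlternating t) (u : G →+ H) :
    IsAlternating fun a => u (t a) where
  comp_perm a α := by rw [ht.comp_perm, map_zsmul]
  eq_zero a ha := by rw [ht.eq_zero a ha, map_zero]

end IsAlternating

end Alternating

/-- Ordered chains: the free abelian group on the tuples of length `K`. A chain of length `K + 1`
has simplicial degree `K`, so that the complex of ordered chains is augmented. -/
abbrev OrderedChain (V : Type*) (K : ℕ) := FreeAbelianGroup (Fin K → V)

namespace OrderedChain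

variable {V : Type*} {J K L : ℕ}

/-- The augmented simplicial differential of ordered chains. -/
def bd (V : Type*) (K : ℕ) : OrderedChain V (K + 1) →+ OrderedChain V K :=
  FreeAbelianGroup.lift (faceSum FreeAbelianGroup.of)

lemma bd_of (a : Fin (K + 1) → V) : bd V K (.of a) = faceSum FreeAbelianGroup.of a :=
  FreeAbelianGroup.lift_apply_of _ _

/-- The cone operator, putting the vertex `v` in front of every tuple. -/
def cone (v : V) (K : ℕ) : OrderedChain V K →+ OrderedChain V (K + 1) :=
  FreeAbelianGroup.map fun a => (Fin.cons v a : Fin (K + 1) → V)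

lemma cone_of (v : V) (a : Fin K → V) : cone v K (.of a) = .of (Fin.cons v a : Fin (K + 1) → V) :=
  FreeAbelianGroup.map_of_apply _

lemma bd_cone (v : V) (x : OrderedChain V (K + 1)) :
    bd V (K + 1) (cone v (K + 1) x) = x - cone v K (bd V K x) := by
  suffices h : (bd V (K + 1)).comp (cone v (K + 1)) =
      AddMonoidHom.id _ - (cone v K).comp (bd V K) from DFunLike.congr_fun h x
  refine FreeAbelianGroup.lift_ext _ _ fun a => ?_
  have succ_face (l : Fin (K + 1)) : (Fin.cons v a : Fin (K + 2) → V) ∘ l.succ.succAbove =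
      Fin.cons v (a ∘ l.succAbove) := by
    funext i
    cases i using Fin.cases <;> simp
  simp only [AddMonoidHom.comp_apply, AddMonoidHom.sub_apply, AddMonoidHom.id_apply, cone_of,
    bd_of, map_faceSum]
  rw [faceSum, Fin.sum_univ_succ, faceSum, sub_eq_add_neg, ← Finset.sum_neg_distrib]
  congr 1
  refine Finset.sum_congr rfl fun l _ => ?_
  rw [succ_face, Fin.val_succ, pow_succ, mul_neg_one, neg_smul]

lemma hom_ext_cone {G : Type*} [AddCommGroup G] {f g : OrderedChain V (K + 1) →+ G}
    (h : ∀ v, f.comp (cone v K) = g.comp (cone v K)) : f = g := by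
  refine FreeAbelianGroup.lift_ext _ _ fun a => ?_
  have := DFunLike.congr_fun (h (a 0)) (.of (Fin.tail a))
  simpa only [AddMonoidHom.comp_apply, cone_of, Fin.cons_self_tail] using this

lemma bd_bd (x : OrderedChain V (K + 2)) : bd V K (bd V (K + 1) x) = 0 := by
  induction K with
  | zero =>
    suffices h : (bd V 0).comp (bd V 1) = 0 from DFunLike.congr_fun h x
    refine FreeAbelianGroup.lift_ext _ _ fun a => ?_
    simp [bd_of, faceSum, Subsingleton.elim (_ : Fin 0 → V) default]
  | succ K ih =>
    suffices h : (bd V (K + 1)).comp (bd V (K + 2)) = 0 from DFunLike.congr_fun h x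
    refine hom_ext_cone fun v => AddMonoidHom.ext fun y => ?_
    simp only [AddMonoidHom.comp_apply, bd_cone, map_sub, ih, map_zero, AddMonoidHom.zero_apply]
    abel

section Sorting

variable [LinearOrder V]

open Classical in
/-- The increasing rearrangement of a tuple with its sign; it is zero if an entry is repeated. -/
noncomputable def signedSort (a : Fin K → V) : OrderedChain V K :=
  if Function.Injective a then (Equiv.Perm.sign (Tuple.sort a) : ℤ) • .of (a ∘ Tuple.sort a) else 0

lemma signedSort_of_injective {a : Fin K → V} (ha : Function.Injective a) :
    signedSort a = (Equiv.Perm.sign (Tuple.sort a) : ℤ) • .of (a ∘ Tuple.sort a) := if_pos ha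

lemma signedSort_of_strictMono {a : Fin K → V} (ha : StrictMono a) : signedSort a = .of a := by
  have hsort : Tuple.sort a = Equiv.refl _ := Tuple.sort_eq_refl_iff_monotone.mpr ha.monotone
  rw [signedSort_of_injective ha.injective, hsort]
  simp

lemma isAlternating_signedSort :
    IsAlternating (signedSort : (Fin K → V) → OrderedChain V K) where
  comp_perm a α := by
    by_cases ha : Function.Injective a
    · have comp_sort : (a ∘ α) ∘ Tuple.sort (a ∘ α) = a ∘ Tuple.sort a :=
        Tuple.comp_perm_comp_sort_eq_comp_sort
      have mul_sort : α * Tuple.sort (a ∘ α) = Tuple.sort a :=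
        Equiv.ext fun i => ha (congrFun comp_sort i)
      rw [signedSort_of_injective ha, signedSort_of_injective (ha.comp α.injective), comp_sort,
        ← mul_sort, Equiv.Perm.sign_mul, Units.val_mul, smul_smul, ← mul_assoc,
        Int.units_coe_mul_self, one_mul]
    · have haα : ¬ Function.Injective (a ∘ α) := by rwa [Equiv.injective_comp]
      rw [signedSort, signedSort, if_neg ha, if_neg haα, smul_zero]
  eq_zero _ ha := if_neg ha

/-- The linear extension of `signedSort`: the projection of the ordered chains onto the chains
spanned by the increasing tuples. -/
noncomputable def sort (V : Type*) [LinearOrder V] (K : ℕ) : OrderedChain V K →+ OrderedChain V K :=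
  FreeAbelianGroup.lift signedSort

lemma sort_of (a : Fin K → V) : sort V K (.of a) = signedSort a :=
  FreeAbelianGroup.lift_apply_of _ _

lemma bd_sort (x : OrderedChain V (K + 1)) : bd V K (sort V (K + 1) x) = sort V K (bd V K x) := by
  suffices h : (bd V K).comp (sort V (K + 1)) = (sort V K).comp (bd V K) from DFunLike.congr_fun h x
  refine FreeAbelianGroup.lift_ext _ _ fun a => ?_
  simp only [AddMonoidHom.comp_apply, bd_of, map_faceSum, sort_of]
  -- Both sides are alternating in `a`, so that only increasing tuples have to be checked.
  refine congrFun ((isAlternating_signedSort.map _).ext_strictMono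
    isAlternating_signedSort.faceSum fun a ha => ?_) a
  rw [signedSort_of_strictMono ha, bd_of]
  exact Finset.sum_congr rfl fun l _ => by
    rw [signedSort_of_strictMono (ha.comp (Fin.strictMono_succAbove l))]

lemma sort_zero : sort V 0 = AddMonoidHom.id _ :=
  FreeAbelianGroup.lift_ext _ _ fun a => by
    rw [sort_of, signedSort_of_strictMono (Subsingleton.strictMono a), AddMonoidHom.id_apply]

/-- The chain homotopy between the identity and `sort`, obtained from acyclic models: the vertices
of a tuple span an acyclic complex, contracted by the cone over the first vertex. -/
noncomputable def homotopy (V : Type*) [LinearOrder V] :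
    (K : ℕ) → OrderedChain V K →+ OrderedChain V (K + 1)
  | 0 => 0
  | K + 1 => FreeAbelianGroup.lift fun a =>
      cone (a 0) (K + 1) (.of a - sort V (K + 1) (.of a) - homotopy V K (bd V K (.of a)))

lemma homotopy_of (a : Fin (K + 1) → V) : homotopy V (K + 1) (.of a) =
    cone (a 0) (K + 1) (.of a - sort V (K + 1) (.of a) - homotopy V K (bd V K (.of a))) :=
  FreeAbelianGroup.lift_apply_of _ _

lemma bd_homotopy_of_cycles (h : ∀ y : OrderedChain V (K + 1),
      bd V K (homotopy V K (bd V K y)) = bd V K y - sort V K (bd V K y))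
    (x : OrderedChain V (K + 1)) :
    bd V (K + 1) (homotopy V (K + 1) x) + homotopy V K (bd V K x) = x - sort V (K + 1) x := by
  suffices hcomp : (bd V (K + 1)).comp (homotopy V (K + 1)) + (homotopy V K).comp (bd V K) =
      AddMonoidHom.id _ - sort V (K + 1) from DFunLike.congr_fun hcomp x
  refine FreeAbelianGroup.lift_ext _ _ fun a => ?_
  simp only [AddMonoidHom.add_apply, AddMonoidHom.comp_apply, AddMonoidHom.sub_apply,
    AddMonoidHom.id_apply]
  rw [homotopy_of, bd_cone, map_sub (bd V K), map_sub (bd V K), h, bd_sort, sub_self, map_zero,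
    sub_zero, sub_add_cancel]

lemma bd_homotopy (x : OrderedChain V (K + 1)) :
    bd V (K + 1) (homotopy V (K + 1) x) + homotopy V K (bd V K x) = x - sort V (K + 1) x := by
  induction K with
  | zero => exact bd_homotopy_of_cycles (by simp [homotopy, sort_zero]) x
  | succ K ih =>
    refine bd_homotopy_of_cycles (fun y => ?_) x
    simpa only [bd_bd, map_zero, add_zero] using ih (bd V (K + 1) y)

end Sorting

/-- The chains supported on the vertices of `a`. -/
def carrier (a : Fin L → V) (K : ℕ) : AddSubgroup (OrderedChain V K) :=
  AddSubgroup.closure (Set.range fun θ : Fin K → Fin L => FreeAbelianGroup.of (a ∘ θ))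

lemma of_comp_mem_carrier (a : Fin L → V) (θ : Fin K → Fin L) :
    FreeAbelianGroup.of (a ∘ θ) ∈ carrier a K :=
  AddSubgroup.subset_closure ⟨θ, rfl⟩

lemma of_mem_carrier (a : Fin K → V) : FreeAbelianGroup.of a ∈ carrier a K :=
  of_comp_mem_carrier a id

lemma eqOn_carrier {a : Fin L → V} {G : Type*} [AddCommGroup G] {f g : OrderedChain V K →+ G}
    (h : ∀ θ : Fin K → Fin L, f (.of (a ∘ θ)) = g (.of (a ∘ θ))) :
    Set.EqOn f g (carrier a K) := by
  refine AddMonoidHom.eqOn_closure ?_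
  rintro _ ⟨θ, rfl⟩
  exact h θ

lemma map_mem_of_mem_carrier {a : Fin L → V} {G : Type*} [AddCommGroup G] {H : AddSubgroup G}
    {f : OrderedChain V K →+ G} (h : ∀ θ : Fin K → Fin L, f (.of (a ∘ θ)) ∈ H)
    {x : OrderedChain V K} (hx : x ∈ carrier a K) : f x ∈ H := by
  suffices hle : carrier a K ≤ H.comap f from hle hx
  refine (AddSubgroup.closure_le _).mpr ?_
  rintro _ ⟨θ, rfl⟩
  exact h θ

lemma carrier_comp_le (a : Fin L → V) (θ : Fin J → Fin L) : carrier (a ∘ θ) K ≤ carrier a K :=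
  fun _ => map_mem_of_mem_carrier (f := AddMonoidHom.id _) fun τ => of_comp_mem_carrier a (θ ∘ τ)

/-- Operators sending a tuple to a chain supported on its vertices. -/
def IsCarried (T : OrderedChain V K →+ OrderedChain V J) : Prop :=
  ∀ a : Fin K → V, T (.of a) ∈ carrier a J

lemma IsCarried.apply_mem {T : OrderedChain V K →+ OrderedChain V J} (hT : IsCarried T)
    {a : Fin L → V} {x : OrderedChain V K} (hx : x ∈ carrier a K) : T x ∈ carrier a J :=
  map_mem_of_mem_carrier (fun θ => carrier_comp_le a θ (hT (a ∘ θ))) hx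

lemma cone_mem_carrier (a : Fin L → V) (i : Fin L) {x : OrderedChain V K}
    (hx : x ∈ carrier a K) : cone (a i) K x ∈ carrier a (K + 1) := by
  refine map_mem_of_mem_carrier (fun θ => ?_) hx
  rw [cone_of]
  convert of_comp_mem_carrier a (Fin.cons i θ : Fin (K + 1) → Fin L) using 2
  funext j
  cases j using Fin.cases <;> simp

lemma isCarried_bd : IsCarried (bd V K) := fun a => by
  rw [bd_of]
  exact sum_mem fun l _ => zsmul_mem (of_comp_mem_carrier a _) _

section Sorting

variable [LinearOrder V]

lemma isCarried_sort : IsCarried (sort V K) := fun a => by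
  rw [sort_of, signedSort]
  split_ifs
  · exact zsmul_mem (of_comp_mem_carrier a _) _
  · exact zero_mem _

lemma isCarried_homotopy : ∀ K, IsCarried (homotopy V K)
  | 0 => fun _ => zero_mem _
  | K + 1 => fun a => by
    rw [homotopy_of]
    exact cone_mem_carrier a 0 (sub_mem (sub_mem (of_mem_carrier a) (isCarried_sort a))
      ((isCarried_homotopy K).apply_mem (isCarried_bd a)))

end Sorting

end OrderedChain

/-! ### Symmetric systems and degenerate chains -/

/-- A contravariant functor from the finite sets `Fin (L + 1)` and all maps between them to abelian
groups: a simplicial abelian group together with an action of the symmetric groups. -/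
structure SymmetricSystem where
  obj : ℕ → Type*
  [grp : ∀ L, AddCommGroup (obj L)]
  pull : ∀ {K L : ℕ}, (Fin (K + 1) → Fin (L + 1)) → obj L →+ obj K
  pull_pull : ∀ {J K L : ℕ} (θ : Fin (K + 1) → Fin (L + 1)) (τ : Fin (J + 1) → Fin (K + 1))
    (x : obj L), pull τ (pull θ x) = pull (θ ∘ τ) x
  pull_id : ∀ {L : ℕ} (x : obj L), pull id x = x

namespace SymmetricSystem

attribute [instance] SymmetricSystem.grp

section Degenerate

variable (A : SymmetricSystem) {K L : ℕ}

/-- The alternating sum of the face maps. -/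
def bdy (L : ℕ) : A.obj (L + 1) →+ A.obj L :=
  ∑ l : Fin (L + 2), (-1 : ℤ) ^ (l : ℕ) • A.pull l.succAbove

lemma bdy_apply (x : A.obj (L + 1)) :
    A.bdy L x = ∑ l : Fin (L + 2), (-1 : ℤ) ^ (l : ℕ) • A.pull l.succAbove x := by
  simp only [bdy, AddMonoidHom.finsetSum_apply, AddMonoidHom.zsmul_apply]

/-- The degenerate chains, generated by the images of the non-injective reindexings and by the
defect of the permutations to act by their sign. -/
def DC (L : ℕ) : AddSubgroup (A.obj L) :=
  AddSubgroup.closure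
    ({x | ∃ θ : Fin (L + 1) → Fin (L + 1), ¬ Function.Injective θ ∧ ∃ y, A.pull θ y = x} ∪
      {x | ∃ (α : Equiv.Perm (Fin (L + 1))) (y : A.obj L),
        A.pull α y - (Equiv.Perm.sign α : ℤ) • y = x})

lemma pull_mem_DC {θ : Fin (L + 1) → Fin (L + 1)} (hθ : ¬ Function.Injective θ) (y : A.obj L) :
    A.pull θ y ∈ A.DC L :=
  AddSubgroup.subset_closure (Or.inl ⟨θ, hθ, y, rfl⟩)

lemma pull_perm_sub_mem_DC (α : Equiv.Perm (Fin (L + 1))) (y : A.obj L) :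
    A.pull α y - (Equiv.Perm.sign α : ℤ) • y ∈ A.DC L :=
  AddSubgroup.subset_closure (Or.inr ⟨α, y, rfl⟩)

variable {A}

lemma DC_le {H : AddSubgroup (A.obj L)}
    (hdeg : ∀ θ : Fin (L + 1) → Fin (L + 1), ¬ Function.Injective θ → ∀ y, A.pull θ y ∈ H)
    (hperm : ∀ (α : Equiv.Perm (Fin (L + 1))) (y : A.obj L),
      A.pull α y - (Equiv.Perm.sign α : ℤ) • y ∈ H) : A.DC L ≤ H := by
  refine (AddSubgroup.closure_le _).mpr ?_
  rintro _ (⟨θ, hθ, y, rfl⟩ | ⟨α, y, rfl⟩)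
  · exact hdeg θ hθ y
  · exact hperm α y

lemma DC_zero : A.DC 0 = ⊥ := by
  refine le_bot_iff.mp (DC_le (fun θ hθ _ => ?_) fun α y => ?_)
  · exact absurd (fun i j _ => Subsingleton.elim (α := Fin 1) i j) hθ
  · obtain rfl : α = 1 := Equiv.ext fun i => Subsingleton.elim (α := Fin 1) _ _
    simpa [sub_eq_zero] using A.pull_id y

end Degenerate

section Intertwines

variable {A B : SymmetricSystem} {K L : ℕ}

/-- Two homomorphisms between the groups of two symmetric systems, in the degrees `L` and `K`,
commute with the reindexings from degree `L` to degree `K`. -/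
def Intertwines (f : A.obj L →+ B.obj L) (g : A.obj K →+ B.obj K) : Prop :=
  ∀ (θ : Fin (K + 1) → Fin (L + 1)) (x : A.obj L), g (A.pull θ x) = B.pull θ (f x)

lemma Intertwines.map_bdy {f : A.obj (L + 1) →+ B.obj (L + 1)} {g : A.obj L →+ B.obj L}
    (h : Intertwines f g) (x : A.obj (L + 1)) : g (A.bdy L x) = B.bdy L (f x) := by
  simp only [bdy_apply, map_sum, map_zsmul, h _ x]

lemma Intertwines.map_mem_DC {f : A.obj L →+ B.obj L} (h : Intertwines f f) {x : A.obj L}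
    (hx : x ∈ A.DC L) : f x ∈ B.DC L := by
  suffices hle : A.DC L ≤ (B.DC L).comap f from hle hx
  refine DC_le (fun θ hθ y => ?_) fun α y => ?_
  · rw [AddSubgroup.mem_comap, h]
    exact B.pull_mem_DC hθ _
  · rw [AddSubgroup.mem_comap, map_sub, map_zsmul, h]
    exact B.pull_perm_sub_mem_DC α _

lemma Intertwines.exists_mem_DC_eq {f : A.obj L →+ B.obj L} (h : Intertwines f f)
    (hf : Function.Surjective f) {y : B.obj L} (hy : y ∈ B.DC L) : ∃ x ∈ A.DC L, f x = y := by
  suffices hle : B.DC L ≤ (A.DC L).map f from hle hy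
  refine DC_le (fun θ hθ y => ?_) fun α y => ?_
  · obtain ⟨x, rfl⟩ := hf y
    exact ⟨_, A.pull_mem_DC hθ x, h θ x⟩
  · obtain ⟨x, rfl⟩ := hf y
    exact ⟨_, A.pull_perm_sub_mem_DC α x, by rw [map_sub, map_zsmul, h]⟩

end Intertwines

end SymmetricSystem

/-- A symmetric system graded by tuples of labels in `V`: `proj a` is the projection onto the
elements whose entries have the labels `a`. Reindexings which agree on the labels agree on these
elements. -/
structure LabelledSystem (V : Type*) [Fintype V] extends SymmetricSystem where
  proj : ∀ {L : ℕ}, (Fin (L + 1) → V) → obj L →+ obj L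
  sum_proj : ∀ {L : ℕ} (x : obj L), ∑ a, proj a x = x
  proj_pull_proj : ∀ {K L : ℕ} (θ : Fin (K + 1) → Fin (L + 1)) (a : Fin (L + 1) → V) (x : obj L),
    proj (a ∘ θ) (pull θ (proj a x)) = pull θ (proj a x)
  proj_pull_proj_of_ne : ∀ {K L : ℕ} (θ : Fin (K + 1) → Fin (L + 1)) (a : Fin (L + 1) → V)
    (b : Fin (K + 1) → V) (x : obj L), b ≠ a ∘ θ → proj b (pull θ (proj a x)) = 0
  pull_congr : ∀ {K L : ℕ} (θ θ' : Fin (K + 1) → Fin (L + 1)) (a : Fin (L + 1) → V) (x : obj L),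
    a ∘ θ = a ∘ θ' → pull θ (proj a x) = pull θ' (proj a x)

namespace LabelledSystem

variable {V : Type*} [Fintype V] (A : LabelledSystem V) {J K L : ℕ}

open Classical in
/-- The action of an ordered chain on the elements with label `a`: the tuple `a ∘ θ` acts by the
reindexing along `θ`, and tuples with a vertex outside of `a` act by zero. -/
noncomputable def eval (a : Fin (L + 1) → V) (K : ℕ) :
    OrderedChain V (K + 1) →+ A.obj L →+ A.obj K :=
  FreeAbelianGroup.lift fun b =>
    if h : ∃ θ : Fin (K + 1) → Fin (L + 1), a ∘ θ = b then (A.pull h.choose).comp (A.proj a) else 0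

lemma eval_of_comp (a : Fin (L + 1) → V) (θ : Fin (K + 1) → Fin (L + 1)) (x : A.obj L) :
    A.eval a K (.of (a ∘ θ)) x = A.pull θ (A.proj a x) := by
  have h : ∃ τ : Fin (K + 1) → Fin (L + 1), a ∘ τ = a ∘ θ := ⟨θ, rfl⟩
  rw [eval, FreeAbelianGroup.lift_apply_of, dif_pos h]
  exact A.pull_congr _ _ a x h.choose_spec

lemma eval_of_self (a : Fin (L + 1) → V) (x : A.obj L) : A.eval a L (.of a) x = A.proj a x :=
  (A.eval_of_comp a id x).trans (A.pull_id _)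

lemma eval_eq_zero {a : Fin (L + 1) → V} {x : A.obj L} (hx : A.proj a x = 0)
    (o : OrderedChain V (K + 1)) : A.eval a K o x = 0 := by
  suffices h : (A.eval a K).flip x = 0 from DFunLike.congr_fun h o
  refine FreeAbelianGroup.lift_ext _ _ fun b => ?_
  rw [AddMonoidHom.flip_apply, eval, FreeAbelianGroup.lift_apply_of]
  split_ifs <;> simp [hx]

lemma eval_pull (a : Fin (L + 1) → V) (θ : Fin (K + 1) → Fin (L + 1)) (x : A.obj L)
    {o : OrderedChain V (J + 1)} (ho : o ∈ OrderedChain.carrier (a ∘ θ) (J + 1)) :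
    A.eval (a ∘ θ) J o (A.pull θ (A.proj a x)) = A.eval a J o x := by
  refine OrderedChain.eqOn_carrier (f := (A.eval (a ∘ θ) J).flip (A.pull θ (A.proj a x)))
    (g := (A.eval a J).flip x) (fun τ => ?_) ho
  rw [AddMonoidHom.flip_apply, AddMonoidHom.flip_apply, eval_of_comp, Function.comp_assoc,
    eval_of_comp, proj_pull_proj, A.pull_pull]

lemma bdy_eval (a : Fin (L + 1) → V) (x : A.obj L) {o : OrderedChain V (K + 2)}
    (ho : o ∈ OrderedChain.carrier a (K + 2)) :
    A.bdy K (A.eval a (K + 1) o x) = A.eval a K (OrderedChain.bd V (K + 1) o) x := by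
  refine OrderedChain.eqOn_carrier (f := (A.bdy K).comp ((A.eval a (K + 1)).flip x))
    (g := ((A.eval a K).flip x).comp (OrderedChain.bd V (K + 1))) (fun τ => ?_) ho
  simp only [AddMonoidHom.comp_apply, AddMonoidHom.flip_apply, eval_of_comp, OrderedChain.bd_of,
    faceSum, SymmetricSystem.bdy_apply, A.pull_pull, map_sum, map_zsmul, Function.comp_assoc]

/-- The operator on a labelled system induced by an operator on the ordered chains of labels. -/
noncomputable def op (T : OrderedChain V (L + 1) →+ OrderedChain V (K + 1)) : A.obj L →+ A.obj K :=
  ∑ a, A.eval a K (T (.of a))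

lemma op_apply (T : OrderedChain V (L + 1) →+ OrderedChain V (K + 1)) (x : A.obj L) :
    A.op T x = ∑ a, A.eval a K (T (.of a)) x :=
  AddMonoidHom.finsetSum_apply _ _ _

lemma op_id (x : A.obj L) : A.op (AddMonoidHom.id _) x = x := by
  simp only [op_apply, AddMonoidHom.id_apply, eval_of_self, sum_proj]

lemma op_add (T T' : OrderedChain V (L + 1) →+ OrderedChain V (K + 1)) (x : A.obj L) :
    A.op (T + T') x = A.op T x + A.op T' x := by
  simp only [op_apply, AddMonoidHom.add_apply, map_add, Finset.sum_add_distrib]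

lemma op_sub (T T' : OrderedChain V (L + 1) →+ OrderedChain V (K + 1)) (x : A.obj L) :
    A.op (T - T') x = A.op T x - A.op T' x := by
  simp only [op_apply, AddMonoidHom.sub_apply, map_sub, Finset.sum_sub_distrib]

section Carried

variable {T : OrderedChain V (K + 1) →+ OrderedChain V (J + 1)}

lemma op_pull_proj (hT : OrderedChain.IsCarried T) (a : Fin (L + 1) → V)
    (θ : Fin (K + 1) → Fin (L + 1)) (x : A.obj L) :
    A.op T (A.pull θ (A.proj a x)) = A.eval a J (T (.of (a ∘ θ))) x := by
  rw [op_apply, Finset.sum_eq_single (a ∘ θ), A.eval_pull a θ x (hT _)]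
  · exact fun b _ hb => A.eval_eq_zero (A.proj_pull_proj_of_ne θ a b x hb) _
  · simp

lemma op_pull (hT : OrderedChain.IsCarried T) (θ : Fin (K + 1) → Fin (L + 1)) (x : A.obj L) :
    A.op T (A.pull θ x) = ∑ a : Fin (L + 1) → V, A.eval a J (T (.of (a ∘ θ))) x := by
  conv_lhs => rw [← A.sum_proj x, map_sum, map_sum]
  exact Finset.sum_congr rfl fun a _ => A.op_pull_proj hT a θ x

lemma op_bdy (hT : OrderedChain.IsCarried T) (x : A.obj (K + 1)) :
    A.op T (A.bdy K x) = A.op (T.comp (OrderedChain.bd V (K + 1))) x := by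
  simp only [SymmetricSystem.bdy_apply, map_sum, map_zsmul, A.op_pull hT, op_apply,
    AddMonoidHom.comp_apply, OrderedChain.bd_of, faceSum, AddMonoidHom.finsetSum_apply,
    AddMonoidHom.zsmul_apply, Finset.smul_sum]
  exact Finset.sum_comm

lemma bdy_op {T : OrderedChain V (L + 1) →+ OrderedChain V (K + 2)}
    (hT : OrderedChain.IsCarried T) (x : A.obj L) :
    A.bdy K (A.op T x) = A.op ((OrderedChain.bd V (K + 1)).comp T) x := by
  rw [op_apply, op_apply, map_sum]
  exact Finset.sum_congr rfl fun a _ => A.bdy_eval a x (hT a)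

end Carried

section Sorting

open OrderedChain

variable [LinearOrder V]

lemma bdy_op_sort (x : A.obj (L + 1)) :
    A.bdy L (A.op (sort V (L + 2)) x) = A.op (sort V (L + 1)) (A.bdy L x) := by
  rw [A.bdy_op isCarried_sort, A.op_bdy isCarried_sort]
  congr 2
  exact AddMonoidHom.ext bd_sort

lemma bdy_op_homotopy (x : A.obj (L + 1)) :
    A.bdy (L + 1) (A.op (homotopy V (L + 2)) x) + A.op (homotopy V (L + 1)) (A.bdy L x) =
      x - A.op (sort V (L + 2)) x := by
  have hcomp : (bd V (L + 2)).comp (homotopy V (L + 2)) +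
      (homotopy V (L + 1)).comp (bd V (L + 1)) = AddMonoidHom.id _ - sort V (L + 2) :=
    AddMonoidHom.ext bd_homotopy
  rw [A.bdy_op (isCarried_homotopy _), A.op_bdy (isCarried_homotopy _), ← op_add, hcomp, op_sub,
    op_id]

lemma op_sort_eq_zero {x : A.obj L} (hx : x ∈ A.DC L) : A.op (sort V (L + 1)) x = 0 := by
  suffices h : A.DC L ≤ (A.op (sort V (L + 1))).ker from h hx
  refine SymmetricSystem.DC_le (fun θ hθ y => ?_) fun α y => ?_
  · rw [AddMonoidHom.mem_ker, A.op_pull isCarried_sort]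
    refine Finset.sum_eq_zero fun a _ => ?_
    rw [sort_of, isAlternating_signedSort.eq_zero _ fun h => hθ h.of_comp, map_zero,
      AddMonoidHom.zero_apply]
  · rw [AddMonoidHom.mem_ker, map_sub, map_zsmul, A.op_pull isCarried_sort, op_apply,
      Finset.smul_sum, sub_eq_zero]
    refine Finset.sum_congr rfl fun a _ => ?_
    rw [sort_of, sort_of, isAlternating_signedSort.comp_perm, map_zsmul, AddMonoidHom.zsmul_apply]

lemma proj_sub_eval_signedSort_mem_DC (a : Fin (L + 1) → V) (x : A.obj L) :
    A.proj a x - A.eval a L (signedSort a) x ∈ A.DC L := by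
  by_cases ha : Function.Injective a
  · have h := zsmul_mem (A.pull_perm_sub_mem_DC (Tuple.sort a) (A.proj a x))
      (-(Equiv.Perm.sign (Tuple.sort a) : ℤ))
    rw [signedSort_of_injective ha, map_zsmul, AddMonoidHom.zsmul_apply, eval_of_comp]
    convert h using 1
    rw [smul_sub, neg_smul, neg_smul, smul_smul, Int.units_coe_mul_self, one_smul]
    abel
  · -- Two entries carry the same label, hence may be exchanged for two copies of one of them.
    rw [isAlternating_signedSort.eq_zero _ ha, map_zero, AddMonoidHom.zero_apply, sub_zero]
    obtain ⟨i, j, hij, hne⟩ := Function.not_injective_iff.mp ha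
    have hcopy : a ∘ id = a ∘ Function.update id j i := by
      rw [Function.comp_update, Function.comp_id, hij, Function.update_eq_self]
    rw [← A.pull_id (A.proj a x), A.pull_congr _ _ a x hcopy]
    refine A.pull_mem_DC (Function.not_injective_iff.mpr ⟨i, j, ?_, hne⟩) _
    rw [Function.update_self, Function.update_of_ne hne, id]

lemma sub_op_sort_mem_DC (x : A.obj L) : x - A.op (sort V (L + 1)) x ∈ A.DC L := by
  rw [op_apply]
  nth_rewrite 1 [← A.sum_proj x]
  rw [← Finset.sum_sub_distrib]
  exact sum_mem fun a _ => by
    rw [sort_of]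
    exact A.proj_sub_eval_signedSort_mem_DC a x

theorem exists_bdy_eq {x : A.obj (L + 1)} (hx : x ∈ A.DC (L + 1)) (h : A.bdy L x = 0) :
    ∃ y ∈ A.DC (L + 2), A.bdy (L + 1) y = x := by
  have bdy_homotopy : A.bdy (L + 1) (A.op (homotopy V (L + 2)) x) = x := by
    simpa only [h, map_zero, add_zero, A.op_sort_eq_zero hx, sub_zero] using A.bdy_op_homotopy x
  refine ⟨_, A.sub_op_sort_mem_DC (A.op (homotopy V (L + 2)) x), ?_⟩
  rw [map_sub, bdy_op_sort, bdy_homotopy, A.op_sort_eq_zero hx, sub_zero]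

end Sorting

end LabelledSystem

/-! ### Holonomies between compact open subsets of stable sets -/

open Filter Topology

section Leafwise

variable {X W U : Type*} [MetricSpace X] [MetricSpace W] [MetricSpace U]

lemma localSet_mono {φ : X → X} {x : X} {δ δ' : ℝ} (h : δ ≤ δ') :
    localSet φ x δ ⊆ localSet φ x δ' := fun _ hy => ⟨hy.1, fun n => (hy.2 n).trans_le h⟩

lemma dist_lt_of_mem_localSet {φ : X → X} {x y : X} {δ : ℝ} (h : y ∈ localSet φ x δ) :
    dist x y < δ := h.2 0

/-- Continuity for the leaf topologies. -/
def LeafContinuous (φ : X → X) (ψ : W → W) {E : Set X} {F : Set W} (h : E → F) : Prop :=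
  ∀ x : E, ∀ ε > 0, ∃ δ > 0, ∀ x' : E, (x' : X) ∈ localSet φ x δ →
    (h x' : W) ∈ localSet ψ (h x) ε

/-- Local constancy for the leaf topology. -/
def LeafConstant (φ : X → X) {E : Set X} {T : Type*} (ℓ : E → T) : Prop :=
  ∀ x : E, ∃ δ > 0, ∀ x' : E, (x' : X) ∈ localSet φ x δ → ℓ x' = ℓ x

lemma LeafContinuous.comp {φ : X → X} {ψ : W → W} {χ : U → U} {E : Set X} {F : Set W} {G : Set U}
    {g : F → G} {h : E → F} (hg : LeafContinuous ψ χ g) (hh : LeafContinuous φ ψ h) :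
    LeafContinuous φ χ (g ∘ h) := by
  intro x ε hε
  obtain ⟨δ, hδ, h1⟩ := hg (h x) ε hε
  obtain ⟨δ', hδ', h2⟩ := hh x δ hδ
  exact ⟨δ', hδ', fun x' hx' => h1 _ (h2 _ hx')⟩

lemma LeafContinuous.id {φ : X → X} {E : Set X} : LeafContinuous φ φ (id : E → E) :=
  fun _ ε hε => ⟨ε, hε, fun _ h => h⟩

lemma LeafConstant.comp {φ : X → X} {ψ : W → W} {E : Set X} {F : Set W} {T : Type*}
    {ℓ : F → T} {h : E → F} (hℓ : LeafConstant ψ ℓ) (hh : LeafContinuous φ ψ h) :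
    LeafConstant φ (ℓ ∘ h) := by
  intro x
  obtain ⟨δ, hδ, h1⟩ := hℓ (h x)
  obtain ⟨δ', hδ', h2⟩ := hh x δ hδ
  exact ⟨δ', hδ', fun x' hx' => h1 _ (h2 _ hx')⟩

lemma LeafConstant.prodMk {φ : X → X} {E : Set X} {T T' : Type*} {ℓ : E → T} {ℓ' : E → T'}
    (h : LeafConstant φ ℓ) (h' : LeafConstant φ ℓ') : LeafConstant φ fun x => (ℓ x, ℓ' x) := by
  intro x
  obtain ⟨δ, hδ, h1⟩ := h x
  obtain ⟨δ', hδ', h2⟩ := h' x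
  exact ⟨min δ δ', lt_min hδ hδ', fun x' hx' => Prod.ext
    (h1 _ (localSet_mono (min_le_left _ _) hx')) (h2 _ (localSet_mono (min_le_right _ _) hx'))⟩

lemma LeafConstant.pi {φ : X → X} {E : Set X} {ι T : Type*} [Finite ι] {ℓ : ι → E → T}
    (h : ∀ i, LeafConstant φ (ℓ i)) : LeafConstant φ fun x i => ℓ i x := by
  intro x
  choose δ hδ h1 using fun i => h i x
  have h2 : ∀ᶠ r in 𝓝[>] (0 : ℝ), ∀ i, r < δ i :=
    eventually_all.mpr fun i => nhdsWithin_le_nhds (Iio_mem_nhds (hδ i))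
  obtain ⟨r, hr, hr0⟩ := (h2.and self_mem_nhdsWithin).exists
  exact ⟨r, hr0, fun x' hx' => funext fun i => h1 i _ (localSet_mono (hr i).le hx')⟩

variable {S : SmaleSpace X} {T : SmaleSpace W} {f : X → W}

lemma IsMap.exists_localSet [CompactSpace X] (hf : IsMap S T f) {ε : ℝ} (hε : 0 < ε) :
    ∃ δ > 0, ∀ x y, y ∈ localSet S.φ x δ → f y ∈ localSet T.φ (f x) ε := by
  have hu := CompactSpace.uniformContinuous_of_continuous hf.continuous
  rw [Metric.uniformContinuous_iff] at hu
  obtain ⟨δ, hδ, hd⟩ := hu ε hε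
  refine ⟨δ, hδ, fun x y hy => ⟨hf.asymptotic hy.1, fun n => ?_⟩⟩
  rw [← hf.iterate, ← hf.iterate]
  exact hd (hy.2 n)

lemma IsMap.leafConstant_comp [CompactSpace X] {V : Type*} {q : W → V} (hf : IsMap S T f)
    (hq : IsLocallyConstant q) (E : Set X) : LeafConstant S.φ fun x : E => q (f x) := by
  intro x
  obtain ⟨η, hη, hconst⟩ := Metric.eventually_nhds_iff.mp (hq.eventually_eq (f x))
  obtain ⟨δ, hδ, hclose⟩ := hf.exists_localSet hη
  refine ⟨δ, hδ, fun x' hx' => hconst ?_⟩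
  rw [dist_comm]
  exact dist_lt_of_mem_localSet (hclose _ _ hx')

lemma IsSBijective.injOn (hf : IsSBijective S T f) {E : Set X} (hE : ∃ e, E ⊆ S.stableSet e) :
    Set.InjOn f E :=
  hE.elim fun e he => (hf.bijOn e).injOn.mono he

lemma asymptotic_of_subset {E : Set X} (hE : ∃ e, E ⊆ S.stableSet e) {x y : X} (hx : x ∈ E)
    (hy : y ∈ E) : Asymptotic S.φ x y :=
  hE.elim fun _ he => (he hx : Asymptotic S.φ _ x).symm.trans (he hy)

/-- The bijection from a subset of a leaf to its image under an `s`-bijective map. -/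
noncomputable def IsSBijective.imageEquiv (hf : IsSBijective S T f) {E : Set X}
    (hE : ∃ e, E ⊆ S.stableSet e) : E ≃ f '' E :=
  Equiv.Set.imageOfInjOn f E (hf.injOn hE)

lemma IsSBijective.leafContinuous_imageEquiv [CompactSpace X] (hf : IsSBijective S T f)
    {E : Set X} (hE : ∃ e, E ⊆ S.stableSet e) : LeafContinuous S.φ T.φ (hf.imageEquiv hE) := by
  intro x ε hε
  obtain ⟨δ, hδ, h⟩ := hf.toIsMap.exists_localSet hε
  exact ⟨δ, hδ, fun x' hx' => h _ _ hx'⟩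

lemma IsSBijective.leafContinuous_imageEquiv_symm [CompactSpace X] (hf : IsSBijective S T f)
    {E : Set X} (hE : ∃ e, E ⊆ S.stableSet e) :
    LeafContinuous T.φ S.φ (hf.imageEquiv hE).symm := by
  intro y ε hε
  obtain ⟨δ, hδ, h⟩ := hf.exists_lift_close hε
  refine ⟨δ, hδ, fun y' hy' => ?_⟩
  obtain ⟨x, rfl⟩ := (hf.imageEquiv hE).surjective y
  obtain ⟨x', rfl⟩ := (hf.imageEquiv hE).surjective y'
  rw [Equiv.symm_apply_apply, Equiv.symm_apply_apply]
  exact h _ _ (asymptotic_of_subset hE x.2 x'.2) hy'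

/-- There is a leafwise homeomorphism between `E` and `F` that moves points along `r`. -/
def LeafHomeo (φ : X → X) (E F : Set X) (r : X → X → Prop) : Prop :=
  ∃ e : E ≃ F, LeafContinuous φ φ e ∧ LeafContinuous φ φ e.symm ∧ ∀ x : E, r x (e x)

namespace LeafHomeo

variable {φ : X → X} {E F G : Set X} {r r' : X → X → Prop}

lemma refl (h : ∀ x, r x x) : LeafHomeo φ E E r :=
  ⟨Equiv.refl E, .id, .id, fun x => h x⟩

lemma symm (h : LeafHomeo φ E F r) (hr : ∀ x y, r x y → r' y x) : LeafHomeo φ F E r' := by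
  obtain ⟨e, h1, h2, h3⟩ := h
  refine ⟨e.symm, h2, h1, fun y => ?_⟩
  have := hr _ _ (h3 (e.symm y))
  rwa [Equiv.apply_symm_apply] at this

lemma trans {r'' : X → X → Prop} (h : LeafHomeo φ E F r) (h' : LeafHomeo φ F G r')
    (hr : ∀ x y z, r x y → r' y z → r'' x z) : LeafHomeo φ E G r'' := by
  obtain ⟨e, h1, h2, h3⟩ := h
  obtain ⟨e', h1', h2', h3'⟩ := h'
  exact ⟨e.trans e', h1'.comp h1, h2.comp h2', fun x => hr _ _ _ (h3 x) (h3' _)⟩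

lemma mono (h : LeafHomeo φ E F r) (hr : ∀ x y, r x y → r' x y) : LeafHomeo φ E F r' := by
  obtain ⟨e, h1, h2, h3⟩ := h
  exact ⟨e, h1, h2, fun x => hr _ _ (h3 x)⟩

lemma map [CompactSpace X] {E F : Set X} {f' : X → W} {r' : W → W → Prop}
    (hE : ∃ e, E ⊆ S.stableSet e) (hF : ∃ e, F ⊆ S.stableSet e) (hf : IsSBijective S T f)
    (hf' : IsSBijective S T f') (h : LeafHomeo S.φ E F r)
    (hr : ∀ x ∈ E, ∀ y ∈ F, r x y → r' (f x) (f' y)) : LeafHomeo T.φ (f '' E) (f' '' F) r' := by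
  obtain ⟨e, h1, h2, h3⟩ := h
  refine ⟨((hf.imageEquiv hE).symm.trans e).trans (hf'.imageEquiv hF),
    (hf'.leafContinuous_imageEquiv hF).comp (h1.comp (hf.leafContinuous_imageEquiv_symm hE)),
    (hf.leafContinuous_imageEquiv hE).comp (h2.comp (hf'.leafContinuous_imageEquiv_symm hF)),
    fun y => ?_⟩
  obtain ⟨x, rfl⟩ := (hf.imageEquiv hE).surjective y
  simp only [Equiv.trans_apply, Equiv.symm_apply_apply]
  exact hr _ x.2 _ (e x).2 (h3 x)

lemma inter_preimage {T : Type*} (h : LeafHomeo φ E F r) (ℓ : X → T)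
    (hr : ∀ x y, r x y → ℓ x = ℓ y) (s : Set T) :
    LeafHomeo φ (E ∩ ℓ ⁻¹' s) (F ∩ ℓ ⁻¹' s) r := by
  obtain ⟨e, h1, h2, h3⟩ := h
  have hm : ∀ x : E, ℓ (e x) = ℓ x := fun x => (hr _ _ (h3 x)).symm
  have hm' : ∀ y : F, ℓ (e.symm y) = ℓ y := fun y => by
    rw [← hm, Equiv.apply_symm_apply]
  let e' : ↥(E ∩ ℓ ⁻¹' s) ≃ ↥(F ∩ ℓ ⁻¹' s) :=
    { toFun := fun x => ⟨e ⟨x, x.2.1⟩, (e _).2, by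
        rw [Set.mem_preimage, hm]; exact x.2.2⟩
      invFun := fun y => ⟨e.symm ⟨y, y.2.1⟩, (e.symm _).2, by
        rw [Set.mem_preimage, hm']; exact y.2.2⟩
      left_inv := fun x => by simp
      right_inv := fun y => by simp }
  refine ⟨e', fun x ε hε => ?_, fun y ε hε => ?_, fun x => h3 ⟨x, x.2.1⟩⟩
  · obtain ⟨δ, hδ, h⟩ := h1 ⟨x, x.2.1⟩ ε hε
    exact ⟨δ, hδ, fun x' hx' => h ⟨x', x'.2.1⟩ hx'⟩
  · obtain ⟨δ, hδ, h⟩ := h2 ⟨y, y.2.1⟩ ε hε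
    exact ⟨δ, hδ, fun y' hy' => h ⟨y', y'.2.1⟩ hy'⟩

end LeafHomeo

namespace CompactOpen

lemma isOpen_image_preimage {E : Set X} (hE : IsOpen[leafTopology S.φ] E) {T : Type*}
    {ℓ : E → T} (hℓ : LeafConstant S.φ ℓ) (s : Set T) :
    IsOpen[leafTopology S.φ] (Subtype.val '' (ℓ ⁻¹' s)) := by
  rintro _ ⟨x, hx, rfl⟩
  obtain ⟨δ, hδ, h⟩ := hE x x.2
  obtain ⟨δ', hδ', h'⟩ := hℓ x
  refine ⟨min δ δ', lt_min hδ hδ', fun y hy => ?_⟩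
  have hyE : y ∈ E := h (localSet_mono (min_le_left _ _) hy)
  refine ⟨⟨y, hyE⟩, ?_, rfl⟩
  rw [Set.mem_preimage, h' ⟨y, hyE⟩ (localSet_mono (min_le_right _ _) hy)]
  exact hx

/-- The part of `E` on which the leafwise locally constant function `ℓ` takes values in `s`. -/
def cut (E : CompactOpen S) {T : Type*} (ℓ : E.1 → T) (hℓ : LeafConstant S.φ ℓ) (s : Set T) :
    CompactOpen S :=
  ⟨Subtype.val '' (ℓ ⁻¹' s), by
    obtain ⟨e, he⟩ := E.2.1
    refine ⟨⟨e, (Subtype.coe_image_subset _ _).trans he⟩, ?_,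
      isOpen_image_preimage E.2.2.2 hℓ s⟩
    have h1 : Subtype.val '' (ℓ ⁻¹' s) = E.1 \ Subtype.val '' (ℓ ⁻¹' sᶜ) := by
      ext x
      constructor
      · rintro ⟨y, hy, rfl⟩
        exact ⟨y.2, fun ⟨z, hz, hzy⟩ => hz (Subtype.ext hzy ▸ hy)⟩
      · rintro ⟨hx, hn⟩
        refine ⟨⟨x, hx⟩, ?_, rfl⟩
        by_contra hs
        exact hn ⟨⟨x, hx⟩, hs, rfl⟩
    rw [h1]
    exact @IsCompact.diff _ (leafTopology S.φ) _ _ E.2.2.1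
      (isOpen_image_preimage E.2.2.2 hℓ sᶜ)⟩

lemma mem_cut {E : CompactOpen S} {T : Type*} {ℓ : E.1 → T} {hℓ : LeafConstant S.φ ℓ}
    {s : Set T} {x : X} : x ∈ (E.cut ℓ hℓ s).1 ↔ ∃ hx : x ∈ E.1, ℓ ⟨x, hx⟩ ∈ s := by
  simp [cut]

lemma cut_val (E : CompactOpen S) {T : Type*} (ℓ : X → T)
    (hℓ : LeafConstant S.φ fun x : E.1 => ℓ x) (s : Set T) :
    (E.cut (fun x : E.1 => ℓ x) hℓ s).1 = E.1 ∩ ℓ ⁻¹' s :=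
  Set.ext fun _ => by simp only [mem_cut, exists_prop, Set.mem_inter_iff, Set.mem_preimage]

/-- The bijection between corresponding parts of `E` and `F` induced by a bijection from `E`
to `F`. -/
def cutEquiv {E F : CompactOpen S} (e : E.1 ≃ F.1) {T : Type*} {ℓ : E.1 → T}
    (hℓ : LeafConstant S.φ ℓ) (hℓ' : LeafConstant S.φ (ℓ ∘ e.symm)) (s : Set T) :
    (E.cut ℓ hℓ s).1 ≃ (F.cut (ℓ ∘ e.symm) hℓ' s).1 where
  toFun x := ⟨e ⟨x, (mem_cut.mp x.2).1⟩, mem_cut.mpr ⟨(e _).2, by simpa using (mem_cut.mp x.2).2⟩⟩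
  invFun y := ⟨e.symm ⟨y, (mem_cut.mp y.2).1⟩, mem_cut.mpr ⟨(e.symm _).2, (mem_cut.mp y.2).2⟩⟩
  left_inv x := by simp
  right_inv y := by simp

/-- Functions on compact open sets that are additive on disjoint unions. -/
def IsAdditive {G : Type*} [AddCommGroup G] (μ : CompactOpen S → G) : Prop :=
  ∀ E F H : CompactOpen S, Disjoint E.1 F.1 → H.1 = E.1 ∪ F.1 → μ H = μ E + μ F

lemma IsAdditive.eq_zero {G : Type*} [AddCommGroup G] {μ : CompactOpen S → G} (hμ : IsAdditive μ)
    {E : CompactOpen S} (hE : E.1 = ∅) : μ E = 0 := by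
  have := hμ E E E (by simp [hE]) (by simp)
  simpa using this

lemma IsAdditive.sum_cut {G : Type*} [AddCommGroup G] {μ : CompactOpen S → G}
    (hμ : IsAdditive μ) (E : CompactOpen S) {T : Type*} [Fintype T] (ℓ : E.1 → T)
    (hℓ : LeafConstant S.φ ℓ) : ∑ t, μ (E.cut ℓ hℓ {t}) = μ E := by
  classical
  have h : ∀ s : Finset T, ∑ t ∈ s, μ (E.cut ℓ hℓ {t}) = μ (E.cut ℓ hℓ s) := by
    intro s
    induction s using Finset.induction_on with
    | empty => exact (hμ.eq_zero (by simp [cut])).symm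
    | insert t s ht ih =>
      rw [Finset.sum_insert ht, ih, eq_comm]
      refine hμ _ _ _ ?_ ?_
      · refine Set.disjoint_image_image fun x hx y hy hxy => ?_
        obtain rfl := Subtype.ext hxy
        have hx' : ℓ x = t := hx
        have hy' : ℓ x ∈ s := hy
        exact ht (hx' ▸ hy')
      · simp only [cut, Finset.coe_insert, Set.insert_eq, Set.preimage_union, Set.image_union]
  rw [h Finset.univ]
  congr 1
  exact Subtype.ext (by simp [cut])

lemma isAdditive_dimClass : IsAdditive (dimClass : CompactOpen S → DimGroup S) := by
  intro E F H hd hH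
  rw [← sub_eq_zero, ← sub_sub]
  exact (QuotientAddGroup.eq_zero_iff _).mpr (AddSubgroup.subset_closure ⟨E, F, H, hd, hH, rfl⟩)

end CompactOpen

namespace SmaleSpace

variable (S)

lemma asymptotic_iff_tail (n : ℕ) (x y : X) :
    Asymptotic S.φ (S.φ^[n] x) (S.φ^[n] y) ↔ Asymptotic S.φ x y := by
  refine ⟨Asymptotic.tail n, fun h => ?_⟩
  simp only [Asymptotic, ← Function.iterate_add_apply]
  exact (tendsto_add_atTop_iff_nat n).mpr h

lemma isMap_iterate (n : ℕ) : IsMap S S S.φ^[n] :=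
  ⟨S.φ.continuous.iterate n, fun x => (Function.Commute.iterate_self S.φ n).eq x⟩

lemma isMap_symm_iterate (n : ℕ) : IsMap S S S.φ.symm^[n] :=
  ⟨S.φ.symm.continuous.iterate n, fun x => by
    have h : Function.Commute S.φ.symm S.φ := fun x => by simp
    exact (h.iterate_left n).eq x⟩

lemma isSBijective_φ : IsSBijective S S S.φ where
  toIsMap := S.isMap_iterate 1
  bijOn x := by
    refine ⟨fun y hy => (S.asymptotic_iff_tail 1 x y).mpr hy, S.φ.injective.injOn, fun y hy => ?_⟩
    refine ⟨S.φ.symm y, (S.asymptotic_iff_tail 1 x _).mp ?_, by simp⟩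
    change Asymptotic S.φ (S.φ x) (S.φ (S.φ.symm y))
    rw [S.φ.apply_symm_apply]
    exact hy

lemma isSBijective_symm : IsSBijective S S S.φ.symm where
  toIsMap := S.isMap_symm_iterate 1
  bijOn x := by
    refine ⟨fun y hy => (S.asymptotic_iff_tail 1 _ _).mp ?_, S.φ.symm.injective.injOn,
      fun y hy => ⟨S.φ y, ?_, by simp⟩⟩
    · change Asymptotic S.φ (S.φ (S.φ.symm x)) (S.φ (S.φ.symm y))
      rw [S.φ.apply_symm_apply, S.φ.apply_symm_apply]
      exact hy
    · have h : Asymptotic S.φ (S.φ (S.φ.symm x)) (S.φ y) := (S.asymptotic_iff_tail 1 _ _).mpr hy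
      rwa [S.φ.apply_symm_apply] at h

lemma symm_iterate_iterate (n : ℕ) (x : X) : S.φ^[n] (S.φ.symm^[n] x) = x :=
  (Function.RightInverse.iterate S.φ.apply_symm_apply n) x

lemma bracket_eq_of_asymptotic [CompactSpace X] {a b : X}
    (h : ∀ n : ℕ, dist (S.φ^[n] a) (S.φ^[n] b) ≤ S.eps) (hab : Asymptotic S.φ a b) :
    S.bracket a b = b := by
  obtain ⟨δ, hδ, -, hfw⟩ := S.exists_forward
  obtain ⟨N, hN⟩ := eventually_atTop.mp ((tendsto_order.mp hab).2 δ hδ)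
  have h1 := hfw (S.φ^[N] a) (S.φ^[N] b) fun n => by
    rw [← Function.iterate_add_apply, ← Function.iterate_add_apply]
    exact (hN (n + N) (by omega)).le
  rw [← S.iterate_bracket h] at h1
  exact S.φ.injective.iterate N h1

lemma exists_uniform_contract {S : SmaleSpace X} (E : CompactOpen S) {δ : ℝ} (hδ : 0 < δ) :
    ∃ J : ℕ, ∀ x ∈ E.1, ∀ x' ∈ E.1, ∀ j ≥ J, dist (S.φ^[j] x) (S.φ^[j] x') ≤ δ := by
  obtain ⟨e, he⟩ := E.2.1
  let U : ℕ → Set X := fun J => {y | ∃ ρ > 0, ∀ j ≥ J, dist (S.φ^[j] e) (S.φ^[j] y) + ρ ≤ δ / 2}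
  have hU : ∀ J, IsOpen[leafTopology S.φ] (U J) := by
    rintro J y ⟨ρ, hρ, hy⟩
    refine ⟨ρ / 2, half_pos hρ, fun z hz => ⟨ρ / 2, half_pos hρ, fun j hj => ?_⟩⟩
    have h1 := hz.2 j
    have h2 := hy j hj
    have h3 := dist_triangle (S.φ^[j] e) (S.φ^[j] y) (S.φ^[j] z)
    linarith
  have hmono : Monotone U := fun J J' h y ⟨ρ, hρ, hy⟩ =>
    ⟨ρ, hρ, fun j hj => hy j (h.trans hj)⟩
  obtain ⟨J, hJ⟩ := @IsCompact.elim_directed_cover X (leafTopology S.φ) E.1 ℕ _ E.2.2.1 U hU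
    (fun y hy => by
      obtain ⟨N, hN⟩ := eventually_atTop.mp
        ((tendsto_order.mp (he hy : Asymptotic S.φ e y)).2 (δ / 4) (by positivity))
      refine Set.mem_iUnion.mpr ⟨N, δ / 4, by positivity, fun j hj => ?_⟩
      have := hN j hj
      linarith) hmono.directed_le
  refine ⟨J, fun x hx x' hx' j hj => ?_⟩
  obtain ⟨ρ, hρ, h1⟩ := hJ hx
  obtain ⟨ρ', hρ', h2⟩ := hJ hx'
  have h1 := h1 j hj
  have h2 := h2 j hj
  have h3 := dist_triangle_left (S.φ^[j] x) (S.φ^[j] x') (S.φ^[j] e)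
  linarith

lemma image2_eq_of_equiv {α : Type*} {g : α → α → α} {A B : Set α} (hA : A.Nonempty) (e : B ≃ A)
    (h : ∀ (x : A) (y : B), g x y = e y) : Set.image2 g A B = A := by
  ext z
  constructor
  · rintro ⟨x, hx, y, hy, rfl⟩
    exact h ⟨x, hx⟩ ⟨y, hy⟩ ▸ (e ⟨y, hy⟩).2
  · intro hz
    obtain ⟨x, hx⟩ := hA
    exact ⟨x, hx, e.symm ⟨z, hz⟩, (e.symm _).2, by rw [h ⟨x, hx⟩, e.apply_symm_apply]⟩

lemma dimRel_of_bracket_eq {S : SmaleSpace X} {E F : CompactOpen S} (e : E.1 ≃ F.1)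
    (hE : ∀ x x' : E.1, ∀ j : ℕ, dist (S.φ^[j] x) (S.φ^[j] x') < S.eps / 2)
    (hF : ∀ y y' : F.1, ∀ j : ℕ, dist (S.φ^[j] y) (S.φ^[j] y') < S.eps / 2)
    (hEF : ∀ (x : E.1) (y : F.1), dist (x : X) y ≤ S.eps)
    (h : ∀ (x : E.1) (y : F.1), S.bracket x y = e.symm y)
    (h' : ∀ (y : F.1) (x : E.1), S.bracket y x = e x) : DimRel S E F := by
  rcases isEmpty_or_nonempty E.1 with hE₀ | ⟨⟨x₀⟩⟩
  · have hF₀ : IsEmpty F.1 := e.symm.isEmpty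
    obtain rfl : E = F := Subtype.ext
      ((Set.isEmpty_coe_sort.mp hE₀).trans (Set.isEmpty_coe_sort.mp hF₀).symm)
    exact DimRel.refl E
  · exact DimRel.bracket E F
      ⟨x₀, fun x hx => ⟨asymptotic_of_subset E.2.1 x₀.2 hx, hE x₀ ⟨x, hx⟩⟩⟩
      ⟨e x₀, fun y hy => ⟨asymptotic_of_subset F.2.1 (e x₀).2 hy, hF (e x₀) ⟨y, hy⟩⟩⟩
      (fun x hx y hy => hEF ⟨x, hx⟩ ⟨y, hy⟩)
      (image2_eq_of_equiv ⟨x₀, x₀.2⟩ e.symm h)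
      (image2_eq_of_equiv ⟨e x₀, (e x₀).2⟩ e h')

lemma exists_dimRel [CompactSpace X] : ∃ δ > 0, ∀ (E F : CompactOpen S) (e : E.1 ≃ F.1),
    (∀ x x' : E.1, ∀ j : ℕ, dist (S.φ^[j] x) (S.φ^[j] x') ≤ δ) →
    (∀ y y' : F.1, ∀ j : ℕ, dist (S.φ^[j] y) (S.φ^[j] y') ≤ δ) →
    (∀ x : E.1, ∀ k : ℕ, dist (S.φ.symm^[k] x) (S.φ.symm^[k] (e x)) ≤ δ) → DimRel S E F := by
  obtain ⟨δ, hδ, -, hfw⟩ := S.reverse.exists_forward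
  have h0 := S.eps_pos
  refine ⟨min δ (S.eps / 4), lt_min hδ (by positivity), fun E F e hE hF hEF => ?_⟩
  have hle : min δ (S.eps / 4) ≤ S.eps / 4 := min_le_right _ _
  have hu (x : E.1) : S.bracket (e x) x = e x :=
    hfw x (e x) fun k => (hEF x k).trans (min_le_left _ _)
  have hs (x x' : E.1) : S.bracket x x' = x' :=
    S.bracket_eq_of_asymptotic (fun n => (hE x x' n).trans (by linarith))
      (asymptotic_of_subset E.2.1 x.2 x'.2)
  have hs' (y y' : F.1) : S.bracket y y' = y' :=
    S.bracket_eq_of_asymptotic (fun n => (hF y y' n).trans (by linarith))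
      (asymptotic_of_subset F.2.1 y.2 y'.2)
  have hxe (x : E.1) : dist (x : X) (e x) ≤ S.eps / 4 := (hEF x 0).trans hle
  have hd (x x' : E.1) : dist (x : X) (e x') ≤ S.eps / 2 := by
    have h1 := dist_triangle (x : X) x' (e x')
    have h2 : dist (x : X) x' ≤ S.eps / 4 := (hE x x' 0).trans hle
    linarith [hxe x']
  refine dimRel_of_bracket_eq e (fun x x' j => ((hE x x' j).trans hle).trans_lt (by linarith))
    (fun y y' j => ((hF y y' j).trans hle).trans_lt (by linarith)) (fun x y => ?_) (fun x y => ?_)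
    fun y x => ?_
  · obtain ⟨x', rfl⟩ := e.surjective y
    linarith [hd x x']
  · obtain ⟨x', rfl⟩ := e.surjective y
    rw [e.symm_apply_apply]
    calc S.bracket x (e x') = S.bracket x (S.bracket (e x') x') := by rw [hu]
      _ = S.bracket x x' := S.bracket_right _ _ _ (by rw [dist_comm]; linarith [hxe x'])
        (by rw [hu]; linarith [hd x x']) (((hE x x' 0).trans hle).trans (by linarith))
      _ = x' := hs x x'
  · obtain ⟨x', rfl⟩ := e.surjective y
    calc S.bracket (e x') x = S.bracket (S.bracket (e x') (e x)) x :=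
        (S.bracket_left (e x') (e x) x (((hF (e x') (e x) 0).trans hle).trans (by linarith))
          (by rw [hs', dist_comm]; linarith [hxe x]) (by rw [dist_comm]; linarith [hd x x'])).symm
      _ = S.bracket (e x) x := by rw [hs']
      _ = e x := hu x

lemma dimRel_of_symm_iterate [CompactSpace X] {S : SmaleSpace X} (n : ℕ) :
    ∀ E F E' F' : CompactOpen S, E'.1 = S.φ.symm^[n] '' E.1 → F'.1 = S.φ.symm^[n] '' F.1 →
      DimRel S E' F' → DimRel S E F := by
  induction n with
  | zero =>
    intro E F E' F' hE hF h
    obtain rfl : E' = E := Subtype.ext (by simpa using hE)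
    obtain rfl : F' = F := Subtype.ext (by simpa using hF)
    exact h
  | succ n ih =>
    intro E F E' F' hE hF h
    have hs : ∀ A : CompactOpen S, A.1 = S.φ '' (A.map S.isSBijective_symm).1 := fun A => by
      change A.1 = S.φ '' (S.φ.symm '' A.1)
      rw [Set.image_image]
      simp
    have hi : ∀ A : CompactOpen S, S.φ.symm^[n + 1] '' A.1 =
        S.φ.symm^[n] '' (A.map S.isSBijective_symm).1 := fun A => by
      change _ = S.φ.symm^[n] '' (S.φ.symm '' A.1)
      rw [← Set.image_comp, Function.iterate_succ]
    exact DimRel.shift _ _ _ _ (hs E) (hs F) (ih _ _ E' F' (hE.trans (hi E)) (hF.trans (hi F)) h)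

lemma exists_symm_iterate_image [CompactSpace X] {S : SmaleSpace X} (n : ℕ) (E : CompactOpen S) :
    ∃ E' : CompactOpen S, E'.1 = S.φ.symm^[n] '' E.1 := by
  induction n with
  | zero => exact ⟨E, by simp⟩
  | succ n ih =>
    obtain ⟨E', hE'⟩ := ih
    refine ⟨E'.map S.isSBijective_symm, ?_⟩
    change S.φ.symm '' E'.1 = _
    rw [hE', ← Set.image_comp, Function.iterate_succ']

lemma exists_dimRel_past [CompactSpace X] : ∃ δ > 0, ∀ (n : ℕ) (E F : CompactOpen S)
    (e : E.1 ≃ F.1),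
    (∀ x x' : E.1, ∀ j : ℕ, dist (S.φ^[j] (S.φ.symm^[n] x)) (S.φ^[j] (S.φ.symm^[n] x')) ≤ δ) →
    (∀ y y' : F.1, ∀ j : ℕ, dist (S.φ^[j] (S.φ.symm^[n] y)) (S.φ^[j] (S.φ.symm^[n] y')) ≤ δ) →
    (∀ x : E.1, ∀ k ≥ n, dist (S.φ.symm^[k] x) (S.φ.symm^[k] (e x)) ≤ δ) → DimRel S E F := by
  obtain ⟨δ, hδ, h⟩ := S.exists_dimRel
  refine ⟨δ, hδ, fun n E F e hE hF hEF => ?_⟩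
  obtain ⟨E', hE'⟩ := exists_symm_iterate_image n E
  obtain ⟨F', hF'⟩ := exists_symm_iterate_image n F
  refine dimRel_of_symm_iterate n E F E' F' hE' hF' ?_
  have hinj : Function.Injective S.φ.symm^[n] := S.φ.symm.injective.iterate n
  let u : E.1 ≃ E'.1 := (Equiv.Set.image _ E.1 hinj).trans (Equiv.setCongr hE'.symm)
  let v : F.1 ≃ F'.1 := (Equiv.Set.image _ F.1 hinj).trans (Equiv.setCongr hF'.symm)
  have hu : ∀ x, (u x : X) = S.φ.symm^[n] x := fun x => rfl
  have hv : ∀ x, (v x : X) = S.φ.symm^[n] x := fun x => rfl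
  refine h E' F' ((u.symm.trans e).trans v) (fun x x' j => ?_) (fun y y' j => ?_) fun x k => ?_
  · obtain ⟨x, rfl⟩ := u.surjective x
    obtain ⟨x', rfl⟩ := u.surjective x'
    exact hE x x' j
  · obtain ⟨y, rfl⟩ := v.surjective y
    obtain ⟨y', rfl⟩ := v.surjective y'
    exact hF y y' j
  · obtain ⟨x, rfl⟩ := u.surjective x
    simp only [Equiv.trans_apply, Equiv.symm_apply_apply, hu, hv, ← Function.iterate_add_apply]
    exact hEF x (k + n) (by omega)

section Itinerary

variable {V : Type*} {q : X → V}

/-- The points `x` and `y` have the same symbols with respect to `q` at all times up to `-n`. -/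
def SamePast (q : X → V) (n : ℕ) (x y : X) : Prop :=
  ∀ k ≥ n, q (S.φ.symm^[k] x) = q (S.φ.symm^[k] y)

variable {S} in
lemma SamePast.symm {n : ℕ} {x y : X} (h : S.SamePast q n x y) : S.SamePast q n y x :=
  fun k hk => (h k hk).symm

variable {S} in
lemma SamePast.trans {n : ℕ} {x y z : X} (h : S.SamePast q n x y) (h' : S.SamePast q n y z) :
    S.SamePast q n x z := fun k hk => (h k hk).trans (h' k hk)

variable {S} in
lemma SamePast.mono {n n' : ℕ} (hn : n ≤ n') {x y : X} (h : S.SamePast q n x y) :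
    S.SamePast q n' x y := fun k hk => h k (hn.trans hk)

/-- The symbols of `x` with respect to `q` at the `N` times starting with `-n`. -/
def itinerary (q : X → V) (n N : ℕ) (x : X) (j : Fin N) : V := q (S.φ^[j] (S.φ.symm^[n] x))

variable {S}

lemma leafConstant_itinerary [CompactSpace X] (hq : IsLocallyConstant q) (n N : ℕ) (E : Set X) :
    LeafConstant S.φ fun x : E => S.itinerary q n N x := by
  refine LeafConstant.pi fun j : Fin N => IsMap.leafConstant_comp (S := S) (T := S)
    (f := S.φ^[j] ∘ S.φ.symm^[n]) ⟨?_, fun x => ?_⟩ hq E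
  · exact (S.isMap_iterate j).continuous.comp (S.isMap_symm_iterate n).continuous
  · rw [Function.comp_apply, Function.comp_apply, (S.isMap_symm_iterate n).map_φ,
      (S.isMap_iterate j).map_φ]

/-- From some time on the points of `E` are close because `E` contracts, before that because the
itineraries agree. -/
lemma exists_dist_le_of_itinerary_eq (E : CompactOpen S) {δ : ℝ} (hδ : 0 < δ)
    (hq : ∀ p p', q p = q p' → dist p p' ≤ δ) (n : ℕ) :
    ∃ N, ∀ x ∈ E.1, ∀ x' ∈ E.1, S.itinerary q n N x = S.itinerary q n N x' → ∀ j : ℕ,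
      dist (S.φ^[j] (S.φ.symm^[n] x)) (S.φ^[j] (S.φ.symm^[n] x')) ≤ δ := by
  obtain ⟨J, hJ⟩ := exists_uniform_contract E hδ
  refine ⟨J + n, fun x hx x' hx' hxx j => ?_⟩
  rcases lt_or_ge j (J + n) with hj | hj
  · exact hq _ _ (congrFun hxx ⟨j, hj⟩)
  · obtain ⟨i, rfl⟩ := Nat.exists_eq_add_of_le' (le_of_add_le_right hj)
    simp only [Function.iterate_add_apply, S.symm_iterate_iterate]
    exact hJ x hx x' hx' i (by omega)

end Itinerary

theorem exists_dimClass_eq [CompactSpace X] : ∃ δ > 0, ∀ {V : Type} [Finite V] {q : X → V},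
    (∀ p p', q p = q p' → dist p p' ≤ δ) → IsLocallyConstant q → ∀ (n : ℕ) (E F : CompactOpen S),
      LeafHomeo S.φ E.1 F.1 (S.SamePast q n) → dimClass E = dimClass F := by
  obtain ⟨δ, hδ, hrel⟩ := S.exists_dimRel_past
  refine ⟨δ, hδ, fun {V} _ q hq hlc n E F ⟨e, he, he', hpast⟩ => ?_⟩
  obtain ⟨N, hN⟩ := exists_dist_le_of_itinerary_eq E hδ hq n
  obtain ⟨N', hN'⟩ := exists_dist_le_of_itinerary_eq F hδ hq n
  let ℓ : E.1 → (Fin N → V) × (Fin N' → V) := fun x =>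
    (S.itinerary q n N x, S.itinerary q n N' (e x))
  have hℓ : LeafConstant S.φ ℓ :=
    (leafConstant_itinerary hlc n N E.1).prodMk ((leafConstant_itinerary hlc n N' F.1).comp he)
  have hℓ' : LeafConstant S.φ (ℓ ∘ e.symm) := hℓ.comp he'
  have := Fintype.ofFinite ((Fin N → V) × (Fin N' → V))
  rw [← CompactOpen.isAdditive_dimClass.sum_cut E ℓ hℓ,
    ← CompactOpen.isAdditive_dimClass.sum_cut F (ℓ ∘ e.symm) hℓ']
  refine Finset.sum_congr rfl fun t _ => congrArg QuotientAddGroup.mk (congrArg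
    FreeAbelianGroup.of (Quotient.sound (hrel n _ _ (CompactOpen.cutEquiv e hℓ hℓ' {t})
      (fun x x' => ?_) (fun y y' => ?_) fun x k hk => hq _ _ (hpast ⟨x, _⟩ k hk))))
  · obtain ⟨hx, hxt⟩ := CompactOpen.mem_cut.mp x.2
    obtain ⟨hx', hxt'⟩ := CompactOpen.mem_cut.mp x'.2
    exact hN x hx x' hx' (congrArg Prod.fst (hxt.trans hxt'.symm))
  · obtain ⟨hy, hyt⟩ := CompactOpen.mem_cut.mp y.2
    obtain ⟨hy', hyt'⟩ := CompactOpen.mem_cut.mp y'.2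
    have := congrArg Prod.snd (hyt.trans hyt'.symm)
    exact hN' y hy y' hy' (by simpa only [ℓ, Function.comp_apply, e.apply_symm_apply] using this)

end SmaleSpace

end Leafwise

/-! ### Partitions and itineraries -/

section LocallyConstant

variable {X V : Type*}

lemma exists_forall_dist_lt_imp_eq [PseudoMetricSpace X] [CompactSpace X] {q : X → V}
    (hq : IsLocallyConstant q) : ∃ η > 0, ∀ p p', dist p p' < η → q p = q p' := by
  obtain ⟨η, hη, hball⟩ := lebesgue_number_lemma_of_metric (isCompact_univ (X := X))
    hq.isOpen_fiber fun p _ => Set.mem_iUnion.mpr ⟨q p, rfl⟩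
  refine ⟨η, hη, fun p p' hpp => ?_⟩
  obtain ⟨v, hv⟩ := hball p (Set.mem_univ p)
  exact (hv (Metric.mem_ball_self hη)).trans (hv (Metric.mem_ball'.mpr hpp)).symm

variable [TopologicalSpace X]

lemma isLocallyConstant_pi {ι : Type*} [Finite ι] {f : X → ι → V}
    (hf : ∀ i, IsLocallyConstant fun x => f x i) : IsLocallyConstant f :=
  (IsLocallyConstant.iff_eventually_eq f).mpr fun x =>
    (eventually_all.mpr fun i => (hf i).eventually_eq x).mono fun _ => funext

lemma isLocallyConstant_mem {U : Set X} (hU : IsClopen U) : IsLocallyConstant (· ∈ U) := by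
  refine (IsLocallyConstant.iff_eventually_eq _).mpr fun x => ?_
  by_cases hx : x ∈ U
  · filter_upwards [hU.isOpen.mem_nhds hx] with y hy using by simp [hx, hy]
  · filter_upwards [hU.compl.isOpen.mem_nhds hx] with y hy using by simpa [hx] using hy

lemma isClopen_image_val {A U : Set X} (hA : IsClosed A) (hU : IsOpen U) (hUA : U ⊆ A)
    {C : Set A} (hC : IsClopen C) (hCU : Subtype.val '' C ⊆ U) : IsClopen (Subtype.val '' C) := by
  refine ⟨hA.isClosedEmbedding_subtypeVal.isClosedMap C hC.isClosed, ?_⟩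
  obtain ⟨O, hO, rfl⟩ := isOpen_induced_iff.mp hC.isOpen
  have heq : Subtype.val '' (Subtype.val ⁻¹' O : Set A) = O ∩ U := by
    refine (Set.subset_inter (Set.image_preimage_subset _ _) hCU).antisymm fun x hx => ?_
    exact ⟨⟨x, hUA hx.2⟩, hx.1, rfl⟩
  rw [heq]
  exact hO.inter hU

end LocallyConstant

section Bracket

variable {X : Type*} [MetricSpace X]

namespace SmaleSpace

variable (S : SmaleSpace X)

lemma exists_pow_mul_lt {c η : ℝ} (hη : 0 < η) : ∃ n : ℕ, ∀ k ≥ n, S.lam ^ k * c < η := by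
  have h : Tendsto (fun k : ℕ => S.lam ^ k * c) atTop (𝓝 0) := by
    simpa using (tendsto_pow_atTop_nhds_zero_of_lt_one S.lam_pos.le S.lam_lt_one).mul_const c
  exact eventually_atTop.mp ((tendsto_order.mp h).2 η hη)

lemma mem_localSet_of_bracket {x y : X} {ε : ℝ} (h : dist x y ≤ S.eps) (hε : dist x y < ε)
    (hb : S.bracket x y = y) : y ∈ localSet S.φ x ε :=
  ⟨S.asymptotic_of_bracket h hb, fun n => ((S.contract_iterate h hb n).1.trans
    (mul_le_of_le_one_left dist_nonneg (pow_le_one₀ S.lam_pos.le S.lam_lt_one.le))).trans_lt hε⟩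

lemma continuousOn_bracket_right (y : X) :
    ContinuousOn (fun x => S.bracket y x) {x | dist y x ≤ S.eps} :=
  S.continuousOn_bracket.comp (f := fun x => (y, x)) (by fun_prop) fun _ h => h

variable {S}

lemma leafContinuous_bracket {E F : Set X} {y : X} (h : E → F)
    (hh : ∀ x : E, (h x : X) = S.bracket y x) (hy : ∀ x ∈ E, dist y x ≤ S.eps)
    (hF : ∀ z ∈ F, ∀ z' ∈ F, dist z z' ≤ S.eps ∧ S.bracket z z' = z') :
    LeafContinuous S.φ S.φ h := by
  intro x ε hε
  obtain ⟨δ, hδ, hd⟩ :=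
    Metric.continuousOn_iff.mp (S.continuousOn_bracket_right y) x (hy x x.2) ε hε
  refine ⟨δ, hδ, fun x' hx' => ?_⟩
  obtain ⟨h1, h2⟩ := hF (h x) (h x).2 (h x') (h x').2
  refine S.mem_localSet_of_bracket h1 ?_ h2
  rw [hh, hh, dist_comm]
  exact hd x' (hy x' x'.2) (by rw [dist_comm]; exact dist_lt_of_mem_localSet hx')

lemma bracket_eq_of_subset_localSet [CompactSpace X] {A : Set X}
    (hA : ∃ e, A ⊆ localSet S.φ e (S.eps / 2)) :
    ∀ z ∈ A, ∀ z' ∈ A, dist z z' ≤ S.eps ∧ S.bracket z z' = z' := by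
  obtain ⟨e, he⟩ := hA
  intro z hz z' hz'
  have hd (n : ℕ) : dist (S.φ^[n] z) (S.φ^[n] z') ≤ S.eps := by
    linarith [(he hz).2 n, (he hz').2 n,
      dist_triangle_left (S.φ^[n] z) (S.φ^[n] z') (S.φ^[n] e)]
  exact ⟨hd 0, S.bracket_eq_of_asymptotic hd ((he hz).1.symm.trans (he hz').1)⟩

lemma exists_equiv_bracket {A B : Set X} {a b : X} (ha : a ∈ A) (hb : b ∈ B)
    (hA : ∀ z ∈ A, ∀ z' ∈ A, dist z z' ≤ S.eps ∧ S.bracket z z' = z')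
    (hB : ∀ z ∈ B, ∀ z' ∈ B, dist z z' ≤ S.eps ∧ S.bracket z z' = z')
    (hAB : ∀ x ∈ A, ∀ y ∈ B, dist x y ≤ S.eps)
    (h₁ : Set.image2 S.bracket A B = A) (h₂ : Set.image2 S.bracket B A = B) :
    ∃ e : A ≃ B, (∀ x, (e x : X) = S.bracket b x) ∧ ∀ y, (e.symm y : X) = S.bracket a y := by
  have memB (x : A) : S.bracket b x ∈ B := h₂.subset ⟨b, hb, x, x.2, rfl⟩
  have memA (y : B) : S.bracket a y ∈ A := h₁.subset ⟨a, ha, y, y.2, rfl⟩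
  refine ⟨⟨fun x => ⟨_, memB x⟩, fun y => ⟨_, memA y⟩, fun x => Subtype.ext ?_,
    fun y => Subtype.ext ?_⟩, fun _ => rfl, fun _ => rfl⟩
  · have hbx : dist b x ≤ S.eps := (dist_comm _ _).trans_le (hAB x x.2 b hb)
    exact (S.bracket_right _ _ _ hbx (hAB a ha _ (memB x)) (hA a ha x x.2).1).trans
      (hA a ha x x.2).2
  · have hby : dist b (S.bracket a y) ≤ S.eps := (dist_comm _ _).trans_le (hAB _ (memA y) b hb)
    exact (S.bracket_right _ _ _ (hAB a ha y y.2) hby (hB b hb y y.2).1).trans (hB b hb y y.2).2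

lemma dist_symm_iterate_le {x y : X} (h : dist x y ≤ S.eps) (hb : S.bracket y x = y) (k : ℕ) :
    dist (S.φ.symm^[k] x) (S.φ.symm^[k] y) ≤ S.lam ^ k * S.eps :=
  (S.reverse.contract_iterate (y := x) (z := y) h hb k).1.trans
    (mul_le_mul_of_nonneg_left h (pow_nonneg S.lam_pos.le _))

variable (S) in
lemma exists_samePast_of_bracket_eq [CompactSpace X] {V : Type*} {q : X → V}
    (hq : IsLocallyConstant q) :
    ∃ n, ∀ x y, dist x y ≤ S.eps → S.bracket y x = y → S.SamePast q n x y := by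
  obtain ⟨η, hη, hconst⟩ := exists_forall_dist_lt_imp_eq hq
  obtain ⟨n, hn⟩ := S.exists_pow_mul_lt (c := S.eps) hη
  exact ⟨n, fun x y h hb k hk => hconst _ _ ((dist_symm_iterate_le h hb k).trans_lt (hn k hk))⟩

lemma exists_leafHomeo_of_bracket [CompactSpace X] {V : Type*} {q : X → V}
    (hq : IsLocallyConstant q) {E F : CompactOpen S}
    (hE : ∃ e, E.1 ⊆ localSet S.φ e (S.eps / 2)) (hF : ∃ f, F.1 ⊆ localSet S.φ f (S.eps / 2))
    (hEF : ∀ x ∈ E.1, ∀ y ∈ F.1, dist x y ≤ S.eps)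
    (h₁ : Set.image2 S.bracket E.1 F.1 = E.1) (h₂ : Set.image2 S.bracket F.1 E.1 = F.1) :
    ∃ n, LeafHomeo S.φ E.1 F.1 (S.SamePast q n) := by
  rcases Set.eq_empty_or_nonempty E.1 with hE₀ | ⟨x₀, hx₀⟩
  · rw [hE₀, Set.image2_empty_right] at h₂
    rw [hE₀, ← h₂]
    exact ⟨0, .refl fun _ _ _ => rfl⟩
  rcases Set.eq_empty_or_nonempty F.1 with hF₀ | ⟨y₀, hy₀⟩
  · rw [hF₀, Set.image2_empty_right] at h₁
    rw [hF₀, ← h₁]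
    exact ⟨0, .refl fun _ _ _ => rfl⟩
  have hE' := bracket_eq_of_subset_localSet hE
  have hF' := bracket_eq_of_subset_localSet hF
  have hFE (y : X) (hy : y ∈ F.1) (x : X) (hx : x ∈ E.1) : dist y x ≤ S.eps :=
    (dist_comm _ _).trans_le (hEF x hx y hy)
  obtain ⟨e, he, he'⟩ := exists_equiv_bracket hx₀ hy₀ hE' hF' hEF h₁ h₂
  obtain ⟨n, hn⟩ := S.exists_samePast_of_bracket_eq hq
  refine ⟨n, e, leafContinuous_bracket e he (hFE y₀ hy₀) hF',
    leafContinuous_bracket e.symm he' (hEF x₀ hx₀) hE', fun x => ?_⟩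
  refine hn x (e x) (hEF x x.2 _ (e x).2) ?_
  have hyx : dist (S.bracket y₀ x) x ≤ S.eps := he x ▸ hFE _ (e x).2 x x.2
  rw [he, S.bracket_left y₀ x x (hFE y₀ hy₀ x x.2) hyx (hFE y₀ hy₀ x x.2)]

lemma exists_leafHomeo_of_dimRel [CompactSpace X] {V : Type*} {q : X → V}
    (hq : IsLocallyConstant q) {E F : CompactOpen S} (h : DimRel S E F) :
    ∃ n, LeafHomeo S.φ E.1 F.1 (S.SamePast q n) := by
  induction h with
  | bracket E F hE hF hEF h₁ h₂ => exact exists_leafHomeo_of_bracket hq hE hF hEF h₁ h₂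
  | shift E F E' F' hE hF _ ih =>
    obtain ⟨n, h⟩ := ih
    refine ⟨n + 1, ?_⟩
    rw [hE, hF]
    refine h.map E.2.1 F.2.1 S.isSBijective_φ S.isSBijective_φ fun x _ y _ hxy k hk => ?_
    obtain ⟨k, rfl⟩ : ∃ j, k = j + 1 := ⟨k - 1, by omega⟩
    simpa using hxy k (by omega)
  | unshift E F E' F' hE hF _ ih =>
    obtain ⟨n, h⟩ := ih
    refine ⟨n, ?_⟩
    have hs (A : Set X) : S.φ.symm '' (S.φ '' A) = A := S.φ.toEquiv.symm_image_image A
    rw [← hs E.1, ← hs F.1, ← hE, ← hF]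
    refine h.map E'.2.1 F'.2.1 S.isSBijective_symm S.isSBijective_symm
      fun x _ y _ hxy k hk => ?_
    simpa using hxy (k + 1) (by omega)
  | refl E => exact ⟨0, .refl fun _ _ _ => rfl⟩
  | symm E F _ ih =>
    obtain ⟨n, h⟩ := ih
    exact ⟨n, h.symm fun _ _ => SamePast.symm⟩
  | trans E F G _ _ ih ih' =>
    obtain ⟨n, h⟩ := ih
    obtain ⟨n', h'⟩ := ih'
    exact ⟨max n n', h.trans h' fun _ _ _ hxy hyz =>
      (hxy.mono (le_max_left n n')).trans (hyz.mono (le_max_right n n'))⟩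

variable (S)

lemma exists_isPreconnected_image [CompactSpace X] : ∃ δ > 0, ∀ (p : X) (K : Set X),
    IsPreconnected K → (∀ x ∈ K, dist p x ≤ δ) →
      @IsPreconnected X (leafTopology S.φ) (S.bracket p '' K) ∧
        S.bracket p '' K ⊆ S.stableSet p := by
  have h0 := S.eps_pos
  obtain ⟨δ, hδ, hδe, hd⟩ := S.near_diag (half_pos h0)
  refine ⟨δ, hδ, fun p K hK hp => ?_⟩
  have hpx : ∀ x ∈ K, dist p x ≤ S.eps := fun x hx => (hp x hx).trans hδe
  have hpb : ∀ x ∈ K, dist p (S.bracket p x) ≤ S.eps / 2 := fun x hx => by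
    rw [dist_comm]; exact (hd p x (hp x hx)).1.le
  have hb : ∀ x ∈ K, S.bracket p (S.bracket p x) = S.bracket p x := fun x hx =>
    S.bracket_right _ _ _ (hpx x hx) ((hpb x hx).trans (by linarith)) (hpx x hx)
  have hxx : ∀ x ∈ K, ∀ x' ∈ K, dist (S.bracket p x) (S.bracket p x') ≤ S.eps :=
    fun x hx x' hx' => by
      have := dist_triangle_left (S.bracket p x) (S.bracket p x') p
      linarith [hpb x hx, hpb x' hx']
  have hbb : ∀ x ∈ K, ∀ x' ∈ K, S.bracket (S.bracket p x) (S.bracket p x') = S.bracket p x' :=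
    fun x hx x' hx' => by
      have h1 := S.bracket_left p x (S.bracket p x') (hpx x hx) (hxx x hx x' hx')
        ((hpb x' hx').trans (by linarith))
      rw [h1, hb x' hx']
  constructor
  · refine @IsPreconnected.image X X _ (leafTopology S.φ) K hK _ ?_
    refine (@continuousOn_iff X X _ (leafTopology S.φ) _ _).mpr fun x hx t ht hxt => ?_
    obtain ⟨ε, hε, hεt⟩ := ht _ hxt
    obtain ⟨ρ, hρ, h⟩ := Metric.continuousOn_iff.mp (S.continuousOn_bracket_right p) x (hpx x hx)
      ε hε
    refine ⟨Metric.ball x ρ, Metric.isOpen_ball, Metric.mem_ball_self hρ, fun x' hx' => hεt ?_⟩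
    refine S.mem_localSet_of_bracket (hxx x hx x' hx'.2) ?_ (hbb x hx x' hx'.2)
    rw [dist_comm]
    exact h x' (hpx x' hx'.2) hx'.1
  · rintro _ ⟨x, hx, rfl⟩
    exact S.asymptotic_of_bracket ((hpb x hx).trans (by linarith)) (hb x hx)

variable {S}

lemma exists_subsingleton_of_isPreconnected [CompactSpace X]
    (hs : ∀ x, @IsTotallyDisconnected X (leafTopology S.φ) (S.stableSet x))
    (hu : ∀ x, @IsTotallyDisconnected X (leafTopology S.φ.symm) (S.unstableSet x)) :
    ∃ δ > 0, ∀ K : Set X, IsPreconnected K → (∀ x ∈ K, ∀ y ∈ K, dist x y ≤ δ) →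
      K.Subsingleton := by
  obtain ⟨δ, hδ, h⟩ := S.exists_isPreconnected_image
  obtain ⟨δ', hδ', h'⟩ := S.reverse.exists_isPreconnected_image
  have h0 := S.eps_pos
  refine ⟨min (min δ δ') S.eps, by positivity, fun K hK hd p hp x hx => ?_⟩
  obtain ⟨h1, h2⟩ := h p K hK fun y hy =>
    (hd p hp y hy).trans ((min_le_left _ _).trans (min_le_left _ _))
  obtain ⟨h1', h2'⟩ := h' p K hK fun y hy =>
    (hd p hp y hy).trans ((min_le_left _ _).trans (min_le_right _ _))
  have e1 : S.bracket p x = S.bracket p p :=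
    hs p _ h2 h1 (Set.mem_image_of_mem _ hx) (Set.mem_image_of_mem _ hp)
  have e2 : S.bracket x p = S.bracket p p :=
    hu p _ h2' h1' (Set.mem_image_of_mem _ hx) (Set.mem_image_of_mem _ hp)
  rw [S.bracket_self] at e1 e2
  have hxp : dist x p ≤ S.eps := (hd x hx p hp).trans (min_le_right _ _)
  have e3 := S.bracket_right x p x (by rw [dist_comm]; exact hxp) (by rw [e1]; exact hxp)
    (by rw [dist_self]; exact h0.le)
  rw [e1, e2, S.bracket_self] at e3
  exact e3

lemma exists_isClopen_subset_ball [CompactSpace X]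
    (hs : ∀ x, @IsTotallyDisconnected X (leafTopology S.φ) (S.stableSet x))
    (hu : ∀ x, @IsTotallyDisconnected X (leafTopology S.φ.symm) (S.unstableSet x))
    (p : X) {ε : ℝ} (hε : 0 < ε) : ∃ V : Set X, IsClopen V ∧ p ∈ V ∧ V ⊆ Metric.ball p ε := by
  obtain ⟨δ, hδ, h⟩ := exists_subsingleton_of_isPreconnected hs hu
  have hr : 0 < min ε (δ / 2) := lt_min hε (half_pos hδ)
  set r := min ε (δ / 2)
  have hc : CompactSpace (Metric.closedBall p r) :=
    isCompact_iff_compactSpace.mp Metric.isClosed_closedBall.isCompact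
  have ht : TotallyDisconnectedSpace (Metric.closedBall p r) := by
    refine totallyDisconnectedSpace_subtype_iff.mpr fun K hK hKc => h K hKc fun x hx y hy => ?_
    have hrδ : r ≤ δ / 2 := min_le_right _ _
    linarith [Metric.mem_closedBall.mp (hK hx), Metric.mem_closedBall.mp (hK hy),
      dist_triangle_right x y p]
  obtain ⟨V, hV, hpV, hVU⟩ := compact_exists_isClopen_in_isOpen
    (X := Metric.closedBall p r) (x := ⟨p, Metric.mem_closedBall_self hr.le⟩)
    (U := Subtype.val ⁻¹' Metric.ball p r) (Metric.isOpen_ball.preimage continuous_subtype_val)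
    (Metric.mem_ball_self hr)
  have hsub : Subtype.val '' V ⊆ Metric.ball p r := Set.image_subset_iff.mpr hVU
  exact ⟨Subtype.val '' V, isClopen_image_val Metric.isClosed_closedBall Metric.isOpen_ball
    Metric.ball_subset_closedBall hV hsub, ⟨_, hpV, rfl⟩,
    hsub.trans (Metric.ball_subset_ball (min_le_left _ _))⟩

lemma exists_clopen_partition [CompactSpace X]
    (hs : ∀ x, @IsTotallyDisconnected X (leafTopology S.φ) (S.stableSet x))
    (hu : ∀ x, @IsTotallyDisconnected X (leafTopology S.φ.symm) (S.unstableSet x))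
    {ε : ℝ} (hε : 0 < ε) : ∃ (N : ℕ) (P : X → Fin N), (∀ p p', P p = P p' → dist p p' ≤ ε) ∧
      IsLocallyConstant P := by
  choose V hV hpV hVb using fun p : X => exists_isClopen_subset_ball hs hu p (half_pos hε)
  obtain ⟨t, ht⟩ := isCompact_univ.elim_nhds_subcover V
    fun p _ => (hV p).isOpen.mem_nhds (hpV p)
  obtain ⟨N, ⟨u⟩⟩ := Finite.exists_equiv_fin (t → Prop)
  refine ⟨N, fun p => u fun i => p ∈ V i, fun p p' h => ?_,
    (isLocallyConstant_pi fun i : t => isLocallyConstant_mem (hV i)).comp u⟩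
  obtain ⟨i, hi, hpi⟩ := Set.mem_iUnion₂.mp (ht.2 (Set.mem_univ p))
  have hpi' : p' ∈ V i := (congrFun (u.injective h) ⟨i, hi⟩).mp hpi
  linarith [Metric.mem_ball.mp (hVb i hpi), Metric.mem_ball.mp (hVb i hpi'),
    dist_triangle_right p p' i]

end SmaleSpace

end Bracket

namespace SUPair

variable {X Y Z : Type*} [MetricSpace X] [MetricSpace Y] [MetricSpace Z]
  {SX : SmaleSpace X} {SY : SmaleSpace Y} {SZ : SmaleSpace Z}
variable [CompactSpace X] [CompactSpace Y] [CompactSpace Z] (π : SUPair SX SY SZ) {L M : ℕ}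

lemma isMap_snd (m : Fin (M + 1)) : IsMap (π.shiftSpace L M) SZ fun p => p.1.2 m :=
  ⟨by fun_prop, fun _ => rfl⟩

lemma isMap_fst_reverse (l : Fin (L + 1)) :
    IsMap (π.shiftSpace L M).reverse SY.reverse fun p => p.1.1 l :=
  ⟨by fun_prop, fun _ => rfl⟩

lemma isMap_snd_reverse (m : Fin (M + 1)) :
    IsMap (π.shiftSpace L M).reverse SZ.reverse fun p => p.1.2 m :=
  ⟨by fun_prop, fun _ => rfl⟩

variable {π} in
lemma eq_of_asymptotic_of_snd_eq {p q : π.Shift L M} (h : Asymptotic (π.shiftSpace L M).φ p q)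
    (hz : ∀ m, p.1.2 m = q.1.2 m) : p = q := by
  refine shift_ext (fun l => ?_) hz
  have hp : p.1.1 l ∈ SY.stableSet (p.1.1 l) := by simp [SmaleSpace.stableSet, Asymptotic]
  refine (π.πs_sBijective.bijOn (p.1.1 l)).injOn hp ((π.asymptotic_iff.mp h).1 l) ?_
  rw [p.2 l 0, q.2 l 0, hz 0]

variable {π} in
lemma eq_of_asymptotic_of_fst_eq {p q : π.Shift L M}
    (h : Asymptotic (π.shiftSpace L M).φ.symm p q) (hy : ∀ l, p.1.1 l = q.1.1 l) : p = q := by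
  refine shift_ext hy fun m => ?_
  have hp : p.1.2 m ∈ SZ.unstableSet (p.1.2 m) := by simp [SmaleSpace.unstableSet, Asymptotic]
  refine (π.πu_uBijective.bijOn (p.1.2 m)).injOn hp ((π.isMap_snd_reverse m).asymptotic h) ?_
  rw [← p.2 0 m, ← q.2 0 m, hy 0]

lemma isTotallyDisconnected_stableSet (p : π.Shift L M) :
    @IsTotallyDisconnected _ (leafTopology (π.shiftSpace L M).φ)
      ((π.shiftSpace L M).stableSet p) := by
  intro K hK hKc x hx y hy
  refine eq_of_asymptotic_of_snd_eq ((hK hx : Asymptotic _ p x).symm.trans (hK hy)) fun m => ?_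
  refine π.stable_totallyDisconnected (p.1.2 m) ((fun p => p.1.2 m) '' K) ?_
    (@IsPreconnected.image _ _ (leafTopology (π.shiftSpace L M).φ) (leafTopology SZ.φ) K hKc _
      (@Continuous.continuousOn _ _ (leafTopology (π.shiftSpace L M).φ) (leafTopology SZ.φ) _ _
        (π.isMap_snd m).continuous_leaf))
    (Set.mem_image_of_mem _ hx) (Set.mem_image_of_mem _ hy)
  rintro _ ⟨z, hz, rfl⟩
  exact (π.isMap_snd m).asymptotic (hK hz)

lemma isTotallyDisconnected_unstableSet (p : π.Shift L M) :
    @IsTotallyDisconnected _ (leafTopology (π.shiftSpace L M).φ.symm)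
      ((π.shiftSpace L M).unstableSet p) := by
  intro K hK hKc x hx y hy
  refine eq_of_asymptotic_of_fst_eq ((hK hx : Asymptotic _ p x).symm.trans (hK hy)) fun l => ?_
  refine π.unstable_totallyDisconnected (p.1.1 l) ((fun p => p.1.1 l) '' K) ?_
    (@IsPreconnected.image _ _ (leafTopology (π.shiftSpace L M).φ.symm) (leafTopology SY.φ.symm)
      K hKc _ (@Continuous.continuousOn _ _ (leafTopology (π.shiftSpace L M).φ.symm)
        (leafTopology SY.φ.symm) _ _ (π.isMap_fst_reverse l).continuous_leaf))
    (Set.mem_image_of_mem _ hx) (Set.mem_image_of_mem _ hy)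
  rintro _ ⟨z, hz, rfl⟩
  exact (π.isMap_fst_reverse l).asymptotic (hK hz)

lemma exists_bracket_eq_of_snd_eq (L M : ℕ) : ∃ δ > 0, ∀ p q : π.Shift L M, dist p q ≤ δ →
    p.1.2 = q.1.2 → dist p q ≤ (π.shiftSpace L M).eps ∧ (π.shiftSpace L M).bracket p q = p := by
  set S := π.shiftSpace L M
  obtain ⟨δ, hδ, hδe, hd⟩ := S.near_diag S.eps_pos
  refine ⟨δ, hδ, fun p q hpq hz => ?_⟩
  have hpq' : dist p q ≤ S.eps := hpq.trans hδe
  have hpb : dist p (S.bracket p q) ≤ S.eps := (dist_comm _ _).trans_le (hd p q hpq).1.le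
  have hasymp := S.asymptotic_of_bracket hpb (S.bracket_right _ _ _ hpq' hpb hpq')
  refine ⟨hpq', (eq_of_asymptotic_of_snd_eq hasymp fun m => ?_).symm⟩
  calc p.1.2 m = SZ.bracket (p.1.2 m) (q.1.2 m) := by rw [← hz, SZ.bracket_self]
    _ = (S.bracket p q).1.2 m := (π.shiftBracket_snd hpq' m).symm

/-- A partition of `Σ_{0,M}` into finitely many clopen sets, such that for points with the same
`Z`-coordinates the present symbol determines the past itinerary. -/
structure Partition (π : SUPair SX SY SZ) (M : ℕ) where
  size : ℕ
  symbol : π.Shift 0 M → Fin size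
  isLocallyConstant : IsLocallyConstant symbol
  samePast : ∀ p p' : π.Shift 0 M, p.1.2 = p'.1.2 → symbol p = symbol p' →
    (π.shiftSpace 0 M).SamePast symbol 0 p p'

/-- Refine a partition into small sets by its itineraries between the times `-n` and `0`, where `n`
is so large that the earlier itineraries of close points with the same `Z`-coordinates agree. -/
lemma exists_partition (M : ℕ) {ε : ℝ} (hε : 0 < ε) :
    ∃ Q : π.Partition M, ∀ p p', Q.symbol p = Q.symbol p' → dist p p' ≤ ε := by
  set S := π.shiftSpace 0 M
  obtain ⟨δ, hδ, hbracket⟩ := π.exists_bracket_eq_of_snd_eq 0 M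
  obtain ⟨N, P, hP, hlc⟩ := SmaleSpace.exists_clopen_partition (S := S)
    π.isTotallyDisconnected_stableSet π.isTotallyDisconnected_unstableSet (lt_min hε hδ)
  obtain ⟨n, hn⟩ := S.exists_samePast_of_bracket_eq hlc
  obtain ⟨N', ⟨u⟩⟩ := Finite.exists_equiv_fin (Fin (n + 1) → Fin N)
  let R : π.Shift 0 M → Fin N' := fun p => u fun j => P (S.φ.symm^[j] p)
  have hR (p p' : π.Shift 0 M) (h : R p = R p') (j : ℕ) (hj : j ≤ n) :
      P (S.φ.symm^[j] p) = P (S.φ.symm^[j] p') :=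
    congrFun (u.injective h) ⟨j, Nat.lt_succ_of_le hj⟩
  have hdist (p p' : π.Shift 0 M) (h : R p = R p') : dist p p' ≤ min ε δ :=
    hP p p' (hR p p' h 0 (Nat.zero_le _))
  refine ⟨⟨N', R, ?_, fun p p' hz h k _ => congrArg u (funext fun j => ?_)⟩,
    fun p p' h => (hdist p p' h).trans (min_le_left _ _)⟩
  · exact (isLocallyConstant_pi fun j : Fin (n + 1) =>
      hlc.comp_continuous (S.isMap_symm_iterate j).continuous).comp u
  · rw [← Function.iterate_add_apply, ← Function.iterate_add_apply]
    rcases le_or_gt ((j : ℕ) + k) n with hj | hj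
    · exact hR p p' h _ hj
    · have hd : dist p' p ≤ δ := (dist_comm _ _).trans_le ((hdist p p' h).trans (min_le_right _ _))
      obtain ⟨hle, hb⟩ := hbracket p p' ((dist_comm _ _).trans_le hd) hz
      exact (hn p' p ((dist_comm _ _).trans_le hle) hb _ hj.le).symm

end SUPair

/-! ### Approximation of the dimension group -/

namespace CompactOpen

variable {X W : Type*} [MetricSpace X] [MetricSpace W] {S : SmaleSpace X} {T : SmaleSpace W}
  {G : Type*} [AddCommGroup G]

lemma IsAdditive.comp_map [CompactSpace X] {μ : CompactOpen T → G} (hμ : IsAdditive μ)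
    {f : X → W} (hf : IsSBijective S T f) : IsAdditive fun E : CompactOpen S => μ (E.map hf) := by
  intro E F H hd hH
  refine hμ _ _ _ ?_ ?_
  · have hinj : Set.InjOn f (E.1 ∪ F.1) := hH ▸ hf.injOn H.2.1
    exact Set.disjoint_image_image fun x hx y hy hxy =>
      Set.disjoint_left.mp hd hx (hinj (Or.inl hx) (Or.inr hy) hxy ▸ hy)
  · change f '' H.1 = f '' E.1 ∪ f '' F.1
    rw [hH, Set.image_union]

lemma IsAdditive.comp_cut {μ : CompactOpen S → G} (hμ : IsAdditive μ) {V : Type*} (ℓ : X → V)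
    (hℓ : ∀ E : Set X, LeafConstant S.φ fun x : E => ℓ x) (s : Set V) :
    IsAdditive fun E : CompactOpen S => μ (E.cut (fun x => ℓ x) (hℓ E.1) s) := by
  intro E F H hd hH
  refine hμ _ _ _ ?_ ?_
  · rw [cut_val, cut_val]
    exact hd.mono Set.inter_subset_left Set.inter_subset_left
  · rw [cut_val, cut_val, cut_val, hH, Set.union_inter_distrib_right]

end CompactOpen

namespace SmaleSpace

section PastGroup

variable {X W V U : Type*} [MetricSpace X] [MetricSpace W] (S : SmaleSpace X) (T : SmaleSpace W)
  (q : X → V) (r : W → U)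

/-- `E` and `F` are related by a holonomy which preserves the itineraries up to time `-n`. -/
def Holonomic (n : ℕ) (E F : CompactOpen S) : Prop :=
  LeafHomeo S.φ E.1 F.1 (S.SamePast q n)

/-- The relations of additivity and of invariance under the holonomies which preserve the
itineraries up to time `-n`. -/
def pastRelations (n : ℕ) : AddSubgroup (FreeAbelianGroup (CompactOpen S)) :=
  AddSubgroup.closure ({x | ∃ E F H : CompactOpen S, Disjoint E.1 F.1 ∧
      H.1 = E.1 ∪ F.1 ∧ x = .of H - .of E - .of F} ∪
    {x | ∃ E F, S.Holonomic q n E F ∧ x = .of E - .of F})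

/-- The labelling `q` is so fine that holonomies which preserve the itineraries up to some time
preserve the class in `D^s`. -/
def IsFine : Prop :=
  ∀ (n : ℕ) (E F : CompactOpen S), S.Holonomic q n E F → dimClass E = dimClass F

/-- The approximation of `D^s` in which only the sets related by a holonomy preserving the
itineraries up to time `-n` are identified. -/
abbrev PastGroup (n : ℕ) : Type _ :=
  FreeAbelianGroup (CompactOpen S) ⧸ S.pastRelations q n

/-- The class of a compact open set in the approximation `PastGroup` of `D^s`. -/
def pastClass (n : ℕ) (E : CompactOpen S) : S.PastGroup q n :=
  QuotientAddGroup.mk (.of E)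

/-- The direct limit of the approximations of `D^s`. -/
abbrev PastLimit : Type _ :=
  FreeAbelianGroup (CompactOpen S) ⧸ ⨆ n, S.pastRelations q n

/-- The class of a compact open set in the direct limit of the approximations of `D^s`. -/
def limitClass (E : CompactOpen S) : S.PastLimit q :=
  QuotientAddGroup.mk (.of E)

variable {S T q r} {n : ℕ}

lemma Holonomic.mono {m n : ℕ} (hmn : m ≤ n) {E F : CompactOpen S}
    (h : S.Holonomic q m E F) : S.Holonomic q n E F :=
  LeafHomeo.mono h fun _ _ hxy => hxy.mono hmn

variable (S q) in
lemma monotone_pastRelations : Monotone (S.pastRelations q) := by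
  intro m n hmn
  refine AddSubgroup.closure_mono (Set.union_subset_union_right _ ?_)
  rintro _ ⟨E, F, h, rfl⟩
  exact ⟨E, F, h.mono hmn, rfl⟩

lemma limitClass_eq_of_dimRel [CompactSpace X] (hq : IsLocallyConstant q) {E F : CompactOpen S}
    (h : DimRel S E F) : S.limitClass q E = S.limitClass q F := by
  obtain ⟨n, hn⟩ := exists_leafHomeo_of_dimRel hq h
  rw [← sub_eq_zero]
  exact (QuotientAddGroup.eq_zero_iff _).mpr (AddSubgroup.mem_iSup_of_mem n
    (AddSubgroup.subset_closure (Or.inr ⟨E, F, hn, rfl⟩)))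

lemma isAdditive_limitClass : CompactOpen.IsAdditive (S.limitClass q) := by
  intro E F H hd hH
  rw [← sub_eq_zero, ← sub_sub]
  exact (QuotientAddGroup.eq_zero_iff _).mpr (AddSubgroup.mem_iSup_of_mem 0
    (AddSubgroup.subset_closure (Or.inl ⟨E, F, H, hd, hH, rfl⟩)))

/-- The homomorphism from `D^s` to the direct limit of its approximations: two sets with the same
class in `D^s` are related by a holonomy which preserves the itineraries up to some time. -/
noncomputable def toLimit [CompactSpace X] (hq : IsLocallyConstant q) :
    DimGroup S →+ S.PastLimit q :=
  QuotientAddGroup.lift _ (FreeAbelianGroup.lift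
    (Quotient.lift (S.limitClass q) fun _ _ => limitClass_eq_of_dimRel hq)) (by
      refine (AddSubgroup.closure_le _).mpr ?_
      rintro _ ⟨E, F, H, hd, hH, rfl⟩
      change S.limitClass q H - S.limitClass q E - S.limitClass q F = 0
      rw [isAdditive_limitClass E F H hd hH, sub_sub, sub_self])

lemma toLimit_dimClass [CompactSpace X] (hq : IsLocallyConstant q) (E : CompactOpen S) :
    S.toLimit hq (dimClass E) = S.limitClass q E :=
  FreeAbelianGroup.lift_apply_of _ _

section Part

variable [CompactSpace X]

lemma leafConstant_symbol (hq : IsLocallyConstant q) (n : ℕ) (E : Set X) :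
    LeafConstant S.φ fun x : E => q (S.φ.symm^[n] x) :=
  (S.isMap_symm_iterate n).leafConstant_comp hq E

/-- The part of a compact open set with symbol `a` at time `-n`. -/
def part (hq : IsLocallyConstant q) (n : ℕ) (a : V) (E : CompactOpen S) : CompactOpen S :=
  E.cut (fun x => q (S.φ.symm^[n] x)) (leafConstant_symbol hq n E.1) {a}

lemma part_val (hq : IsLocallyConstant q) (n : ℕ) (a : V) (E : CompactOpen S) :
    (part hq n a E).1 = E.1 ∩ (fun x => q (S.φ.symm^[n] x)) ⁻¹' {a} :=
  CompactOpen.cut_val E (fun x => q (S.φ.symm^[n] x)) _ _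

lemma holonomic_part (hq : IsLocallyConstant q) (a : V) {E F : CompactOpen S}
    (h : S.Holonomic q n E F) : S.Holonomic q n (part hq n a E) (part hq n a F) := by
  rw [Holonomic, part_val, part_val]
  exact h.inter_preimage _ (fun x y hxy => hxy n le_rfl) _

end Part

namespace PastGroup

lemma hom_ext {G : Type*} [AddCommGroup G] {f g : S.PastGroup q n →+ G}
    (h : ∀ E, f (S.pastClass q n E) = g (S.pastClass q n E)) : f = g :=
  QuotientAddGroup.addMonoidHom_ext _ (FreeAbelianGroup.lift_ext _ _ h)

lemma pastClass_eq {E F : CompactOpen S} (h : S.Holonomic q n E F) :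
    S.pastClass q n E = S.pastClass q n F := by
  rw [← sub_eq_zero]
  exact (QuotientAddGroup.eq_zero_iff _).mpr (AddSubgroup.subset_closure (Or.inr ⟨E, F, h, rfl⟩))

variable (S q) in
lemma isAdditive_pastClass (n : ℕ) : CompactOpen.IsAdditive (S.pastClass q n) := by
  intro E F H hd hH
  rw [← sub_eq_zero, ← sub_sub]
  exact (QuotientAddGroup.eq_zero_iff _).mpr
    (AddSubgroup.subset_closure (Or.inl ⟨E, F, H, hd, hH, rfl⟩))

section Lift

variable {G : Type*} [AddCommGroup G] {μ : CompactOpen S → G}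

lemma pastRelations_le_ker (hμ : CompactOpen.IsAdditive μ)
    (h : ∀ E F, S.Holonomic q n E F → μ E = μ F) :
    S.pastRelations q n ≤ (FreeAbelianGroup.lift μ).ker := by
  refine (AddSubgroup.closure_le _).mpr ?_
  rintro _ (⟨E, F, H, hd, hH, rfl⟩ | ⟨E, F, hEF, rfl⟩)
  · simp [hμ E F H hd hH]
  · simp [h E F hEF]

/-- The homomorphism induced by an additive holonomy invariant function. -/
noncomputable def lift (μ : CompactOpen S → G) (hμ : CompactOpen.IsAdditive μ)
    (h : ∀ E F, S.Holonomic q n E F → μ E = μ F) : S.PastGroup q n →+ G :=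
  QuotientAddGroup.lift _ (FreeAbelianGroup.lift μ) (pastRelations_le_ker hμ h)

lemma lift_pastClass (hμ : CompactOpen.IsAdditive μ) (h : ∀ E F, S.Holonomic q n E F → μ E = μ F)
    (E : CompactOpen S) : lift μ hμ h (S.pastClass q n E) = μ E :=
  FreeAbelianGroup.lift_apply_of _ _

end Lift

section Map

variable [CompactSpace X] {f : X → W}

/-- The homomorphism `[E] ↦ [f(E)]` induced by an `s`-bijective map respecting the itineraries. -/
noncomputable def map (hf : IsSBijective S T f)
    (h : ∀ x y, S.SamePast q n x y → T.SamePast r n (f x) (f y)) :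
    S.PastGroup q n →+ T.PastGroup r n :=
  lift (fun E => T.pastClass r n (E.map hf)) ((isAdditive_pastClass T r n).comp_map hf)
    fun E F hEF => pastClass_eq (LeafHomeo.map E.2.1 F.2.1 hf hf hEF fun x _ y _ => h x y)

lemma map_pastClass (hf : IsSBijective S T f)
    (h : ∀ x y, S.SamePast q n x y → T.SamePast r n (f x) (f y)) (E : CompactOpen S) :
    map hf h (S.pastClass q n E) = T.pastClass r n (E.map hf) :=
  lift_pastClass _ _ E

end Map

section Component

variable [CompactSpace X]

/-- The projection onto the classes of the sets with symbol `a` at time `-n`. -/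
noncomputable def component (hq : IsLocallyConstant q) (n : ℕ) (a : V) :
    S.PastGroup q n →+ S.PastGroup q n :=
  lift (fun E => S.pastClass q n (part hq n a E))
    ((isAdditive_pastClass S q n).comp_cut (fun x => q (S.φ.symm^[n] x))
      (leafConstant_symbol hq n) {a})
    fun _ _ h => pastClass_eq (holonomic_part hq a h)

lemma component_pastClass (hq : IsLocallyConstant q) (a : V) (E : CompactOpen S) :
    component hq n a (S.pastClass q n E) = S.pastClass q n (part hq n a E) :=
  lift_pastClass _ _ E

lemma sum_component [Fintype V] (hq : IsLocallyConstant q) (x : S.PastGroup q n) :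
    ∑ a, component hq n a x = x := by
  suffices h : ∑ a, component hq n a = AddMonoidHom.id (S.PastGroup q n) by
    simpa only [AddMonoidHom.finsetSum_apply, AddMonoidHom.id_apply] using DFunLike.congr_fun h x
  refine hom_ext fun E => ?_
  simp only [AddMonoidHom.finsetSum_apply, component_pastClass, AddMonoidHom.id_apply]
  exact (isAdditive_pastClass S q n).sum_cut E _ (leafConstant_symbol hq n E.1)

end Component

section Limit

variable (S q) in
/-- The transition homomorphism from time `0` to time `-n`. -/
noncomputable def trans (n : ℕ) : S.PastGroup q 0 →+ S.PastGroup q n :=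
  lift (S.pastClass q n) (isAdditive_pastClass S q n) fun _ _ h =>
    pastClass_eq (h.mono (Nat.zero_le n))

lemma trans_pastClass (n : ℕ) (E : CompactOpen S) :
    trans S q n (S.pastClass q 0 E) = S.pastClass q n E :=
  lift_pastClass _ _ E

/-- The homomorphism `[E] ↦ [E]` from an approximation to `D^s`. -/
noncomputable def toDimGroup (hfine : S.IsFine q) (n : ℕ) : S.PastGroup q n →+ DimGroup S :=
  lift dimClass CompactOpen.isAdditive_dimClass (hfine n)

lemma toDimGroup_pastClass (hfine : S.IsFine q) (E : CompactOpen S) :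
    toDimGroup hfine n (S.pastClass q n E) = dimClass E :=
  lift_pastClass _ _ E

lemma toDimGroup_trans (hfine : S.IsFine q) (x : S.PastGroup q 0) :
    toDimGroup hfine n (trans S q n x) = toDimGroup hfine 0 x := by
  suffices h : (toDimGroup hfine n).comp (trans S q n) = toDimGroup hfine 0 from
    DFunLike.congr_fun h x
  refine hom_ext fun E => ?_
  simp only [AddMonoidHom.comp_apply, trans_pastClass, toDimGroup_pastClass]

lemma toDimGroup_surjective (hfine : S.IsFine q) (n : ℕ) :
    Function.Surjective (toDimGroup hfine n) := by
  refine (QuotientAddGroup.mk'_surjective _).forall.mpr fun c => ?_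
  change _ ∈ (toDimGroup hfine n).range
  induction c using FreeAbelianGroup.induction_on with
  | zero => exact zero_mem _
  | of c =>
    induction c using Quotient.inductionOn with
    | h E => exact ⟨S.pastClass q n E, toDimGroup_pastClass hfine E⟩
  | neg c ih => exact neg_mem ih
  | add c c' ih ih' => exact add_mem ih ih'

lemma toLimit_toDimGroup [CompactSpace X] (hq : IsLocallyConstant q) (hfine : S.IsFine q)
    (c : FreeAbelianGroup (CompactOpen S)) :
    S.toLimit hq (toDimGroup hfine 0 (QuotientAddGroup.mk c)) = QuotientAddGroup.mk c := by
  suffices h : ((S.toLimit hq).comp (toDimGroup hfine 0)).comp (QuotientAddGroup.mk' _) =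
      QuotientAddGroup.mk' _ from DFunLike.congr_fun h c
  refine FreeAbelianGroup.lift_ext _ _ fun E => ?_
  exact (congrArg (S.toLimit hq) (toDimGroup_pastClass (n := 0) hfine E)).trans
    (toLimit_dimClass hq E)

lemma trans_mk (n : ℕ) (c : FreeAbelianGroup (CompactOpen S)) :
    trans S q n (QuotientAddGroup.mk c) = QuotientAddGroup.mk c := by
  suffices h : (trans S q n).comp (QuotientAddGroup.mk' _) = QuotientAddGroup.mk' _ from
    DFunLike.congr_fun h c
  exact FreeAbelianGroup.lift_ext _ _ fun E => trans_pastClass n E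

theorem exists_trans_eq_zero [CompactSpace X] (hq : IsLocallyConstant q) (hfine : S.IsFine q)
    {x : S.PastGroup q 0} (hx : toDimGroup hfine 0 x = 0) : ∃ n, trans S q n x = 0 := by
  obtain ⟨c, rfl⟩ := QuotientAddGroup.mk_surjective x
  have hc : (QuotientAddGroup.mk c : S.PastLimit q) = 0 := by
    rw [← toLimit_toDimGroup hq hfine, hx, map_zero]
  obtain ⟨n, hn⟩ := (AddSubgroup.mem_iSup_of_directed
    (monotone_pastRelations S q).directed_le).mp ((QuotientAddGroup.eq_zero_iff _).mp hc)
  exact ⟨n, (trans_mk n c).trans ((QuotientAddGroup.eq_zero_iff _).mpr hn)⟩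

end Limit

end PastGroup

end PastGroup

end SmaleSpace

/-! ### The complex of an s/u-bijective pair -/

namespace SUPair

variable {X Y Z : Type*} [MetricSpace X] [MetricSpace Y] [MetricSpace Z]
  {SX : SmaleSpace X} {SY : SmaleSpace Y} {SZ : SmaleSpace Z}
variable [CompactSpace X] [CompactSpace Y] [CompactSpace Z]

section Chains

variable (π : SUPair SX SY SZ) (M : ℕ)

/-- The groups `C_{L,M}` for fixed `M`, with the homomorphisms induced by the reindexings of
`y_0, …, y_L`. -/
noncomputable def symmetricSystem : SymmetricSystem where
  obj L := π.chains L M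
  pull θ := π.pull M θ
  pull_pull := π.pull_pull
  pull_id := π.pull_id

lemma bdy_symmetricSystem (L : ℕ) : (π.symmetricSystem M).bdy L = π.boundary L M :=
  AddMonoidHom.ext fun a => ((π.symmetricSystem M).bdy_apply a).trans (π.boundary_apply a).symm

lemma degenerate_le_DC (L : ℕ) : π.degenerate M L ≤ (π.symmetricSystem M).DC L := by
  cases L with
  | zero => exact bot_le
  | succ L =>
    refine iSup_le fun l => iSup_le fun q => iSup_le fun _ => ?_
    rintro _ ⟨c, rfl⟩
    let θ : Fin (L + 2) → Fin (L + 1) := Fin.insertNth (α := fun _ => Fin (L + 1)) q l id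
    have hsection : θ ∘ q.succAbove = id := funext fun i => by simp [θ]
    have hθ : π.pull M (q.succAbove ∘ θ) (π.pull M θ c) = π.pull M θ c := by
      rw [π.pull_pull, ← Function.comp_assoc, hsection, Function.id_comp]
    change π.pull M θ c ∈ _
    rw [← hθ]
    refine (π.symmetricSystem M).pull_mem_DC (fun hinj => Fin.succAbove_ne q l ?_) _
    refine hinj (congrArg q.succAbove ?_)
    simp [θ]

lemma DC_symmetricSystem (L : ℕ) : (π.symmetricSystem M).DC L = π.DC M L := by
  refine le_antisymm (SymmetricSystem.DC_le (fun θ hθ a => ?_) fun α a => ?_)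
    (sup_le (π.degenerate_le_DC M L) ((AddSubgroup.closure_le _).mpr ?_))
  · obtain ⟨i, j, hij, hne⟩ := Function.not_injective_iff.mp hθ
    rcases lt_or_gt_of_ne hne with h | h
    · exact AddSubgroup.mem_sup_left (π.pull_mem_degenerate θ i j h hij a)
    · exact AddSubgroup.mem_sup_left (π.pull_mem_degenerate θ j i h hij.symm a)
  · refine AddSubgroup.mem_sup_right ?_
    have h := π.perm_sub_mem α⁻¹ a
    rwa [perm, inv_inv, Equiv.Perm.sign_inv] at h
  · rintro _ ⟨α, a, rfl⟩
    have h := (π.symmetricSystem M).pull_perm_sub_mem_DC α⁻¹ a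
    rwa [Equiv.Perm.sign_inv] at h

end Chains

variable {π : SUPair SX SY SZ} {J K L M : ℕ}

lemma reindex_symm_iterate (θ : Fin (K + 1) → Fin (L + 1)) (k : ℕ) (p : π.Shift L M) :
    π.reindex M θ ((π.shiftSpace L M).φ.symm^[k] p) =
      (π.shiftSpace K M).φ.symm^[k] (π.reindex M θ p) :=
  (Function.Semiconj.iterate_right (f := π.reindex M θ) (ga := (π.shiftSpace L M).φ.symm)
    (gb := (π.shiftSpace K M).φ.symm) (fun _ => rfl) k) p

namespace Partition

open SmaleSpace

variable (Q : π.Partition M) {n : ℕ}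

/-- The symbols of the points `(y_l, z_0, …, z_M)` of `Σ_{0,M}`. -/
def label (p : π.Shift L M) : Fin (L + 1) → Fin Q.size :=
  fun l => Q.symbol (π.reindex M (fun _ : Fin (0 + 1) => l) p)

lemma label_reindex (θ : Fin (K + 1) → Fin (L + 1)) (p : π.Shift L M) :
    Q.label (π.reindex M θ p) = Q.label p ∘ θ := rfl

lemma isLocallyConstant_label (L : ℕ) :
    IsLocallyConstant (Q.label : π.Shift L M → Fin (L + 1) → Fin Q.size) :=
  isLocallyConstant_pi fun _ =>
    Q.isLocallyConstant.comp_continuous (π.reindex_isStrict M _).continuous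

variable {Q}

lemma samePast_reindex (θ : Fin (K + 1) → Fin (L + 1)) (p p' : π.Shift L M)
    (h : (π.shiftSpace L M).SamePast Q.label n p p') :
    (π.shiftSpace K M).SamePast Q.label n (π.reindex M θ p) (π.reindex M θ p') := fun k hk => by
  rw [← reindex_symm_iterate, ← reindex_symm_iterate, label_reindex, label_reindex, h k hk]

lemma label_symm_iterate_congr {p : π.Shift L M} {l l' : Fin (L + 1)}
    (h : Q.label p l = Q.label p l') (k : ℕ) :
    Q.label ((π.shiftSpace L M).φ.symm^[k] p) l = Q.label ((π.shiftSpace L M).φ.symm^[k] p) l' := by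
  simp only [label, reindex_symm_iterate]
  exact Q.samePast (π.reindex M (fun _ => l) p) (π.reindex M (fun _ => l') p) rfl h k
    (Nat.zero_le k)

lemma samePast_reindex_of_label {p : π.Shift L M} {a : Fin (L + 1) → Fin Q.size}
    (hp : Q.label ((π.shiftSpace L M).φ.symm^[n] p) = a) {θ θ' : Fin (K + 1) → Fin (L + 1)}
    (h : a ∘ θ = a ∘ θ') :
    (π.shiftSpace K M).SamePast Q.label n (π.reindex M θ p) (π.reindex M θ' p) := by
  intro k hk
  obtain ⟨j, rfl⟩ := Nat.exists_eq_add_of_le' hk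
  simp only [Function.iterate_add_apply, ← reindex_symm_iterate, label_reindex]
  refine funext fun l => label_symm_iterate_congr ?_ j
  rw [hp]
  exact congrFun h l

variable (Q)

/-- The homomorphism induced by a reindexing on the approximations of `D^s(Σ_{L,M})`. -/
noncomputable def pull (n : ℕ) (θ : Fin (K + 1) → Fin (L + 1)) :
    (π.shiftSpace L M).PastGroup Q.label n →+ (π.shiftSpace K M).PastGroup Q.label n :=
  PastGroup.map (π.reindex_isStrict M θ).toIsSBijective (samePast_reindex θ)

/-- The part of the approximation of `D^s(Σ_{L,M})` with the labels `a` at time `-n`. -/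
noncomputable def proj (n : ℕ) (a : Fin (L + 1) → Fin Q.size) :
    (π.shiftSpace L M).PastGroup Q.label n →+ (π.shiftSpace L M).PastGroup Q.label n :=
  PastGroup.component (Q.isLocallyConstant_label L) n a

variable {Q}

lemma pull_pastClass (θ : Fin (K + 1) → Fin (L + 1)) (E : CompactOpen (π.shiftSpace L M)) :
    Q.pull n θ ((π.shiftSpace L M).pastClass Q.label n E) =
      (π.shiftSpace K M).pastClass Q.label n (E.map (π.reindex_isStrict M θ).toIsSBijective) :=
  PastGroup.map_pastClass _ _ E

lemma proj_pastClass (a : Fin (L + 1) → Fin Q.size) (E : CompactOpen (π.shiftSpace L M)) :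
    Q.proj n a ((π.shiftSpace L M).pastClass Q.label n E) =
      (π.shiftSpace L M).pastClass Q.label n (part (Q.isLocallyConstant_label L) n a E) :=
  PastGroup.component_pastClass _ a E

lemma pull_pull (θ : Fin (K + 1) → Fin (L + 1)) (τ : Fin (J + 1) → Fin (K + 1))
    (x : (π.shiftSpace L M).PastGroup Q.label n) :
    Q.pull n τ (Q.pull n θ x) = Q.pull n (θ ∘ τ) x := by
  suffices h : (Q.pull n τ).comp (Q.pull n θ) = Q.pull n (θ ∘ τ) from DFunLike.congr_fun h x
  refine PastGroup.hom_ext fun E => ?_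
  simp only [AddMonoidHom.comp_apply, pull_pastClass]
  congr 1
  exact Subtype.ext (Set.image_comp (π.reindex M τ) (π.reindex M θ) E.1).symm

lemma pull_id (x : (π.shiftSpace L M).PastGroup Q.label n) : Q.pull n id x = x := by
  suffices h : Q.pull n id = AddMonoidHom.id ((π.shiftSpace L M).PastGroup Q.label n) from
    DFunLike.congr_fun h x
  refine PastGroup.hom_ext fun E => ?_
  simp only [AddMonoidHom.id_apply, pull_pastClass]
  congr 1
  exact Subtype.ext (Set.image_id E.1)

section Labels

variable {a : Fin (L + 1) → Fin Q.size} {θ : Fin (K + 1) → Fin (L + 1)}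

lemma label_of_mem_map_part {E : CompactOpen (π.shiftSpace L M)} {p : π.Shift K M}
    (hp : p ∈ ((part (Q.isLocallyConstant_label L) n a E).map
      (π.reindex_isStrict M θ).toIsSBijective).1) :
    Q.label ((π.shiftSpace K M).φ.symm^[n] p) = a ∘ θ := by
  obtain ⟨p, hp, rfl⟩ := hp
  rw [part_val] at hp
  rw [← reindex_symm_iterate, label_reindex]
  exact congrArg (· ∘ θ) hp.2

lemma proj_pull_proj (x : (π.shiftSpace L M).PastGroup Q.label n) :
    Q.proj n (a ∘ θ) (Q.pull n θ (Q.proj n a x)) = Q.pull n θ (Q.proj n a x) := by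
  suffices h : (Q.proj n (a ∘ θ)).comp ((Q.pull n θ).comp (Q.proj n a)) =
      (Q.pull n θ).comp (Q.proj n a) from DFunLike.congr_fun h x
  refine PastGroup.hom_ext fun E => ?_
  simp only [AddMonoidHom.comp_apply, pull_pastClass, proj_pastClass]
  congr 1
  refine Subtype.ext ?_
  rw [part_val]
  exact Set.inter_eq_left.mpr fun _ hp => label_of_mem_map_part hp

lemma proj_pull_proj_of_ne {b : Fin (K + 1) → Fin Q.size} (hb : b ≠ a ∘ θ)
    (x : (π.shiftSpace L M).PastGroup Q.label n) :
    Q.proj n b (Q.pull n θ (Q.proj n a x)) = 0 := by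
  suffices h : (Q.proj n b).comp ((Q.pull n θ).comp (Q.proj n a)) = 0 from DFunLike.congr_fun h x
  refine PastGroup.hom_ext fun E => ?_
  simp only [AddMonoidHom.comp_apply, pull_pastClass, proj_pastClass]
  refine (PastGroup.isAdditive_pastClass _ _ n).eq_zero ?_
  rw [part_val]
  refine Set.eq_empty_of_forall_notMem fun p hp => hb ?_
  rw [← label_of_mem_map_part hp.1]
  exact hp.2.symm

lemma pull_proj_congr {θ' : Fin (K + 1) → Fin (L + 1)} (h : a ∘ θ = a ∘ θ')
    (x : (π.shiftSpace L M).PastGroup Q.label n) :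
    Q.pull n θ (Q.proj n a x) = Q.pull n θ' (Q.proj n a x) := by
  suffices h : (Q.pull n θ).comp (Q.proj n a) = (Q.pull n θ').comp (Q.proj n a) from
    DFunLike.congr_fun h x
  refine PastGroup.hom_ext fun E => ?_
  simp only [AddMonoidHom.comp_apply, pull_pastClass, proj_pastClass]
  refine PastGroup.pastClass_eq (LeafHomeo.map (r := Eq) (part _ n a E).2.1 (part _ n a E).2.1
    (π.reindex_isStrict M θ).toIsSBijective (π.reindex_isStrict M θ').toIsSBijective
    (.refl fun _ => rfl) ?_)
  rintro p hp _ _ rfl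
  rw [part_val] at hp
  exact samePast_reindex_of_label hp.2 h

end Labels

variable (Q) in
/-- The approximations at time `-n` of the groups `C_{L,M}`, graded by the labels at time `-n`. -/
noncomputable def system (n : ℕ) : LabelledSystem (Fin Q.size) where
  obj L := (π.shiftSpace L M).PastGroup Q.label n
  pull := Q.pull n
  proj := Q.proj n
  pull_pull := pull_pull
  pull_id := pull_id
  sum_proj := PastGroup.sum_component _
  proj_pull_proj _ _ := proj_pull_proj
  proj_pull_proj_of_ne _ _ _ x hb := proj_pull_proj_of_ne hb x
  pull_congr _ _ _ x h := pull_proj_congr h x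

lemma intertwines_trans (n K L : ℕ) : SymmetricSystem.Intertwines
    (A := (Q.system 0).toSymmetricSystem) (B := (Q.system n).toSymmetricSystem)
    (PastGroup.trans (π.shiftSpace L M) Q.label n)
    (PastGroup.trans (π.shiftSpace K M) Q.label n) := by
  intro θ x
  suffices h : (PastGroup.trans (π.shiftSpace K M) Q.label n).comp (Q.pull 0 θ) =
    (Q.pull n θ).comp (PastGroup.trans (π.shiftSpace L M) Q.label n) from DFunLike.congr_fun h x
  refine PastGroup.hom_ext fun E => ?_
  simp only [AddMonoidHom.comp_apply, pull_pastClass, PastGroup.trans_pastClass]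

lemma intertwines_toDimGroup (n : ℕ) (hL : (π.shiftSpace L M).IsFine Q.label)
    (hK : (π.shiftSpace K M).IsFine Q.label) : SymmetricSystem.Intertwines
      (A := (Q.system n).toSymmetricSystem) (B := π.symmetricSystem M)
      (PastGroup.toDimGroup hL n) (PastGroup.toDimGroup hK n) := by
  intro θ x
  suffices h : (PastGroup.toDimGroup hK n).comp (Q.pull n θ) =
    (dimMap (π.reindex_isStrict M θ)).comp (PastGroup.toDimGroup hL n) from DFunLike.congr_fun h x
  refine PastGroup.hom_ext fun E => ?_
  simp only [AddMonoidHom.comp_apply, pull_pastClass, PastGroup.toDimGroup_pastClass]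
  exact (dimMap_dimClass (π.reindex_isStrict M θ) E).symm

end Partition

end SUPair

namespace SUPair

variable {X Y Z : Type*} [MetricSpace X] [MetricSpace Y] [MetricSpace Z]
  {SX : SmaleSpace X} {SY : SmaleSpace Y} {SZ : SmaleSpace Z}
variable [CompactSpace X] [CompactSpace Y] [CompactSpace Z] (π : SUPair SX SY SZ)

lemma exists_isFine_label (L M : ℕ) : ∃ δ > 0, ∀ Q : π.Partition M,
    (∀ p p', Q.symbol p = Q.symbol p' → dist p p' ≤ δ) → (π.shiftSpace L M).IsFine Q.label := by
  obtain ⟨δ, hδ, h⟩ := (π.shiftSpace L M).exists_dimClass_eq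
  refine ⟨δ, hδ, fun Q hQ => h (fun p p' hpp => ?_) (Q.isLocallyConstant_label L)⟩
  have hdist (l : Fin (L + 1)) :
      dist (π.reindex M (fun _ : Fin (0 + 1) => l) p) (π.reindex M (fun _ => l) p') ≤ δ :=
    hQ _ _ (congrFun hpp l)
  exact (dist_le_iff hδ.le).mpr ⟨fun l => (dist_fst_le _ _ 0).trans (hdist l), fun m =>
    (dist_snd_le (π.reindex M (fun _ : Fin (0 + 1) => 0) p) (π.reindex M (fun _ => 0) p') m).trans
      (hdist 0)⟩

lemma exists_partition_isFine (N M : ℕ) :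
    ∃ Q : π.Partition M, ∀ L ≤ N, (π.shiftSpace L M).IsFine Q.label := by
  choose δ hδ hfine using fun L => π.exists_isFine_label L M
  have hne : (Finset.range (N + 1)).Nonempty := Finset.nonempty_range_add_one
  obtain ⟨Q, hQ⟩ := π.exists_partition M ((Finset.lt_inf'_iff hne).mpr fun L _ => hδ L)
  exact ⟨Q, fun L hL => hfine L Q fun p p' h =>
    (hQ p p' h).trans (Finset.inf'_le δ (Finset.mem_range_succ_iff.mpr hL))⟩

theorem exists_bdy_eq {L M : ℕ} {c : (π.symmetricSystem M).obj (L + 1)}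
    (hc : c ∈ (π.symmetricSystem M).DC (L + 1)) (h : (π.symmetricSystem M).bdy L c = 0) :
    ∃ b ∈ (π.symmetricSystem M).DC (L + 2), (π.symmetricSystem M).bdy (L + 1) b = c := by
  obtain ⟨Q, hQ⟩ := π.exists_partition_isFine (L + 2) M
  have h₀ := hQ L (by omega)
  have h₁ := hQ (L + 1) (by omega)
  have h₂ := hQ (L + 2) le_rfl
  obtain ⟨x, hx, rfl⟩ := (Partition.intertwines_toDimGroup 0 h₁ h₁).exists_mem_DC_eq
    (SmaleSpace.PastGroup.toDimGroup_surjective h₁ 0) hc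
  rw [← (Partition.intertwines_toDimGroup 0 h₁ h₀).map_bdy] at h
  obtain ⟨n, hn⟩ := SmaleSpace.PastGroup.exists_trans_eq_zero (Q.isLocallyConstant_label L) h₀ h
  have hcycle := ((Partition.intertwines_trans n L (L + 1)).map_bdy x).symm.trans hn
  obtain ⟨y, hy, hyx⟩ := (Q.system n).exists_bdy_eq
    ((Partition.intertwines_trans n (L + 1) (L + 1)).map_mem_DC hx) hcycle
  refine ⟨_, (Partition.intertwines_toDimGroup n h₂ h₂).map_mem_DC hy, ?_⟩
  rw [← (Partition.intertwines_toDimGroup n h₂ h₁).map_bdy]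
  exact (congrArg _ hyx).trans (SmaleSpace.PastGroup.toDimGroup_trans h₁ x)

theorem exists_boundary_eq {L M : ℕ} {c : π.chains (L + 1) M} (hc : c ∈ π.DC M (L + 1))
    (h : π.boundary L M c = 0) : ∃ b ∈ π.DC M (L + 2), π.boundary (L + 1) M b = c := by
  simp only [← DC_symmetricSystem, ← bdy_symmetricSystem] at hc h ⊢
  exact π.exists_bdy_eq hc h

lemma DC_zero (M : ℕ) : π.DC M 0 = ⊥ :=
  (π.DC_symmetricSystem M 0).symm.trans SymmetricSystem.DC_zero

open CategoryTheory

lemma acyclic_degenerateComplex (M : ℕ) : (π.degenerateComplex M).Acyclic := by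
  intro L
  cases L with
  | zero =>
    rw [HomologicalComplex.exactAt_iff' _ 1 0 0 (by simp) (by simp), ShortComplex.ab_exact_iff]
    intro x _
    refine ⟨0, (map_zero _).trans (Subtype.ext ?_)⟩
    exact (AddSubgroup.mem_bot.mp (π.DC_zero M ▸ x.2)).symm
  | succ L =>
    rw [HomologicalComplex.exactAt_iff' _ (L + 2) (L + 1) L (by simp) (by simp),
      ShortComplex.ab_exact_iff]
    have hd : ∀ L, (π.degenerateComplex M).d (L + 1) L =
        AddCommGrpCat.ofHom (π.boundaryDC L M) :=
      ChainComplex.of_d (fun L => AddCommGrpCat.of (π.DC M L))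
        (fun L => AddCommGrpCat.ofHom (π.boundaryDC L M))
    intro x hx
    change (π.degenerateComplex M).d (L + 1) L x = 0 at hx
    rw [hd] at hx
    obtain ⟨b, hb, hbx⟩ := π.exists_boundary_eq x.2 (congrArg Subtype.val hx)
    refine ⟨⟨b, hb⟩, ?_⟩
    change (π.degenerateComplex M).d (L + 2) (L + 1) _ = x
    rw [hd]
    exact Subtype.ext hbx

lemma shortExact_shortComplex (M : ℕ) : (π.shortComplex M).ShortExact := by
  refine HomologicalComplex.shortExact_of_degreewise_shortExact _ fun L => ?_
  refine
    { exact := ?_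
      mono_f := (AddCommGrpCat.mono_iff_injective _).mpr Subtype.val_injective
      epi_g := (AddCommGrpCat.epi_iff_surjective _).mpr
        (QuotientAddGroup.mk'_surjective (π.DC M L)) }
  rw [ShortComplex.ab_exact_iff]
  intro x hx
  exact ⟨⟨x, (QuotientAddGroup.eq_zero_iff (N := π.DC M L) (x : π.chains L M)).mp hx⟩, rfl⟩

end SUPair

open CategoryTheory in
lemma quasiIso_g_of_acyclic {C ι : Type*} [Category C] [Abelian C] {c : ComplexShape ι}
    {S : ShortComplex (HomologicalComplex C c)} (hS : S.ShortExact) (h : S.X₁.Acyclic) :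
    QuasiIso S.g := by
  have hzero : ∀ i, Limits.IsZero (S.X₁.homology i) := fun i =>
    (HomologicalComplex.exactAt_iff_isZero_homology _ _).mp (h i)
  refine ⟨fun i => ?_⟩
  rw [quasiIsoAt_iff_isIso_homologyMap]
  have hmono : Mono (HomologicalComplex.homologyMap S.g i) :=
    (hS.homology_exact₂ i).mono_g ((hzero i).eq_of_src _ _)
  have hepi : Epi (HomologicalComplex.homologyMap S.g i) := by
    by_cases hi : ∃ j, c.Rel i j
    · obtain ⟨j, hij⟩ := hi
      exact (hS.homology_exact₃ i j hij).epi_f ((hzero j).eq_of_tgt _ _)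
    · have := hS.epi_g
      exact HomologicalComplex.epi_homologyMap_of_epi_of_not_rel S.g i (by simpa using hi)
  exact isIso_of_mono_of_epi _

end SmaleHomology

theorem mainTheorem2 {X Y Z : Type*} [MetricSpace X] [CompactSpace X] [MetricSpace Y]
    [CompactSpace Y] [MetricSpace Z] [CompactSpace Z] {SX : SmaleHomology.SmaleSpace X}
    {SY : SmaleHomology.SmaleSpace Y} {SZ : SmaleHomology.SmaleSpace Z}
    (π : SmaleHomology.SUPair SX SY SZ) (M : ℕ) :
    (π.shortComplex M).ShortExact ∧ (π.degenerateComplex M).Acyclic ∧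
      QuasiIso (π.projection M) :=
  ⟨π.shortExact_shortComplex M, π.acyclic_degenerateComplex M,
    SmaleHomology.quasiIso_g_of_acyclic (π.shortExact_shortComplex M)
      (π.acyclic_degenerateComplex M)⟩
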